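/- Let $p\in(1,\infty)$, let $(X,d)$ be a complete separable metric space, and let $m$ be a Borel measure on $X$ that is finite on balls. For a Lipschitz function $g:X\to\mathbb R$ put $\mathrm{lip}(g)(x)=\limsup_{y\to x}\frac{|g(x)-g(y)|}{d(x,y)}$ (and $\mathrm{lip}(g)(x)=0$ if $x$ is isolated), and let $\mathrm{LIP}_{bs}(X)$ be the set of real-valued Lipschitz functions on $X$ with bounded support. Write $B_r(x)$ for the open ball of radius $r$ around $x$. Assume that $(X,d,m)$ is a $p$-PI space, that is, there are constants $C_D,C_P>0$ such that for every $x\in X$ and $r>0$ $$m(B_{2r}(x))\le C_D\, m(B_r(x))$$ and, for every $g\in \mathrm{LIP}_{bs}(X)$, $$\frac{1}{m(B_r(x))}\int_{B_r(x)}|g-g_{B_r(x)}|\,dm\le C_P\, r\Big(\frac{1}{m(B_r(x))}\int_{B_r(x)}\mathrm{lip}(g)^p\,dm\Big)^{1/p},\qquad g_{B_r(x)}=\frac{1}{m(B_r(x))}\int_{B_r(x)}g\,dm$$ (averages over balls of measure zero, which occur only if $m=0$, are read as $0$). For $f\in L^p(m)$ let $$\mathrm{Ch}_p(f)=\inf\Big\{\liminf_{n\to\infty}\int_X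 \mathrm{lip}(f_n)^p\,dm \;:\; f_n\in \mathrm{LIP}_{bs}(X)\cap L^p(m),\ f_n\to f \text{ in } L^p(m)\Big\},$$ and let $W^{1,p}(X)=\{f\in L^p(m):\mathrm{Ch}_p(f)<\infty\}$. Let $f\in L^p(m)$. Then $f\in W^{1,p}(X)$ if and only if both $$\sup_{\delta\in(0,1)}\iint_{|f(x)-f(y)|\le 1}\frac{\delta\,|f(x)-f(y)|^{p+\delta}}{m(B_{d(x,y)}(x))\,d(x,y)^p}\,dm(y)\,dm(x)<\infty$$ and $$\iint_{|f(x)-f(y)|>1}\frac{1}{m(B_{d(x,y)}(x))\,d(x,y)^p}\,dm(y)\,dm(x)<\infty,$$ where the integrand of the first integral is read as $0$ on the diagonal $x=y$. -/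

import Mathlib

open MeasureTheory Filter Topology
open scoped NNReal ENNReal

/-- The slope `lip(g)(x) = limsup_{y → x, y ≠ x} |g(x) - g(y)| / d(x, y)`, with values in `[0, ∞]`.
At an isolated point the filter `𝓝[≠] x` is trivial and the slope is `0`. -/
noncomputable def slopeAt {X : Type*} [MetricSpace X] (g : X → ℝ) (x : X) : ℝ≥0∞ :=
  limsup (fun y => edist (g x) (g y) / edist x y) (𝓝[≠] x)

/-- `g` is Lipschitz with bounded support. -/
def IsLipBS {X : Type*} [MetricSpace X] (g : X → ℝ) : Prop :=
  (∃ K : ℝ≥0, LipschitzWith K g) ∧ Bornology.IsBounded (Function.support g)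

/-- The Cheeger `p`-energy: the infimum of `liminf_n ∫ lip(u_n)^p dm` over all sequences of
functions in `L^p(m)` that are Lipschitz with bounded support and converge to `f` in `L^p(m)`. -/
noncomputable def cheegerEnergy {X : Type*} [MetricSpace X] [MeasurableSpace X]
    (p : ℝ) (m : Measure X) (f : X → ℝ) : ℝ≥0∞ :=
  ⨅ (u : ℕ → X → ℝ) (_ : ∀ n, IsLipBS (u n) ∧ MemLp (u n) (ENNReal.ofReal p) m)
    (_ : Tendsto (fun n => eLpNorm (u n - f) (ENNReal.ofReal p) m) atTop (𝓝 0)),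
    liminf (fun n => ∫⁻ x, slopeAt (u n) x ^ p ∂m) atTop

/-- The Sobolev space `W^{1,p}(X)`: functions in `L^p(m)` of finite Cheeger `p`-energy. -/
def sobolevW1 {X : Type*} [MetricSpace X] [MeasurableSpace X]
    (p : ℝ) (m : Measure X) : Set (X → ℝ) :=
  {f | MemLp f (ENNReal.ofReal p) m ∧ cheegerEnergy p m f < ∞}

/-- `m` is uniformly doubling. -/
def IsUnifDoubling {X : Type*} [MetricSpace X] [MeasurableSpace X] (m : Measure X) : Prop :=
  ∃ C : ℝ≥0, 0 < C ∧ ∀ (x : X) (r : ℝ), 0 < r →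
    m (Metric.ball x (2 * r)) ≤ C * m (Metric.ball x r)

/-- The `(1,p)`-Poincaré inequality for Lipschitz functions with bounded support. -/
def SupportsPoincare {X : Type*} [MetricSpace X] [MeasurableSpace X]
    (p : ℝ) (m : Measure X) : Prop :=
  ∃ C : ℝ≥0, 0 < C ∧ ∀ g : X → ℝ, IsLipBS g → ∀ (x : X) (r : ℝ), 0 < r →
    ⨍⁻ y in Metric.ball x r, ‖g y - ⨍ z in Metric.ball x r, g z ∂m‖ₑ ∂m ≤
      C * ENNReal.ofReal r * (⨍⁻ y in Metric.ball x r, slopeAt g y ^ p ∂m) ^ (1 / p)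

/-- The measure-theoretic part of being a `p`-PI space; completeness and separability of the
metric space and the Borel property of its σ-algebra are separate type-class assumptions. -/
structure IsPISpace {X : Type*} [MetricSpace X] [MeasurableSpace X]
    (p : ℝ) (m : Measure X) : Prop where
  ball_finite : ∀ (x : X) (r : ℝ), m (Metric.ball x r) < ∞
  doubling : IsUnifDoubling m
  poincare : SupportsPoincare p m

/-- The functional `J_δ(f)`, the iterated integral over `{|f(x) - f(y)| ≤ 1}` of
`δ |f(x) - f(y)|^{p+δ} / (m(B_{d(x,y)}(x)) d(x,y)^p)`.
On the diagonal the numerator vanishes, and so does the quotient in `[0, ∞]`. -/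
noncomputable def functionalJ {X : Type*} [MetricSpace X] [MeasurableSpace X]
    (p : ℝ) (m : Measure X) (f : X → ℝ) (δ : ℝ) : ℝ≥0∞ :=
  ∫⁻ x, ∫⁻ y in {y | |f x - f y| ≤ 1},
    (ENNReal.ofReal δ * ENNReal.ofReal |f x - f y| ^ (p + δ)) /
      (m (Metric.ball x (dist x y)) * edist x y ^ p) ∂m ∂m

/-- The iterated integral over `{|f(x) - f(y)| > 1}` of `1 / (m(B_{d(x,y)}(x)) d(x,y)^p)`. -/
noncomputable def largeOscIntegral {X : Type*} [MetricSpace X] [MeasurableSpace X]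
    (p : ℝ) (m : Measure X) (f : X → ℝ) : ℝ≥0∞ :=
  ∫⁻ x, ∫⁻ y in {y | 1 < |f x - f y|},
    1 / (m (Metric.ball x (dist x y)) * edist x y ^ p) ∂m ∂m

/-! Finite Cheeger energy implies finite functionals. For a Lipschitz u let S(x) be the supremum,
over balls containing x, of mean oscillation divided by radius. Telescoping averages gives |u(x) -
u(y)| ≤ C d(x,y) (S(x) + S(y)) (`edist_le_sharpMax`). Truncate differences at 1 and split the inner
integral into dyadic annuli: the sum over scales is at most a geometric series of ratio 2^(-δ), of
size 1/δ, plus a convergent one, and the factor δ compensates. So both functionals are at most C ∫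
S^p, uniformly in δ (`truncEnergy_le_sharpMax`), and Fatou's lemma carries the bound to f.

The core is ∫ S^p ≤ C ∫ lip(u)^p (`exists_lintegral_sharpMax_le`). The Poincaré inequality bounds
S^p pointwise by the maximal function of lip(u)^p, but on L^1 that operator is only of weak type.
Instead, at each level λ, u is replaced by the mean h of its Lipschitz truncations at the k levels
2^i λ, k ≤ i < 2k. The Poincaré inequality for h on balls where u oscillates by more than λ times
the radius, with a Vitali covering, bounds λ^p m{S > λ} by the integral of lip(u)^p over a window
where lip(u) is comparable to λ, plus terms in S at higher levels. Summed over λ = 2^n, the window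
terms give C ∫ lip(u)^p. The others give a dyadic version of ∫ S^p with a coefficient of order
k^(1-p) + 2^(-k(p-1)), which is small for large k because p > 1. It is absorbed, since the dyadic
sum is finite a priori.

The converse rests on doubling. Let F be f clipped to a bounded range and e_k the energy of F at
scale 2^(-k), so that δ ∑ e_k ≤ A. The tent average of F at that scale has ∫ lip^(p+δ) ≤ C 2^(kδ)
e_k. When δ k₀ ≤ 1, the sum of 2^(-kδ) over k ≥ k₀ is at least 1/(2δ), so some k ≥ k₀ has 2^(kδ) e_k
≤ 4A (`exists_rpow_mul_le_of_tsum_le`). This bounds the slope at arbitrarily small scales,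
independently of δ. On a bounded set the exponent p+δ is traded for p by taking δ small, and cutoffs
supply bounded supports (`exists_tentAvg_approx`, `exists_isLipBS_approx`). -/

/-! ### Calculus and measurability of the slope. -/

section Slope

variable {X : Type*} [MetricSpace X]

theorem slopeAt_le_of_forall_gt {g : X → ℝ} {x : X} {c : ℝ≥0∞}
    (h : ∀ᶠ y in 𝓝[≠] x, edist (g x) (g y) / edist x y ≤ c) : slopeAt g x ≤ c :=
  limsup_le_of_le (by isBoundedDefault) h

theorem eventually_edist_pos_nhdsNE (x : X) :
    ∀ᶠ y in 𝓝[≠] x, edist x y ≠ 0 := by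
  filter_upwards [self_mem_nhdsWithin] with y hy
  exact fun h => hy (edist_eq_zero.1 h).symm

theorem slopeAt_le_add {g u v : X → ℝ} {x : X}
    (h : ∀ᶠ y in 𝓝[≠] x, edist (g x) (g y) ≤ edist (u x) (u y) + edist (v x) (v y)) :
    slopeAt g x ≤ slopeAt u x + slopeAt v x := by
  refine ENNReal.le_of_forall_pos_le_add fun ε hε hfin => ?_
  have hε2 : ((ε / 2 : ℝ≥0) : ℝ≥0∞) ≠ 0 := by
    simpa using (half_pos hε).ne'
  have hu : slopeAt u x < slopeAt u x + (ε / 2 : ℝ≥0) :=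
    ENNReal.lt_add_right (lt_of_le_of_lt le_self_add hfin).ne hε2
  have hv : slopeAt v x < slopeAt v x + (ε / 2 : ℝ≥0) :=
    ENNReal.lt_add_right (lt_of_le_of_lt le_add_self hfin).ne hε2
  refine slopeAt_le_of_forall_gt ?_
  filter_upwards [h, eventually_lt_of_limsup_lt hu, eventually_lt_of_limsup_lt hv]
    with y hy h1 h2
  calc edist (g x) (g y) / edist x y
      ≤ (edist (u x) (u y) + edist (v x) (v y)) / edist x y := by gcongr
    _ = edist (u x) (u y) / edist x y + edist (v x) (v y) / edist x y := ENNReal.add_div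
    _ ≤ (slopeAt u x + (ε / 2 : ℝ≥0)) + (slopeAt v x + (ε / 2 : ℝ≥0)) := by gcongr
    _ = slopeAt u x + slopeAt v x + ε := by
        rw [add_add_add_comm, ← ENNReal.coe_add, add_halves]

theorem slopeAt_le_const_add {g v : X → ℝ} {x : X} {c : ℝ≥0∞}
    (h : ∀ᶠ y in 𝓝[≠] x, edist (g x) (g y) ≤ c * edist x y + edist (v x) (v y)) :
    slopeAt g x ≤ c + slopeAt v x := by
  refine ENNReal.le_of_forall_pos_le_add fun ε hε hfin => ?_
  have hv : slopeAt v x < slopeAt v x + ε :=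
    ENNReal.lt_add_right (lt_of_le_of_lt le_add_self hfin).ne (by simpa using hε.ne')
  refine slopeAt_le_of_forall_gt ?_
  filter_upwards [h, eventually_lt_of_limsup_lt hv, eventually_edist_pos_nhdsNE x] with y hy h2 h0
  calc edist (g x) (g y) / edist x y
      ≤ (c * edist x y + edist (v x) (v y)) / edist x y := by gcongr
    _ = c + edist (v x) (v y) / edist x y := by
        rw [ENNReal.add_div, ENNReal.mul_div_cancel_right h0 (edist_ne_top _ _)]
    _ ≤ c + (slopeAt v x + ε) := by gcongr
    _ = c + slopeAt v x + ε := by rw [add_assoc]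

theorem slopeAt_const (c : ℝ) (x : X) : slopeAt (fun _ : X => c) x = 0 := by
  refine le_antisymm (slopeAt_le_of_forall_gt ?_) bot_le
  simp

theorem slopeAt_le_of_eventually_le {g : X → ℝ} {x : X} {c : ℝ≥0∞}
    (h : ∀ᶠ y in 𝓝[≠] x, edist (g x) (g y) ≤ c * edist x y) : slopeAt g x ≤ c := by
  have := slopeAt_le_const_add (g := g) (v := fun _ => 0) (c := c) (x := x) (by simpa using h)
  simpa [slopeAt_const] using this

theorem LipschitzWith.slopeAt_le {g : X → ℝ} {K : ℝ≥0} (h : LipschitzWith K g) (x : X) :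
    slopeAt g x ≤ K :=
  slopeAt_le_of_eventually_le (Eventually.of_forall fun y => h x y)

theorem slopeAt_eq_zero_of_eventuallyEq_zero {g : X → ℝ} {x : X} (h : ∀ᶠ y in 𝓝 x, g y = 0) :
    slopeAt g x = 0 := by
  refine le_antisymm (slopeAt_le_of_eventually_le ?_) bot_le
  filter_upwards [h.filter_mono nhdsWithin_le_nhds] with y hy
  simp [hy, h.self_of_nhds]

theorem slopeAt_const_mul_le (c : ℝ) (g : X → ℝ) (x : X) :
    slopeAt (fun y => c * g y) x ≤ ‖c‖ₑ * slopeAt g x := by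
  have key : ∀ y, edist (c * g x) (c * g y) / edist x y
      = ‖c‖ₑ * (edist (g x) (g y) / edist x y) := by
    intro y
    rw [edist_eq_enorm_sub, ← mul_sub, enorm_mul, ← edist_eq_enorm_sub, mul_div_assoc]
  rcases eq_or_ne c 0 with rfl | hc
  · simp [slopeAt_const]
  · refine ENNReal.le_of_forall_pos_le_add fun ε hε hfin => ?_
    have hc0 : ‖c‖ₑ ≠ 0 := by simpa using hc
    have hct : ‖c‖ₑ ≠ ∞ := enorm_ne_top
    have hne : slopeAt g x ≠ ∞ := by
      intro h
      rw [h, ENNReal.mul_top hc0] at hfin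
      exact lt_irrefl _ hfin
    have hlt : slopeAt g x < slopeAt g x + ε / ‖c‖ₑ :=
      ENNReal.lt_add_right hne (by simp [ENNReal.div_eq_zero_iff, hε.ne', hct])
    refine slopeAt_le_of_forall_gt ?_
    filter_upwards [eventually_lt_of_limsup_lt hlt] with y hy
    rw [key]
    calc ‖c‖ₑ * (edist (g x) (g y) / edist x y) ≤ ‖c‖ₑ * (slopeAt g x + ε / ‖c‖ₑ) := by gcongr
      _ = _ := by rw [mul_add, ENNReal.mul_div_cancel hc0 hct]

theorem slopeAt_sum_le {ι : Type*} (s : Finset ι) (u : ι → X → ℝ) (x : X) :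
    slopeAt (fun y => ∑ i ∈ s, u i y) x ≤ ∑ i ∈ s, slopeAt (u i) x := by
  classical
  induction s using Finset.induction_on with
  | empty => simp [slopeAt_const]
  | insert a s ha ih =>
    rw [Finset.sum_insert ha]
    refine (slopeAt_le_add (u := u a) (v := fun y => ∑ i ∈ s, u i y) ?_).trans (by gcongr)
    refine Eventually.of_forall fun y => ?_
    simp only [Finset.sum_insert ha]
    exact edist_add_add_le _ _ _ _

/-- The supremum runs over uncountably many y, so measurability cannot be read off termwise. For
fixed y the constraint is open in x and the quotient is continuous there, so superlevel sets are
unions of open sets. The slope is then a countable infimum of such functions. -/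
theorem lowerSemicontinuous_slope_at_scale {g : X → ℝ} (hg : Continuous g) (r : ℝ) :
    LowerSemicontinuous
      (fun x => ⨆ y : X, ⨆ _ : 0 < dist x y ∧ dist x y < r, edist (g x) (g y) / edist x y) := by
  rw [lowerSemicontinuous_iff_isOpen_preimage]
  intro a
  have : (fun x => ⨆ y : X, ⨆ _ : 0 < dist x y ∧ dist x y < r,
      edist (g x) (g y) / edist x y) ⁻¹' Set.Ioi a =
      ⋃ y : X, {x | (0 < dist x y ∧ dist x y < r) ∧ a < edist (g x) (g y) / edist x y} := by
    ext x
    simp [lt_iSup_iff]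
  rw [this]
  refine isOpen_iUnion fun y => ?_
  rw [isOpen_iff_mem_nhds]
  rintro x ⟨⟨h1, h2⟩, h3⟩
  have hd : ContinuousAt (fun x => dist x y) x := by fun_prop
  have hc : ContinuousAt (fun x => edist (g x) (g y) / edist x y) x := by
    have h1' : Tendsto (fun x => edist (g x) (g y)) (𝓝 x) (𝓝 (edist (g x) (g y))) :=
      ((hg.edist continuous_const).tendsto x)
    have h2' : Tendsto (fun x => edist x y) (𝓝 x) (𝓝 (edist x y)) :=
      ((continuous_id.edist continuous_const).tendsto x)
    refine ENNReal.Tendsto.div h1' (Or.inr ?_) h2' (Or.inr (edist_ne_top _ _))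
    simpa using h1
  filter_upwards [hd.eventually (lt_mem_nhds h1), hd.eventually (gt_mem_nhds h2),
    hc.eventually (lt_mem_nhds h3)] with z z1 z2 z3
  exact ⟨⟨z1, z2⟩, z3⟩

theorem slopeAt_eq_iInf {g : X → ℝ} (x : X) :
    slopeAt g x = ⨅ n : ℕ, ⨆ y : X, ⨆ _ : 0 < dist x y ∧ dist x y < 1 / ((n : ℝ) + 1),
      edist (g x) (g y) / edist x y := by
  have hb : (𝓝[≠] x).HasBasis (fun _ : ℕ => True)
      (fun n => {y | 0 < dist x y ∧ dist x y < 1 / ((n : ℝ) + 1)}) := by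
    refine (nhdsWithin_hasBasis Metric.nhds_basis_ball_inv_nat_succ _).to_hasBasis ?_ ?_
    · intro n _
      refine ⟨n, trivial, fun y hy => ⟨?_, ?_⟩⟩
      · rw [Metric.mem_ball, dist_comm]; exact hy.2
      · exact (dist_pos.1 hy.1).symm
    · intro n _
      refine ⟨n, trivial, fun y hy => ⟨dist_pos.2 (Ne.symm hy.2), ?_⟩⟩
      have := hy.1
      rwa [Metric.mem_ball, dist_comm] at this
  rw [slopeAt, hb.limsup_eq_iInf_iSup]
  simp

theorem measurable_slopeAt [MeasurableSpace X] [BorelSpace X] {g : X → ℝ} (hg : Continuous g) :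
    Measurable (slopeAt g) := by
  have : slopeAt g = fun x => ⨅ n : ℕ, ⨆ y : X,
      ⨆ _ : 0 < dist x y ∧ dist x y < 1 / ((n : ℝ) + 1), edist (g x) (g y) / edist x y :=
    funext fun x => slopeAt_eq_iInf x
  rw [this]
  exact Measurable.iInf fun n => (lowerSemicontinuous_slope_at_scale hg _).measurable

end Slope

/-! ### Doubling measures and the Vitali covering argument. -/

section Doubling

/-- `m` is doubling with constant `D` and its balls have positive finite measure. -/
structure DoublingWith {X : Type*} [MetricSpace X] [MeasurableSpace X] (m : Measure X)
    (D : ℝ≥0) : Prop where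
  fin : ∀ (x : X) (r : ℝ), m (Metric.ball x r) < ∞
  pos : ∀ (x : X) (r : ℝ), 0 < r → 0 < m (Metric.ball x r)
  dbl : ∀ (x : X) (r : ℝ), 0 < r → m (Metric.ball x (2 * r)) ≤ D * m (Metric.ball x r)

variable {X : Type*} [MetricSpace X] [MeasurableSpace X] {m : Measure X} {D : ℝ≥0}

/-- One null ball forces all concentric balls of radius 2^n r to be null by doubling, and these
exhaust the space. -/
theorem doublingWith_of_ne_zero (hfin : ∀ (x : X) (r : ℝ), m (Metric.ball x r) < ∞)
    (hD : ∀ (x : X) (r : ℝ), 0 < r → m (Metric.ball x (2 * r)) ≤ D * m (Metric.ball x r))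
    (hm : m ≠ 0) : DoublingWith m D := by
  refine ⟨hfin, fun x r hr => ?_, hD⟩
  by_contra h0
  have h0 : m (Metric.ball x r) = 0 := by simpa using h0
  have h : ∀ n : ℕ, m (Metric.ball x (2 ^ n * r)) = 0 := by
    intro n
    induction n with
    | zero => simpa using h0
    | succ n ih =>
      have := hD x (2 ^ n * r) (by positivity)
      rw [ih, mul_zero, ← mul_assoc, ← pow_succ'] at this
      simpa using this
  apply hm
  rw [← Measure.measure_univ_eq_zero]
  have hU : (Set.univ : Set X) = ⋃ n : ℕ, Metric.ball x (2 ^ n * r) := by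
    refine (Set.eq_univ_of_forall fun y => ?_).symm
    obtain ⟨n, hn⟩ := pow_unbounded_of_one_lt (dist y x / r) (one_lt_two (α := ℝ))
    exact Set.mem_iUnion.2 ⟨n, by rw [Metric.mem_ball]; exact (div_lt_iff₀ hr).1 hn⟩
  rw [hU]
  exact measure_iUnion_null h

namespace DoublingWith

theorem ball_four_le (h : DoublingWith m D) (x : X) {r : ℝ} (hr : 0 < r) :
    m (Metric.ball x (4 * r)) ≤ D ^ 2 * m (Metric.ball x r) := by
  calc m (Metric.ball x (4 * r)) = m (Metric.ball x (2 * (2 * r))) := by ring_nf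
    _ ≤ D * m (Metric.ball x (2 * r)) := h.dbl _ _ (by positivity)
    _ ≤ D * (D * m (Metric.ball x r)) := by gcongr; exact h.dbl _ _ hr
    _ = _ := by ring

theorem ball_eight_le (h : DoublingWith m D) (x : X) {r : ℝ} (hr : 0 < r) :
    m (Metric.ball x (8 * r)) ≤ D ^ 3 * m (Metric.ball x r) := by
  calc m (Metric.ball x (8 * r)) = m (Metric.ball x (4 * (2 * r))) := by ring_nf
    _ ≤ D ^ 2 * m (Metric.ball x (2 * r)) := h.ball_four_le _ (by positivity)
    _ ≤ D ^ 2 * (D * m (Metric.ball x r)) := by gcongr; exact h.dbl _ _ hr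
    _ = _ := by ring

/-- Comparison of the measures of balls with different centres. -/
theorem ball_le_of_dist (h : DoublingWith m D) {x y : X} {r s : ℝ} (hr : 0 < r)
    (hs : dist y x + s ≤ 4 * r) : m (Metric.ball y s) ≤ D ^ 2 * m (Metric.ball x r) :=
  (measure_mono (Metric.ball_subset_ball' (by linarith))).trans (h.ball_four_le x hr)

theorem one_le [Nonempty X] (h : DoublingWith m D) : 1 ≤ D := by
  obtain ⟨x⟩ := ‹Nonempty X›
  have h1 := h.dbl x 1 one_pos
  have h2 : m (Metric.ball x 1) ≤ m (Metric.ball x (2 * 1)) :=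
    measure_mono (Metric.ball_subset_ball (by norm_num))
  have h3 := h2.trans h1
  by_contra hlt
  push Not at hlt
  have : (D : ℝ≥0∞) * m (Metric.ball x 1) < 1 * m (Metric.ball x 1) :=
    ENNReal.mul_lt_mul_left (h.pos x 1 one_pos).ne' (h.fin x 1).ne (by exact_mod_cast hlt)
  rw [one_mul] at this
  exact absurd h3 (not_le.2 this)

/-- Gives access to the Lebesgue density and differentiation theorems. They use closed balls, which
costs a second factor D. -/
theorem isUnifLocDoublingMeasure (h : DoublingWith m D) : IsUnifLocDoublingMeasure m := by
  refine ⟨⟨D ^ 2, ?_⟩⟩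
  filter_upwards [self_mem_nhdsWithin] with r hr x
  have hr : 0 < r := hr
  calc m (Metric.closedBall x (2 * r)) ≤ m (Metric.ball x (4 * r)) :=
        measure_mono (Metric.closedBall_subset_ball (by linarith))
    _ ≤ D ^ 2 * m (Metric.ball x r) := h.ball_four_le x hr
    _ ≤ _ := by push_cast; gcongr; exact Metric.ball_subset_closedBall

theorem isLocallyFiniteMeasure (h : DoublingWith m D) : IsLocallyFiniteMeasure m :=
  ⟨fun x => ⟨Metric.ball x 1, Metric.ball_mem_nhds x one_pos, h.fin x 1⟩⟩

theorem measure_lt_top_of_isBounded (h : DoublingWith m D) {s : Set X}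
    (hs : Bornology.IsBounded s) : m s < ∞ := by
  rcases s.eq_empty_or_nonempty with rfl | ⟨x, hx⟩
  · simp
  · obtain ⟨r, hr⟩ := hs.subset_ball x
    exact (measure_mono hr).trans_lt (h.fin x r)

/-- A Vitali covering argument: if every ball in a family of uniformly bounded radii satisfies
`a * m B ≤ ν B`, then the union `U` of the family satisfies `a * m U ≤ D ^ 3 * ν U`. -/
theorem mul_measure_iUnion_le [TopologicalSpace.SeparableSpace X] [BorelSpace X]
    (h : DoublingWith m D) (ν : Measure X) (a : ℝ≥0∞)
    (t : Set (X × ℝ)) (R : ℝ) (hR : ∀ b ∈ t, 0 < b.2 ∧ b.2 ≤ R)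
    (hν : ∀ b ∈ t, a * m (Metric.ball b.1 b.2) ≤ ν (Metric.ball b.1 b.2)) :
    a * m (⋃ b ∈ t, Metric.ball b.1 b.2) ≤ D ^ 3 * ν Set.univ := by
  -- The closed balls are enlarged by the factor 4. They sit inside open balls of 8 times the
  -- radius, whence the three doublings in `D ^ 3`.
  obtain ⟨u, hut, hdisj, hcov⟩ := Vitali.exists_disjoint_subfamily_covering_enlargement_closedBall
    t (fun b => b.1) (fun b => b.2) R (fun b hb => (hR b hb).2) 4 (by norm_num)
  have hdisj' : u.PairwiseDisjoint fun b => Metric.ball b.1 b.2 :=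
    hdisj.mono fun b => Metric.ball_subset_closedBall
  have hcount : u.Countable := hdisj'.countable_of_isOpen (fun b _ => Metric.isOpen_ball)
    fun b hb => ⟨b.1, Metric.mem_ball_self (hR b (hut hb)).1⟩
  have hsub : (⋃ b ∈ t, Metric.ball b.1 b.2) ⊆ ⋃ b ∈ u, Metric.ball b.1 (8 * b.2) := by
    refine Set.iUnion₂_subset fun b hb => ?_
    obtain ⟨c, hc, hbc⟩ := hcov b hb
    refine (Metric.ball_subset_closedBall.trans (hbc.trans ?_)).trans
      (Set.subset_biUnion_of_mem (u := fun b : X × ℝ => Metric.ball b.1 (8 * b.2)) hc)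
    exact Metric.closedBall_subset_ball (by linarith [(hR c (hut hc)).1])
  have : Countable u := hcount.to_subtype
  calc a * m (⋃ b ∈ t, Metric.ball b.1 b.2)
      ≤ a * m (⋃ b ∈ u, Metric.ball b.1 (8 * b.2)) := by gcongr
    _ ≤ a * ∑' b : u, m (Metric.ball b.1.1 (8 * b.1.2)) := by
        gcongr; exact measure_biUnion_le m hcount _
    _ ≤ a * ∑' b : u, D ^ 3 * m (Metric.ball b.1.1 b.1.2) := by
        gcongr with b
        exact h.ball_eight_le _ (hR _ (hut b.2)).1
    _ = D ^ 3 * ∑' b : u, a * m (Metric.ball b.1.1 b.1.2) := by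
        rw [ENNReal.tsum_mul_left, ENNReal.tsum_mul_left]; ring
    _ ≤ D ^ 3 * ∑' b : u, ν (Metric.ball b.1.1 b.1.2) := by
        gcongr with b
        exact hν _ (hut b.2)
    _ = D ^ 3 * ν (⋃ b ∈ u, Metric.ball b.1 b.2) := by
        rw [measure_biUnion hcount hdisj' fun b _ => measurableSet_ball]
    _ ≤ D ^ 3 * ν Set.univ := by gcongr; exact Set.subset_univ _

end DoublingWith

end Doubling

/-! ### Elementary inequalities for averages. -/

section Averages

variable {X : Type*} [MeasurableSpace X] {m : Measure X}

theorem isProbabilityMeasure_normalized {s : Set X} (h0 : m s ≠ 0) (ht : m s ≠ ∞) :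
    IsProbabilityMeasure ((m.restrict s Set.univ)⁻¹ • m.restrict s) := by
  refine ⟨?_⟩
  rw [Measure.smul_apply, Measure.restrict_apply_univ, smul_eq_mul, ENNReal.inv_mul_cancel h0 ht]

theorem enorm_sub_setAverage_le {s : Set X} (h0 : m s ≠ 0) (ht : m s ≠ ∞) {u : X → ℝ}
    (hu : IntegrableOn u s m) (a : ℝ) :
    ‖a - ⨍ y in s, u y ∂m‖ₑ ≤ ⨍⁻ y in s, ‖a - u y‖ₑ ∂m := by
  have := isProbabilityMeasure_normalized h0 ht
  have hu' : Integrable u ((m.restrict s Set.univ)⁻¹ • m.restrict s) :=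
    hu.smul_measure (by rw [Measure.restrict_apply_univ]; exact ENNReal.inv_ne_top.2 h0)
  have : a - ⨍ y in s, u y ∂m
      = ∫ y, (a - u y) ∂((m.restrict s Set.univ)⁻¹ • m.restrict s) := by
    rw [integral_sub (integrable_const a) hu', integral_const, probReal_univ, one_smul]
    rfl
  rw [this]
  exact enorm_integral_le_lintegral_enorm _

theorem setLAverage_le_mul_of_subset {s t : Set X} (hst : s ⊆ t) {c : ℝ≥0∞}
    (hc : m t ≤ c * m s) (h0 : m s ≠ 0) (ht : m t ≠ ∞) (φ : X → ℝ≥0∞) :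
    ⨍⁻ y in s, φ y ∂m ≤ c * ⨍⁻ y in t, φ y ∂m := by
  rw [setLAverage_eq, setLAverage_eq]
  have ht0 : m t ≠ 0 := fun h => h0 (measure_mono_null hst h)
  have hs : m s ≠ ∞ := ((measure_mono hst).trans_lt ht.lt_top).ne
  rw [ENNReal.div_le_iff h0 hs]
  calc ∫⁻ y in s, φ y ∂m ≤ ∫⁻ y in t, φ y ∂m := lintegral_mono_set hst
    _ = ((∫⁻ y in t, φ y ∂m) / m t) * m t := (ENNReal.div_mul_cancel ht0 ht).symm
    _ ≤ ((∫⁻ y in t, φ y ∂m) / m t) * (c * m s) := by gcongr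
    _ = _ := by ring

theorem setLAverage_const_le {s : Set X} (c : ℝ≥0∞) : ⨍⁻ _y in s, c ∂m ≤ c := by
  rw [setLAverage_eq, lintegral_const, Measure.restrict_apply_univ]
  exact ENNReal.div_le_of_le_mul le_rfl

theorem setLAverage_mono {s : Set X} (hs : MeasurableSet s) {f g : X → ℝ≥0∞}
    (h : ∀ y ∈ s, f y ≤ g y) : ⨍⁻ y in s, f y ∂m ≤ ⨍⁻ y in s, g y ∂m := by
  rw [setLAverage_eq, setLAverage_eq]
  exact ENNReal.div_le_div_right (setLIntegral_mono' hs h) _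

theorem setLAverage_le_of_forall_le {s : Set X} (hs : MeasurableSet s) {f : X → ℝ≥0∞}
    {c : ℝ≥0∞} (h : ∀ y ∈ s, f y ≤ c) : ⨍⁻ y in s, f y ∂m ≤ c :=
  (setLAverage_mono hs h).trans (setLAverage_const_le c)

end Averages

/-! ### The sharp maximal function and the Hajłasz inequality. -/

section SharpMaximal

variable {X : Type*} [MetricSpace X] [MeasurableSpace X] {m : Measure X} {D : ℝ≥0}

/-- The mean oscillation of `u` on a ball. -/
noncomputable def ballOsc (m : Measure X) (u : X → ℝ) (z : X) (r : ℝ) : ℝ≥0∞ :=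
  ⨍⁻ y in Metric.ball z r, ‖u y - ⨍ w in Metric.ball z r, u w ∂m‖ₑ ∂m

/-- The (uncentred) sharp maximal function of order one, the supremum of `ballOsc / radius`. -/
noncomputable def sharpMax (m : Measure X) (u : X → ℝ) (x : X) : ℝ≥0∞ :=
  ⨆ b : X × ℝ, ⨆ _ : 0 < b.2 ∧ x ∈ Metric.ball b.1 b.2, ballOsc m u b.1 b.2 / ENNReal.ofReal b.2

/-- The centres and radii of the balls whose mean oscillation exceeds `a` times the radius. -/
def oscillatingBalls (m : Measure X) (u : X → ℝ) (a : ℝ≥0∞) : Set (X × ℝ) :=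
  {b | 0 < b.2 ∧ a * ENNReal.ofReal b.2 < ballOsc m u b.1 b.2}

/-- Because the maximal function is uncentred, a ball that oscillates too much lies entirely in the
superlevel set. This yields openness and the form needed for the covering argument. -/
theorem setOf_lt_sharpMax (u : X → ℝ) (a : ℝ≥0∞) :
    {x | a < sharpMax m u x} = ⋃ b ∈ oscillatingBalls m u a, Metric.ball b.1 b.2 := by
  ext x
  simp only [sharpMax, lt_iSup_iff, Set.mem_ofPred_eq, Set.mem_iUnion, oscillatingBalls, exists_prop]
  refine exists_congr fun b => ?_
  constructor
  · rintro ⟨⟨h1, h2⟩, h3⟩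
    refine ⟨⟨h1, ?_⟩, h2⟩
    rwa [ENNReal.lt_div_iff_mul_lt (Or.inl (by simpa using h1)) (Or.inl ENNReal.ofReal_ne_top)] at h3
  · rintro ⟨⟨h1, h2⟩, h3⟩
    refine ⟨⟨h1, h3⟩, ?_⟩
    rwa [ENNReal.lt_div_iff_mul_lt (Or.inl (by simpa using h1)) (Or.inl ENNReal.ofReal_ne_top)]

theorem isOpen_setOf_lt_sharpMax (u : X → ℝ) (a : ℝ≥0∞) : IsOpen {x | a < sharpMax m u x} := by
  rw [setOf_lt_sharpMax]
  exact isOpen_biUnion fun b _ => Metric.isOpen_ball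

theorem measurable_sharpMax [BorelSpace X] (u : X → ℝ) : Measurable (sharpMax m u) :=
  measurable_of_Ioi fun a => (isOpen_setOf_lt_sharpMax u a).measurableSet

theorem ballOsc_le_mul_sharpMax {u : X → ℝ} {x z : X} {r : ℝ} (hr : 0 < r)
    (hx : x ∈ Metric.ball z r) : ballOsc m u z r ≤ ENNReal.ofReal r * sharpMax m u x := by
  have h : ballOsc m u z r / ENNReal.ofReal r ≤ sharpMax m u x :=
    le_iSup₂_of_le (f := fun (b : X × ℝ) (_ : 0 < b.2 ∧ x ∈ Metric.ball b.1 b.2) =>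
      ballOsc m u b.1 b.2 / ENNReal.ofReal b.2) (z, r) ⟨hr, hx⟩ le_rfl
  rw [mul_comm]
  exact (ENNReal.div_le_iff (by simpa using hr) ENNReal.ofReal_ne_top).1 h

namespace DoublingWith

variable [BorelSpace X]

theorem integrableOn_ball (hm : DoublingWith m D) {u : X → ℝ} {L : ℝ≥0} (hu : LipschitzWith L u)
    (z : X) (r : ℝ) : IntegrableOn u (Metric.ball z r) m := by
  obtain ⟨M, hM⟩ := (hu.isBounded_image (Metric.isBounded_ball (x := z) (r := r))).exists_norm_le
  exact Measure.integrableOn_of_bounded (M := M) (hm.fin z r).ne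
    hu.continuous.aestronglyMeasurable
    ((ae_restrict_iff' measurableSet_ball).2 (Eventually.of_forall fun y hy =>
      hM _ (Set.mem_image_of_mem u hy)))

theorem enorm_sub_average_le (hm : DoublingWith m D) {u : X → ℝ} {L : ℝ≥0}
    (hu : LipschitzWith L u) (z : X) {r : ℝ} (hr : 0 < r) (a : ℝ) :
    ‖a - ⨍ y in Metric.ball z r, u y ∂m‖ₑ ≤ ⨍⁻ y in Metric.ball z r, ‖a - u y‖ₑ ∂m :=
  enorm_sub_setAverage_le (hm.pos z r hr).ne' (hm.fin z r).ne (hm.integrableOn_ball hu z r) a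

theorem enorm_sub_average_le_radius (hm : DoublingWith m D) {u : X → ℝ} {L : ℝ≥0}
    (hu : LipschitzWith L u) {y z : X} {r : ℝ} (hr : 0 < r) (hy : y ∈ Metric.ball z r) :
    ‖u y - ⨍ w in Metric.ball z r, u w ∂m‖ₑ ≤ L * ENNReal.ofReal (2 * r) := by
  refine (hm.enorm_sub_average_le hu z hr _).trans
    (setLAverage_le_of_forall_le measurableSet_ball fun w hw => ?_)
  rw [← edist_eq_enorm_sub]
  refine (hu y w).trans ?_
  gcongr
  rw [edist_dist]
  refine ENNReal.ofReal_le_ofReal ?_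
  rw [Metric.mem_ball] at hy hw
  linarith [dist_triangle_right y w z]

/-- A qualitative bound: it makes the sharp maximal function finite and its high superlevel sets
empty. The constant `L` does not enter the final estimate. -/
theorem sharpMax_le (hm : DoublingWith m D) {u : X → ℝ} {L : ℝ≥0} (hu : LipschitzWith L u)
    (x : X) : sharpMax m u x ≤ 2 * L := by
  refine iSup₂_le fun b hb => ?_
  rw [ENNReal.div_le_iff (by simpa using hb.1) ENNReal.ofReal_ne_top]
  refine setLAverage_le_of_forall_le measurableSet_ball fun y hy =>
    (hm.enorm_sub_average_le_radius hu hb.1 hy).trans_eq ?_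
  rw [ENNReal.ofReal_mul zero_le_two, ENNReal.ofReal_ofNat]
  ring

theorem enorm_average_sub_average_half_le (hm : DoublingWith m D) {u : X → ℝ} {L : ℝ≥0}
    (hu : LipschitzWith L u) (x : X) {r : ℝ} (hr : 0 < r) :
    ‖(⨍ y in Metric.ball x r, u y ∂m) - ⨍ y in Metric.ball x (r / 2), u y ∂m‖ₑ ≤
      D * ENNReal.ofReal r * sharpMax m u x := by
  refine (hm.enorm_sub_average_le hu x (half_pos hr) _).trans ?_
  simp_rw [fun y => enorm_sub_rev (⨍ y in Metric.ball x r, u y ∂m) (u y)]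
  refine (setLAverage_le_mul_of_subset (c := D) (Metric.ball_subset_ball (half_le_self hr.le)) ?_
    (hm.pos x _ (half_pos hr)).ne' (hm.fin x r).ne _).trans ?_
  · have := hm.dbl x (r / 2) (half_pos hr)
    rwa [mul_div_cancel₀ r two_ne_zero] at this
  · rw [mul_assoc]
    gcongr
    exact ballOsc_le_mul_sharpMax hr (Metric.mem_ball_self hr)

/-- Telescoping over successively halved balls: the n-th step costs D r 2^(-n) S(x), and the sum is
2 D r S(x). The Lipschitz property is used only to see that the averages tend to u(x), so `L`
disappears in the limit. -/
theorem enorm_average_sub_le_centre (hm : DoublingWith m D) {u : X → ℝ} {L : ℝ≥0}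
    (hu : LipschitzWith L u) (x : X) {r : ℝ} (hr : 0 < r) :
    ‖(⨍ y in Metric.ball x r, u y ∂m) - u x‖ₑ ≤
      D * ENNReal.ofReal (2 * r) * sharpMax m u x := by
  have hstep : ∀ n : ℕ, ‖(⨍ y in Metric.ball x r, u y ∂m)
      - ⨍ y in Metric.ball x (r / 2 ^ n), u y ∂m‖ₑ ≤
      D * ENNReal.ofReal (2 * r - 2 * r / 2 ^ n) * sharpMax m u x := by
    intro n
    induction n with
    | zero => simp
    | succ n ih =>
      have hn : 0 < r / 2 ^ n := by positivity
      have h1 := hm.enorm_average_sub_average_half_le hu x hn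
      have h2 : r / 2 ^ n / 2 = r / 2 ^ (n + 1) := by rw [pow_succ, div_div]
      rw [h2] at h1
      rw [← sub_add_sub_cancel _ (⨍ y in Metric.ball x (r / 2 ^ n), u y ∂m)]
      refine (enorm_add_le _ _).trans ((add_le_add ih h1).trans_eq ?_)
      rw [← add_mul, ← mul_add, ← ENNReal.ofReal_add _ hn.le]
      · congr 3; field_simp; ring
      · rw [sub_nonneg]
        exact div_le_self (by positivity) (one_le_pow₀ one_le_two)
  have hlim : Tendsto (fun n : ℕ => D * ENNReal.ofReal (2 * r) * sharpMax m u x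
      + L * ENNReal.ofReal (2 * (r / 2 ^ n))) atTop
      (𝓝 (D * ENNReal.ofReal (2 * r) * sharpMax m u x + L * ENNReal.ofReal (2 * 0))) := by
    refine tendsto_const_nhds.add (ENNReal.Tendsto.const_mul (ENNReal.tendsto_ofReal ?_)
      (Or.inr ENNReal.coe_ne_top))
    refine Tendsto.const_mul _ ?_
    have := (tendsto_pow_atTop_nhds_zero_of_lt_one (r := (1 / 2 : ℝ)) (by norm_num)
      (by norm_num)).const_mul r
    simpa [div_eq_mul_inv] using this
  refine le_trans (ge_of_tendsto' hlim fun n => ?_) (by simp)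
  have hn : 0 < r / 2 ^ n := by positivity
  rw [← sub_add_sub_cancel _ (⨍ y in Metric.ball x (r / 2 ^ n), u y ∂m)]
  refine (enorm_add_le _ _).trans (add_le_add ((hstep n).trans ?_) ?_)
  · gcongr
    have : 0 ≤ 2 * r / 2 ^ n := by positivity
    linarith
  · rw [enorm_sub_rev]
    exact hm.enorm_sub_average_le_radius hu hn (Metric.mem_ball_self hn)

/-- A point value differs from the mean over a ball containing the point by at most a constant
times the radius times the sharp maximal function. -/
theorem enorm_sub_average_le_sharpMax (hm : DoublingWith m D) {u : X → ℝ} {L : ℝ≥0}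
    (hu : LipschitzWith L u) {x z : X} {r : ℝ} (hr : 0 < r) (hx : x ∈ Metric.ball z r) :
    ‖u x - ⨍ y in Metric.ball z r, u y ∂m‖ₑ ≤
      6 * D ^ 2 * ENNReal.ofReal r * sharpMax m u x := by
  have : Nonempty X := ⟨x⟩
  have hD : (1 : ℝ≥0∞) ≤ D := by exact_mod_cast hm.one_le
  have h2r : 0 < 2 * r := by positivity
  have hx' : dist x z < r := hx
  have h1 := hm.enorm_average_sub_le_centre hu x h2r
  rw [enorm_sub_rev] at h1
  -- The ball of radius 2r about x contains the given ball and has comparable measure, so it serves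
  -- as an intermediate ball centred at x.
  have h2 : ‖(⨍ y in Metric.ball x (2 * r), u y ∂m) - ⨍ y in Metric.ball z r, u y ∂m‖ₑ ≤
      D ^ 2 * (ENNReal.ofReal (2 * r) * sharpMax m u x) := by
    refine (hm.enorm_sub_average_le hu z hr _).trans ?_
    simp_rw [fun y => enorm_sub_rev (⨍ y in Metric.ball x (2 * r), u y ∂m) (u y)]
    refine (setLAverage_le_mul_of_subset (c := D ^ 2) (t := Metric.ball x (2 * r)) ?_ ?_
      (hm.pos z r hr).ne' (hm.fin x (2 * r)).ne _).trans ?_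
    · refine Metric.ball_subset_ball' ?_
      rw [dist_comm]; linarith
    · exact hm.ball_le_of_dist hr (by linarith)
    · gcongr
      exact ballOsc_le_mul_sharpMax h2r (Metric.mem_ball_self h2r)
  rw [← sub_add_sub_cancel _ (⨍ y in Metric.ball x (2 * r), u y ∂m)]
  refine (enorm_add_le _ _).trans ((add_le_add h1 h2).trans ?_)
  calc (D : ℝ≥0∞) * ENNReal.ofReal (2 * (2 * r)) * sharpMax m u x +
      D ^ 2 * (ENNReal.ofReal (2 * r) * sharpMax m u x)
      = (4 * (D * 1) + 2 * D ^ 2) * ENNReal.ofReal r * sharpMax m u x := by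
        rw [ENNReal.ofReal_mul zero_le_two, ENNReal.ofReal_mul zero_le_two, ENNReal.ofReal_ofNat]
        ring
    _ ≤ (4 * (D * D) + 2 * D ^ 2) * ENNReal.ofReal r * sharpMax m u x := by gcongr
    _ = _ := by ring

/-- The Hajłasz-type inequality with the sharp maximal function. -/
theorem edist_le_sharpMax (hm : DoublingWith m D) {u : X → ℝ} {L : ℝ≥0}
    (hu : LipschitzWith L u) (x y : X) :
    edist (u x) (u y) ≤ 12 * D ^ 2 * edist x y * (sharpMax m u x + sharpMax m u y) := by
  rcases eq_or_ne x y with rfl | hxy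
  · simp
  have hd : 0 < dist x y := dist_pos.2 hxy
  have h2d : 0 < 2 * dist x y := by positivity
  have h1 := hm.enorm_sub_average_le_sharpMax hu h2d (Metric.mem_ball_self (x := x) h2d)
  have h2 := hm.enorm_sub_average_le_sharpMax hu h2d
    (show y ∈ Metric.ball x (2 * dist x y) by rw [Metric.mem_ball, dist_comm]; linarith)
  rw [enorm_sub_rev] at h2
  rw [edist_eq_enorm_sub, ← sub_add_sub_cancel _ (⨍ w in Metric.ball x (2 * dist x y), u w ∂m)]
  refine (enorm_add_le _ _).trans ((add_le_add h1 h2).trans_eq ?_)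
  rw [ENNReal.ofReal_mul zero_le_two, ENNReal.ofReal_ofNat, edist_dist]
  ring

/-- This makes Lipschitz truncation possible: on a sublevel set the Lipschitz constant depends on
the level only, not on `L`. -/
theorem lipschitzOnWith_sharpMax_le (hm : DoublingWith m D) {u : X → ℝ} {L : ℝ≥0}
    (hu : LipschitzWith L u) (μ : ℝ≥0) :
    LipschitzOnWith (24 * D ^ 2 * μ) u {x | sharpMax m u x ≤ μ} := by
  intro x hx y hy
  refine (hm.edist_le_sharpMax hu x y).trans ?_
  calc 12 * (D : ℝ≥0∞) ^ 2 * edist x y * (sharpMax m u x + sharpMax m u y)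
      ≤ 12 * (D : ℝ≥0∞) ^ 2 * edist x y * (μ + μ) := by gcongr <;> assumption
    _ = _ := by push_cast; ring

end DoublingWith

end SharpMaximal

/-! ### Slopes agree almost everywhere on coincidence sets. -/

section VanishingSlope

variable {X : Type*} [MetricSpace X] [MeasurableSpace X] {m : Measure X} {D : ℝ≥0}

theorem DoublingWith.ball_two_pow_le (hm : DoublingWith m D) (x : X) {r : ℝ} (hr : 0 < r)
    (n : ℕ) : m (Metric.ball x (2 ^ n * r)) ≤ D ^ n * m (Metric.ball x r) := by
  induction n with
  | zero => simp
  | succ n ih =>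
    calc m (Metric.ball x (2 ^ (n + 1) * r)) = m (Metric.ball x (2 * (2 ^ n * r))) := by ring_nf
      _ ≤ D * m (Metric.ball x (2 ^ n * r)) := hm.dbl _ _ (by positivity)
      _ ≤ D * (D ^ n * m (Metric.ball x r)) := by gcongr
      _ = _ := by ring

variable [BorelSpace X]

/-- Near a density point, the zero set of `w` meets all balls of radius a fixed proportion of the
distance to the point. -/
theorem DoublingWith.eventually_inter_ball_nonempty (hm : DoublingWith m D) {A : Set X}
    {x : X} (hA : Tendsto (fun t : ℝ => m (A ∩ Metric.closedBall x t) / m (Metric.closedBall x t))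
      (𝓝[>] 0) (𝓝 1)) (N : ℕ) :
    ∀ᶠ y in 𝓝[≠] x, (A ∩ Metric.ball y (dist x y / 2 ^ N)).Nonempty := by
  have : Nonempty X := ⟨x⟩
  have hD : D ≠ 0 := (zero_lt_one.trans_le hm.one_le).ne'
  -- With d = d(x,y), the ball of radius d/2^N about y fills at least the fraction `c` of the closed
  -- ball of radius 2d about x, since N+2 doublings bring its radius to 4d > 3d. If it missed A, the
  -- density of A at scale 2d would be at most 1 - c, contrary to density one at x.
  set c : ℝ≥0∞ := ((D : ℝ≥0∞) ^ (N + 2))⁻¹ with hc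
  have hDN : ((D : ℝ≥0∞) ^ (N + 2)) ≠ ∞ := by finiteness
  have hDN0 : ((D : ℝ≥0∞) ^ (N + 2)) ≠ 0 := pow_ne_zero _ (by exact_mod_cast hD)
  have hc0 : c ≠ 0 := ENNReal.inv_ne_zero.2 hDN
  have hev := hA.eventually (lt_mem_nhds (ENNReal.sub_lt_self ENNReal.one_ne_top one_ne_zero hc0))
  have hdist : Tendsto (fun y => 2 * dist x y) (𝓝[≠] x) (𝓝[>] 0) := by
    refine tendsto_nhdsWithin_iff.2 ⟨?_, ?_⟩
    · have : Tendsto (fun y => 2 * dist x y) (𝓝 x) (𝓝 (2 * dist x x)) :=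
        Continuous.tendsto (by fun_prop) x
      rw [dist_self, mul_zero] at this
      exact this.mono_left nhdsWithin_le_nhds
    · filter_upwards [self_mem_nhdsWithin] with y hy
      have : 0 < dist x y := dist_pos.2 (Ne.symm hy)
      simpa using Ne.symm hy
  filter_upwards [hdist.eventually hev, self_mem_nhdsWithin] with y hy hne
  have hd : 0 < dist x y := dist_pos.2 (Ne.symm hne)
  have hr : 0 < dist x y / 2 ^ N := by positivity
  by_contra hempty
  rw [Set.not_nonempty_iff_eq_empty] at hempty
  set B := Metric.closedBall x (2 * dist x y) with hB
  have hBt : m B ≠ ∞ := (hm.measure_lt_top_of_isBounded Metric.isBounded_closedBall).ne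
  have hB0 : m B ≠ 0 := ((hm.pos x (2 * dist x y) (by positivity)).trans_le
    (measure_mono Metric.ball_subset_closedBall)).ne'
  have hsub : Metric.ball y (dist x y / 2 ^ N) ⊆ B := by
    refine Metric.ball_subset_closedBall.trans (Metric.closedBall_subset_closedBall' ?_)
    have : dist x y / 2 ^ N ≤ dist x y := div_le_self hd.le (one_le_pow₀ one_le_two)
    rw [dist_comm y x]; linarith
  have hle : m B ≤ D ^ (N + 2) * m (Metric.ball y (dist x y / 2 ^ N)) := by
    refine le_trans (measure_mono ?_) (hm.ball_two_pow_le y hr (N + 2))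
    refine Metric.closedBall_subset_ball' ?_
    have : (2 : ℝ) ^ (N + 2) * (dist x y / 2 ^ N) = 4 * dist x y := by
      rw [pow_add]; field_simp; norm_num
    rw [this]; linarith
  have hcB : c * m B ≤ m (Metric.ball y (dist x y / 2 ^ N)) := by
    rw [hc, ← ENNReal.div_eq_inv_mul]
    exact ENNReal.div_le_of_le_mul' hle
  have hadd : m (A ∩ B) + m (Metric.ball y (dist x y / 2 ^ N)) ≤ m B := by
    rw [← measure_union _ measurableSet_ball]
    · exact measure_mono (Set.union_subset Set.inter_subset_right hsub)
    · refine Set.disjoint_left.2 fun z hz hz' => ?_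
      have : z ∈ A ∩ Metric.ball y (dist x y / 2 ^ N) := ⟨hz.1, hz'⟩
      rw [hempty] at this
      exact this
  have hratio : m (A ∩ B) / m B + c ≤ 1 := by
    calc m (A ∩ B) / m B + c = (m (A ∩ B) + c * m B) / m B := by
          rw [ENNReal.add_div, ENNReal.mul_div_cancel_right hB0 hBt]
      _ ≤ m B / m B := by gcongr; exact (by gcongr : m (A ∩ B) + c * m B ≤ _).trans hadd
      _ = 1 := ENNReal.div_self hB0 hBt
  have hct : c ≠ ∞ := ENNReal.inv_ne_top.2 hDN0
  exact absurd hy (not_lt.2 (ENNReal.le_sub_of_add_le_right hct hratio))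

variable [TopologicalSpace.SeparableSpace X]

/-- A Lipschitz function has vanishing slope almost everywhere on its zero set. -/
theorem DoublingWith.ae_slopeAt_eq_zero (hm : DoublingWith m D) {w : X → ℝ} {L : ℝ≥0}
    (hw : LipschitzWith L w) : ∀ᵐ x ∂m, w x = 0 → slopeAt w x = 0 := by
  have := hm.isUnifLocDoublingMeasure
  have := hm.isLocallyFiniteMeasure
  have := UniformSpace.secondCountable_of_separable X
  set A : Set X := {x | w x = 0} with hA
  have hAm : MeasurableSet A := measurableSet_eq_fun hw.continuous.measurable measurable_const
  have hdens := (ae_restrict_iff' hAm).1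
    (IsUnifLocDoublingMeasure.ae_tendsto_measure_inter_div.{_, 0} m A 1)
  filter_upwards [hdens] with x hx hwx
  have htend := hx hwx (l := 𝓝[>] (0 : ℝ)) (fun _ => x) (fun t => t) tendsto_id (by
    filter_upwards [self_mem_nhdsWithin] with t ht
    exact Metric.mem_closedBall_self (by rw [one_mul]; exact le_of_lt ht))
  -- For y near x there is a zero a of w within d(x,y)/2^N of y, and w(x) = w(a). Hence |w(x) -
  -- w(y)| ≤ L d(x,y)/2^N.
  have hbound : ∀ N : ℕ, slopeAt w x ≤ L * (2⁻¹ : ℝ≥0∞) ^ N := by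
    intro N
    refine slopeAt_le_of_eventually_le ?_
    filter_upwards [hm.eventually_inter_ball_nonempty htend N] with y hy
    obtain ⟨a, ha, hay⟩ := hy
    have ha : w a = w x := ha.trans hwx.symm
    rw [← ha]
    refine (hw a y).trans ?_
    rw [mul_assoc]
    gcongr
    rw [edist_dist, edist_dist, ← ENNReal.inv_pow, mul_comm, ← div_eq_mul_inv,
      ← ENNReal.ofReal_ofNat 2, ← ENNReal.ofReal_pow zero_le_two,
      ← ENNReal.ofReal_div_of_pos (by positivity)]
    exact ENNReal.ofReal_le_ofReal (Metric.mem_ball.1 hay).le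
  have hlim : Tendsto (fun N : ℕ => (L : ℝ≥0∞) * (2⁻¹ : ℝ≥0∞) ^ N) atTop (𝓝 (L * 0)) :=
    ENNReal.Tendsto.const_mul (ENNReal.tendsto_pow_atTop_nhds_zero_of_lt_one (by norm_num))
      (Or.inr ENNReal.coe_ne_top)
  rw [mul_zero] at hlim
  exact le_antisymm (ge_of_tendsto' hlim hbound) bot_le

/-- Two Lipschitz functions have comparable slopes almost everywhere on their coincidence set. -/
theorem DoublingWith.ae_slopeAt_le_of_eq (hm : DoublingWith m D) {u v : X → ℝ} {L L' : ℝ≥0}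
    (hu : LipschitzWith L u) (hv : LipschitzWith L' v) :
    ∀ᵐ x ∂m, u x = v x → slopeAt u x ≤ slopeAt v x := by
  have hw : LipschitzWith (L + L') (fun x => u x - v x) := hu.sub hv
  filter_upwards [hm.ae_slopeAt_eq_zero hw] with x hx hxe
  have h0 := hx (by simp [hxe])
  have := slopeAt_le_add (g := u) (u := fun x => u x - v x) (v := v) (x := x)
    (Eventually.of_forall fun y => by
      calc edist (u x) (u y) = edist ((u x - v x) + v x) ((u y - v y) + v y) := by simp
        _ ≤ _ := edist_add_add_le _ _ _ _)
  rwa [h0, zero_add] at this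

end VanishingSlope

/-! ### Lipschitz truncation at a level of the sharp maximal function. -/

section Truncation

theorem IsLipBS.exists_bound {X : Type*} [MetricSpace X] {u : X → ℝ} (hu : IsLipBS u) :
    ∃ M : ℝ≥0, ∀ x, ‖u x‖ₑ ≤ M := by
  obtain ⟨⟨L, hL⟩, hb⟩ := hu
  obtain ⟨M, hM⟩ := (hL.isBounded_image hb).exists_norm_le
  refine ⟨M.toNNReal, fun x => ?_⟩
  by_cases hx : u x = 0
  · simp [hx]
  · rw [← ofReal_norm]
    exact ENNReal.ofReal_le_ofReal (hM _ (Set.mem_image_of_mem u hx))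

variable {X : Type*} [MetricSpace X] [MeasurableSpace X] [BorelSpace X] {m : Measure X} {D : ℝ≥0}

namespace DoublingWith

theorem ballOsc_le_two_mul_average (hm : DoublingWith m D) {u : X → ℝ} {L : ℝ≥0}
    (hu : LipschitzWith L u) (z : X) {r : ℝ} (hr : 0 < r) :
    ballOsc m u z r ≤ 2 * ⨍⁻ y in Metric.ball z r, ‖u y‖ₑ ∂m := by
  have h0 := (hm.pos z r hr).ne'
  have ht := (hm.fin z r).ne
  have hc : ‖⨍ w in Metric.ball z r, u w ∂m‖ₑ ≤ ⨍⁻ y in Metric.ball z r, ‖u y‖ₑ ∂m := by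
    simpa using hm.enorm_sub_average_le hu z hr 0
  have hmeas : Measurable fun y => ‖u y‖ₑ := hu.continuous.measurable.enorm
  calc ballOsc m u z r
      ≤ ⨍⁻ y in Metric.ball z r, (‖u y‖ₑ + ‖⨍ w in Metric.ball z r, u w ∂m‖ₑ) ∂m :=
        setLAverage_mono (m := m) (s := Metric.ball z r) measurableSet_ball fun y _ => enorm_sub_le
    _ = (⨍⁻ y in Metric.ball z r, ‖u y‖ₑ ∂m)
        + ⨍⁻ y in Metric.ball z r, ‖⨍ w in Metric.ball z r, u w ∂m‖ₑ ∂m := by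
        rw [setLAverage_eq, setLAverage_eq, setLAverage_eq, lintegral_add_left hmeas,
          ENNReal.add_div]
    _ ≤ _ := by
        rw [two_mul]
        exact add_le_add le_rfl ((setLAverage_const_le _).trans hc)

theorem ballOsc_le_two_mul_bound (hm : DoublingWith m D) {u : X → ℝ} {L M : ℝ≥0}
    (hu : LipschitzWith L u) (hM : ∀ x, ‖u x‖ₑ ≤ M) (z : X) {r : ℝ} (hr : 0 < r) :
    ballOsc m u z r ≤ 2 * M := by
  refine (hm.ballOsc_le_two_mul_average hu z hr).trans ?_
  exact mul_le_mul_right (setLAverage_le_of_forall_le measurableSet_ball fun y _ => hM y) _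

/-- A bounded function has mean oscillation at most 2M, so λ r < 2M. The Vitali covering lemma
requires such a uniform bound on radii. -/
theorem radius_le_of_mem_oscillatingBalls (hm : DoublingWith m D) {u : X → ℝ} {L M : ℝ≥0}
    (hu : LipschitzWith L u) (hM : ∀ x, ‖u x‖ₑ ≤ M) {lam : ℝ≥0} (hlam : 0 < lam)
    {b : X × ℝ} (hb : b ∈ oscillatingBalls m u lam) : b.2 ≤ 2 * M / lam := by
  have h := hb.2.le.trans (hm.ballOsc_le_two_mul_bound hu hM b.1 hb.1)
  rw [← ENNReal.ofReal_coe_nnreal, ← ENNReal.ofReal_mul lam.coe_nonneg] at h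
  have h2 : (2 : ℝ≥0∞) * M = ENNReal.ofReal (2 * M) := by
    rw [ENNReal.ofReal_mul zero_le_two]; simp
  rw [h2, ENNReal.ofReal_le_ofReal_iff (by positivity)] at h
  rw [le_div_iff₀ (by exact_mod_cast hlam)]
  linarith

theorem exists_mem_support_of_mem_oscillatingBalls {u : X → ℝ} {a : ℝ≥0∞}
    {b : X × ℝ} (hb : b ∈ oscillatingBalls m u a) :
    ∃ y ∈ Metric.ball b.1 b.2, u y ≠ 0 := by
  by_contra! h
  have hz : ∀ y ∈ Metric.ball b.1 b.2, u y = (fun _ => (0 : ℝ)) y := h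
  have h1 : ⨍ w in Metric.ball b.1 b.2, u w ∂m = 0 := by
    rw [setAverage_congr_fun measurableSet_ball (Eventually.of_forall hz)]
    simp
  have h2 : ballOsc m u b.1 b.2 ≤ 0 :=
    setLAverage_le_of_forall_le measurableSet_ball fun y hy => by rw [h1, h y hy]; simp
  exact absurd (hb.2.trans_le h2) not_lt_bot

/-- Oscillating balls meet the support and have bounded radii, so they stay near the support.
Consequently the extension used for truncation still has bounded support. -/
theorem isBounded_setOf_lt_sharpMax (hm : DoublingWith m D) {u : X → ℝ} (hu : IsLipBS u)
    {lam : ℝ≥0} (hlam : 0 < lam) : Bornology.IsBounded {x | lam < sharpMax m u x} := by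
  obtain ⟨M, hM⟩ := hu.exists_bound
  obtain ⟨⟨L, hL⟩, hb⟩ := hu
  rw [setOf_lt_sharpMax]
  set R := 2 * (M : ℝ) / lam
  refine (hb.thickening (δ := 2 * R + 1)).subset ?_
  refine Set.iUnion₂_subset fun b hb x hx => ?_
  obtain ⟨y, hy, hy0⟩ := exists_mem_support_of_mem_oscillatingBalls hb
  have hr := hm.radius_le_of_mem_oscillatingBalls hL hM hlam hb
  rw [Metric.mem_thickening_iff]
  refine ⟨y, hy0, ?_⟩
  rw [Metric.mem_ball] at hx hy
  linarith [dist_triangle_right x y b.1]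

/-- A Lipschitz truncation of `u`, agreeing with `u` where the sharp maximal function is small. -/
theorem exists_lipschitz_truncation (hm : DoublingWith m D) {u : X → ℝ} (hu : IsLipBS u)
    {μ : ℝ≥0} (hμ : 0 < μ) :
    ∃ v : X → ℝ, LipschitzWith (24 * D ^ 2 * μ) v ∧ IsLipBS v ∧
      ∀ x, sharpMax m u x ≤ μ → v x = u x := by
  obtain ⟨L, hL⟩ := hu.1
  obtain ⟨v, hv, he⟩ := (hm.lipschitzOnWith_sharpMax_le hL μ).extend_real
  refine ⟨v, hv, ⟨⟨_, hv⟩, ?_⟩, fun x hx => (he hx).symm⟩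
  refine (hu.2.union (hm.isBounded_setOf_lt_sharpMax hu hμ)).subset fun x hx => ?_
  by_cases h : sharpMax m u x ≤ μ
  · left
    rw [Function.mem_support, he h]
    exact hx
  · right
    exact not_le.1 h

/-- On a ball that contains a point where the sharp maximal function is at most `μ₀`, a Lipschitz
truncation at a higher level is close to `u`. -/
theorem enorm_sub_truncation_le (hm : DoublingWith m D) {u v : X → ℝ} {L μ₀ μ : ℝ≥0}
    (hu : LipschitzWith L u) (hv : LipschitzWith (24 * D ^ 2 * μ) v)
    (huv : ∀ x, sharpMax m u x ≤ μ → v x = u x) (hμ : μ₀ ≤ μ) {z : X} {r : ℝ} (hr : 0 < r)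
    {y' : X} (hy' : y' ∈ Metric.ball z r) (hS : sharpMax m u y' ≤ μ₀)
    {y : X} (hy : y ∈ Metric.ball z r) :
    ‖u y - v y‖ₑ ≤ 60 * D ^ 2 * ENNReal.ofReal r *
      {x | μ₀ < sharpMax m u x}.indicator (sharpMax m u) y := by
  have hμ' : (μ₀ : ℝ≥0∞) ≤ μ := by exact_mod_cast hμ
  by_cases hSy : sharpMax m u y ≤ μ
  · simp [huv y hSy]
  push Not at hSy
  rw [Set.indicator_of_mem (show y ∈ {x | (μ₀ : ℝ≥0∞) < sharpMax m u x} from hμ'.trans_lt hSy)]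
  have h1 := hm.enorm_sub_average_le_sharpMax hu hr hy
  have h2 := hm.enorm_sub_average_le_sharpMax hu hr hy'
  rw [enorm_sub_rev] at h2
  -- At y' the functions u and v agree, so the Lipschitz bound for v applies. Since S(y') ≤ μ <
  -- S(y), all three terms are then bounded by S(y), and 60 = 6 + 6 + 48.
  have h3 : ‖u y' - v y‖ₑ ≤ 24 * D ^ 2 * μ * (2 * ENNReal.ofReal r) := by
    rw [← huv y' (hS.trans hμ'), ← edist_eq_enorm_sub]
    refine (hv y' y).trans ?_
    push_cast
    gcongr
    rw [edist_dist, ← ENNReal.ofReal_ofNat, ← ENNReal.ofReal_mul zero_le_two]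
    refine ENNReal.ofReal_le_ofReal ?_
    rw [Metric.mem_ball] at hy hy'
    linarith [dist_triangle_right y' y z]
  have hsplit : u y - v y = (u y - ⨍ w in Metric.ball z r, u w ∂m)
      + ((⨍ w in Metric.ball z r, u w ∂m) - u y') + (u y' - v y) := by ring
  have hS' : sharpMax m u y' ≤ sharpMax m u y := (hS.trans hμ').trans hSy.le
  rw [hsplit]
  calc _ ≤ 6 * D ^ 2 * ENNReal.ofReal r * sharpMax m u y
        + 6 * D ^ 2 * ENNReal.ofReal r * sharpMax m u y'
        + 24 * D ^ 2 * μ * (2 * ENNReal.ofReal r) :=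
        (enorm_add_le _ _).trans (add_le_add ((enorm_add_le _ _).trans (add_le_add h1 h2)) h3)
    _ ≤ 6 * D ^ 2 * ENNReal.ofReal r * sharpMax m u y
        + 6 * D ^ 2 * ENNReal.ofReal r * sharpMax m u y
        + 24 * D ^ 2 * sharpMax m u y * (2 * ENNReal.ofReal r) := by gcongr
    _ = _ := by ring

end DoublingWith

end Truncation

/-! ### Dyadic sums and powers. -/

section DyadicSums

theorem ENNReal.zpow_rpow_comm (n : ℤ) (q : ℝ) :
    ((2 : ℝ≥0∞) ^ n) ^ q = ((2 : ℝ≥0∞) ^ q) ^ n := by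
  rw [← ENNReal.rpow_intCast, ← ENNReal.rpow_intCast, ← ENNReal.rpow_mul, ← ENNReal.rpow_mul,
    mul_comm]

/-- The ratio of the geometric series of the powers `(2 ^ n) ^ q`. -/
noncomputable def geomConst (q : ℝ) : ℝ≥0∞ := (1 - ((2 : ℝ≥0∞) ^ q)⁻¹)⁻¹

theorem geomConst_ne_top {q : ℝ} (hq : 0 < q) : geomConst q ≠ ∞ := by
  have h : 1 < (2 : ℝ≥0∞) ^ q := ENNReal.one_lt_rpow ENNReal.one_lt_two hq
  have : ((2 : ℝ≥0∞) ^ q)⁻¹ < 1 := ENNReal.inv_lt_one.2 h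
  exact ENNReal.inv_ne_top.2 (tsub_pos_of_lt this).ne'

theorem geomConst_ne_zero (q : ℝ) : geomConst q ≠ 0 :=
  ENNReal.inv_ne_zero.2 (ENNReal.sub_ne_top ENNReal.one_ne_top)

/-- If 2^N < t ≤ 2^(N+1), the contributing indices are n ≤ N, and the series is geometric going down
from its top term. With the reverse bound below, this is a dyadic layer-cake formula. -/
theorem tsum_zpow_rpow_lt_le {q : ℝ} (hq : 0 < q) (t : ℝ≥0∞) :
    ∑' n : ℤ, (if (2 : ℝ≥0∞) ^ n < t then ((2 : ℝ≥0∞) ^ n) ^ q else 0) ≤ geomConst q * t ^ q := by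
  rcases eq_or_ne t 0 with rfl | h0
  · simp
  rcases eq_or_ne t ∞ with rfl | ht
  · rw [ENNReal.top_rpow_of_pos hq, ENNReal.mul_top (geomConst_ne_zero q)]
    exact le_top
  obtain ⟨N, hN1, hN2⟩ := ENNReal.exists_mem_Ioc_zpow h0 ht ENNReal.one_lt_two ENNReal.ofNat_ne_top
  set f : ℤ → ℝ≥0∞ := fun n => if (2 : ℝ≥0∞) ^ n < t then ((2 : ℝ≥0∞) ^ n) ^ q else 0 with hf
  have hinj : Function.Injective (fun j : ℕ => N - (j : ℤ)) := fun a b h => by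
    have h : N - (a : ℤ) = N - b := h
    omega
  have hsupp : Function.support f ⊆ Set.range (fun j : ℕ => N - (j : ℤ)) := by
    intro n hn
    have hlt : (2 : ℝ≥0∞) ^ n < t := by
      by_contra h
      exact hn (by simp [hf, h])
    have h2 : n < N + 1 := by
      by_contra h
      exact absurd ((hlt.trans_le hN2).trans_le
        (ENNReal.zpow_le_of_le ENNReal.one_lt_two.le (not_lt.1 h))) (lt_irrefl _)
    exact ⟨(N - n).toNat, by simp; omega⟩
  have hqt : (2 : ℝ≥0∞) ^ q ≠ ∞ := ENNReal.rpow_ne_top_of_nonneg hq.le ENNReal.ofNat_ne_top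
  have hq0 : (2 : ℝ≥0∞) ^ q ≠ 0 := by simp [ENNReal.rpow_eq_zero_iff]
  rw [← hinj.tsum_eq hsupp]
  calc ∑' j : ℕ, f (N - j) ≤ ∑' j : ℕ, ((2 : ℝ≥0∞) ^ N) ^ q * (((2 : ℝ≥0∞) ^ q)⁻¹) ^ j := by
        refine ENNReal.tsum_le_tsum fun j => ?_
        simp only [hf]
        split_ifs
        · rw [ENNReal.zpow_rpow_comm, ENNReal.zpow_rpow_comm, ENNReal.zpow_sub hq0 hqt,
            zpow_natCast, ENNReal.inv_pow]
        · exact bot_le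
    _ = geomConst q * ((2 : ℝ≥0∞) ^ N) ^ q := by
        rw [ENNReal.tsum_mul_left, ENNReal.tsum_geometric, mul_comm]; rfl
    _ ≤ geomConst q * t ^ q := by gcongr

theorem rpow_le_tsum_zpow_rpow_lt {q : ℝ} (hq : 0 < q) {t : ℝ≥0∞} (ht : t ≠ ∞) :
    t ^ q ≤ 2 ^ q *
      ∑' n : ℤ, (if (2 : ℝ≥0∞) ^ n < t then ((2 : ℝ≥0∞) ^ n) ^ q else 0) := by
  rcases eq_or_ne t 0 with rfl | h0
  · simp [hq]
  obtain ⟨N, hN1, hN2⟩ := ENNReal.exists_mem_Ioc_zpow h0 ht ENNReal.one_lt_two ENNReal.ofNat_ne_top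
  calc t ^ q ≤ ((2 : ℝ≥0∞) ^ (N + 1)) ^ q := by gcongr
    _ = 2 ^ q * ((2 : ℝ≥0∞) ^ N) ^ q := by
        rw [ENNReal.zpow_add two_ne_zero ENNReal.ofNat_ne_top, zpow_one, mul_comm,
          ENNReal.mul_rpow_of_nonneg _ _ hq.le]
    _ ≤ _ := by
        gcongr
        refine le_trans ?_ (ENNReal.le_tsum N)
        rw [if_pos hN1]

/-- The number of dyadic scales in a window of bounded ratio. -/
theorem tsum_window_le (e : ℝ≥0) (he : 0 < e) (N : ℕ) (t : ℝ≥0∞) :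
    ∑' n : ℤ, (if e * (2 : ℝ≥0∞) ^ n < t ∧ t ≤ e * (2 : ℝ≥0∞) ^ (n + N) then 1 else 0)
      ≤ (N : ℝ≥0∞) := by
  have he0 : (e : ℝ≥0∞) ≠ 0 := by exact_mod_cast he.ne'
  rcases eq_or_ne t 0 with rfl | h0
  · simp
  rcases eq_or_ne t ∞ with rfl | ht
  · have : ∀ n : ℤ, ¬ (∞ ≤ e * (2 : ℝ≥0∞) ^ (n + N)) := fun n h =>
      ENNReal.mul_ne_top ENNReal.coe_ne_top
        (ENNReal.zpow_ne_top two_ne_zero ENNReal.ofNat_ne_top _) (top_le_iff.1 h)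
    simp [this]
  obtain ⟨M, hM1, hM2⟩ := ENNReal.exists_mem_Ioc_zpow
    (ENNReal.div_ne_zero.2 ⟨h0, ENNReal.coe_ne_top (r := e)⟩) (ENNReal.div_ne_top ht he0)
    ENNReal.one_lt_two ENNReal.ofNat_ne_top
  have hmem : ∀ n : ℤ, (e * (2 : ℝ≥0∞) ^ n < t ∧ t ≤ e * (2 : ℝ≥0∞) ^ (n + N)) →
      n ∈ Finset.Ioc (M - N) M := by
    rintro n ⟨h1, h2⟩
    have h1' : (2 : ℝ≥0∞) ^ n < t / e := by
      rw [ENNReal.lt_div_iff_mul_lt (Or.inl he0) (Or.inl ENNReal.coe_ne_top), mul_comm]; exact h1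
    have h2' : t / e ≤ (2 : ℝ≥0∞) ^ (n + N) := by
      rw [ENNReal.div_le_iff he0 ENNReal.coe_ne_top, mul_comm]; exact h2
    rw [Finset.mem_Ioc]
    constructor
    · by_contra h
      exact absurd ((hM1.trans_le h2').trans_le (ENNReal.zpow_le_of_le ENNReal.one_lt_two.le
        (by omega : n + N ≤ M))) (lt_irrefl _)
    · by_contra h
      exact absurd ((h1'.trans_le hM2).trans_le (ENNReal.zpow_le_of_le ENNReal.one_lt_two.le
        (by omega : M + 1 ≤ n))) (lt_irrefl _)
  rw [tsum_eq_sum (s := Finset.Ioc (M - N) M) fun n hn => if_neg fun h => hn (hmem n h)]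
  calc _ ≤ ∑ _n ∈ Finset.Ioc (M - (N : ℤ)) M, (1 : ℝ≥0∞) :=
        Finset.sum_le_sum fun n _ => by split_ifs <;> simp
    _ = N := by simp

/-- A sum of distinct powers of two is at most twice its largest term, so no factor depending on the
number of terms appears. The gain from averaging k truncations depends on this: k terms each
weighted k^(-p) leave k^(1-p). -/
theorem rpow_sum_two_pow_le {p : ℝ} (hp : 0 < p) (T : Finset ℕ) (a : ℝ≥0∞) :
    (∑ i ∈ T, 2 ^ i * a) ^ p ≤ 2 ^ p * ∑ i ∈ T, (2 ^ i * a) ^ p := by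
  rcases T.eq_empty_or_nonempty with rfl | hT
  · simp [hp]
  set N := T.max' hT
  have h1 : ∑ i ∈ T, (2 : ℝ≥0∞) ^ i ≤ 2 * 2 ^ N := by
    have hsub : T ⊆ Finset.range (N + 1) := fun i hi =>
      Finset.mem_range.2 (Nat.lt_succ_of_le (Finset.le_max' T i hi))
    have : ∑ i ∈ Finset.range (N + 1), (2 : ℕ) ^ i ≤ 2 * 2 ^ N := by
      rw [← pow_succ']
      exact (Nat.geomSum_lt le_rfl fun i hi => Finset.mem_range.1 hi).le
    exact (Finset.sum_le_sum_of_subset hsub).trans (by exact_mod_cast this)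
  calc (∑ i ∈ T, 2 ^ i * a) ^ p ≤ (2 * 2 ^ N * a) ^ p := by
        rw [← Finset.sum_mul]; gcongr
    _ = 2 ^ p * (2 ^ N * a) ^ p := by rw [mul_assoc, ENNReal.mul_rpow_of_nonneg _ _ hp.le]
    _ ≤ _ := by
        gcongr
        exact Finset.single_le_sum (f := fun i => ((2 : ℝ≥0∞) ^ i * a) ^ p)
          (fun _ _ => bot_le) (T.max'_mem hT)

theorem ENNReal.rpow_add_three_le {p : ℝ} (hp : 0 < p) (a b c : ℝ≥0∞) :
    (a + b + c) ^ p ≤ 3 ^ p * (a ^ p + b ^ p + c ^ p) := by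
  have h : a + b + c ≤ 3 * max a (max b c) := by
    calc a + b + c ≤ max a (max b c) + max a (max b c) + max a (max b c) := by
          gcongr <;> simp
      _ = _ := by ring
  calc (a + b + c) ^ p ≤ (3 * max a (max b c)) ^ p := by gcongr
    _ = 3 ^ p * max a (max b c) ^ p := ENNReal.mul_rpow_of_nonneg _ _ hp.le
    _ ≤ _ := by
        gcongr
        rcases max_choice a (max b c) with h | h
        · rw [h, add_assoc]; exact le_self_add
        · rw [h]
          rcases max_choice b c with h | h
          · rw [h, add_assoc]; exact le_self_add.trans le_add_self
          · rw [h]; exact le_add_self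

end DyadicSums

/-! ### Stability of Lipschitz functions with bounded support. -/

section Algebra

variable {X : Type*} [MetricSpace X]

theorem IsLipBS.sum {ι : Type*} {s : Finset ι} {u : ι → X → ℝ} (h : ∀ i ∈ s, IsLipBS (u i)) :
    IsLipBS fun x => ∑ i ∈ s, u i x := by
  classical
  induction s using Finset.induction_on with
  | empty => exact ⟨⟨0, by simp⟩, by simp⟩
  | insert a s ha ih =>
    obtain ⟨⟨K, hK⟩, hb⟩ := h a (Finset.mem_insert_self a s)
    obtain ⟨⟨K', hK'⟩, hb'⟩ := ih fun i hi => h i (Finset.mem_insert_of_mem hi)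
    simp only [Finset.sum_insert ha]
    exact ⟨⟨K + K', hK.add hK'⟩, (hb.union hb').subset (Function.support_add _ _)⟩

theorem IsLipBS.const_mul {u : X → ℝ} (h : IsLipBS u) (c : ℝ) : IsLipBS fun x => c * u x := by
  obtain ⟨⟨K, hK⟩, hb⟩ := h
  refine ⟨⟨‖c‖₊ * K, ?_⟩, hb.subset fun x hx => ?_⟩
  · intro x y
    rw [edist_eq_enorm_sub, ← mul_sub, enorm_mul, ← edist_eq_enorm_sub, ENNReal.coe_mul, mul_assoc]
    exact mul_le_mul_right (hK x y) _
  · rw [Function.mem_support] at hx ⊢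
    exact right_ne_zero_of_mul hx

end Algebra

/-! ### Poincaré inequality for a multilevel truncation. -/

section LevelInequality

variable {X : Type*} [MetricSpace X] [MeasurableSpace X] [BorelSpace X] {m : Measure X} {D : ℝ≥0}

/-- The `(1,p)`-Poincaré inequality with constant `C`. -/
def PoincareWith (p : ℝ) (m : Measure X) (C : ℝ≥0) : Prop :=
  ∀ g : X → ℝ, IsLipBS g → ∀ (x : X) (r : ℝ), 0 < r →
    ballOsc m g x r ≤
      C * ENNReal.ofReal r * (⨍⁻ y in Metric.ball x r, slopeAt g y ^ p ∂m) ^ (1 / p)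

namespace DoublingWith

theorem ballOsc_le_add (hm : DoublingWith m D) {u h : X → ℝ} {L L' : ℝ≥0}
    (hu : LipschitzWith L u) (hh : LipschitzWith L' h) (z : X) {r : ℝ} (hr : 0 < r) :
    ballOsc m u z r ≤ ballOsc m h z r + 2 * ⨍⁻ y in Metric.ball z r, ‖u y - h y‖ₑ ∂m := by
  set B := Metric.ball z r
  have havg : ‖(⨍ y in B, h y ∂m) - ⨍ y in B, u y ∂m‖ₑ ≤ ⨍⁻ y in B, ‖u y - h y‖ₑ ∂m := by
    have h1 := hm.enorm_sub_average_le (hu.sub hh) z hr 0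
    have h2 : ⨍ y in B, (u y - h y) ∂m = (⨍ y in B, u y ∂m) - ⨍ y in B, h y ∂m := by
      rw [setAverage_eq, setAverage_eq, setAverage_eq,
        integral_sub (hm.integrableOn_ball hu z r) (hm.integrableOn_ball hh z r), smul_sub]
    change ‖0 - ⨍ y in B, (u y - h y) ∂m‖ₑ ≤ _ at h1
    rw [h2, zero_sub, enorm_neg] at h1
    rw [enorm_sub_rev]
    simpa only [zero_sub, enorm_neg] using h1
  have hmeas : Measurable fun y => ‖u y - h y‖ₑ := (hu.sub hh).continuous.measurable.enorm
  have hmeas2 : Measurable fun y => ‖h y - ⨍ w in B, h w ∂m‖ₑ :=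
    (hh.continuous.measurable.sub_const _).enorm
  calc ballOsc m u z r
      ≤ ⨍⁻ y in B, (‖h y - ⨍ w in B, h w ∂m‖ₑ + ‖u y - h y‖ₑ
          + ‖(⨍ y in B, h y ∂m) - ⨍ y in B, u y ∂m‖ₑ) ∂m := by
        refine setLAverage_mono (m := m) measurableSet_ball fun y _ => ?_
        have : u y - ⨍ w in Metric.ball z r, u w ∂m = (h y - ⨍ w in B, h w ∂m) + (u y - h y)
          + ((⨍ y in B, h y ∂m) - ⨍ y in B, u y ∂m) := by ring
        rw [this]
        exact (enorm_add_le _ _).trans (add_le_add (enorm_add_le _ _) le_rfl)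
    _ = ballOsc m h z r + (⨍⁻ y in B, ‖u y - h y‖ₑ ∂m)
          + ⨍⁻ _y in B, ‖(⨍ y in B, h y ∂m) - ⨍ y in B, u y ∂m‖ₑ ∂m := by
        rw [ballOsc, setLAverage_eq, setLAverage_eq, setLAverage_eq, setLAverage_eq,
          lintegral_add_left (f := fun y => ‖h y - ⨍ w in B, h w ∂m‖ₑ + ‖u y - h y‖ₑ)
            (hmeas2.add hmeas), lintegral_add_left hmeas2,
          ENNReal.add_div, ENNReal.add_div]
    _ ≤ _ := by
        rw [two_mul, ← add_assoc]
        exact add_le_add le_rfl ((setLAverage_const_le _).trans havg)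

/-- If `h` is close to `u` on a ball where `u` oscillates, then the energy of `h` on the ball is
bounded below, up to an error. -/
theorem mul_measure_ball_le_of_close (hm : DoublingWith m D) {p : ℝ} (hp : 1 < p) {CP : ℝ≥0}
    (hP : PoincareWith p m CP) {u h : X → ℝ} (hu : IsLipBS u) (hh : IsLipBS h)
    {lam c : ℝ≥0} (hlam : 0 < lam) {T : X → ℝ≥0∞}
    {b : X × ℝ} (hb : b ∈ oscillatingBalls m u lam)
    (hT : ∀ y ∈ Metric.ball b.1 b.2, ‖u y - h y‖ₑ ≤ c * ENNReal.ofReal b.2 * T y) :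
    (lam : ℝ≥0∞) ^ p * m (Metric.ball b.1 b.2) ≤
      (2 * CP) ^ p * ∫⁻ y in Metric.ball b.1 b.2, slopeAt h y ^ p ∂m +
        4 * c * (lam : ℝ≥0∞) ^ (p - 1) * ∫⁻ y in Metric.ball b.1 b.2, T y ∂m := by
  obtain ⟨z, r⟩ := b
  obtain ⟨hr, hosc⟩ := hb
  simp only at hr hosc hT ⊢
  obtain ⟨L, hL⟩ := hu.1
  obtain ⟨L', hL'⟩ := hh.1
  have hp0 : 0 < p := one_pos.trans hp
  set B := Metric.ball z r with hB
  have hB0 : m B ≠ 0 := (hm.pos z r hr).ne'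
  have hBt : m B ≠ ∞ := (hm.fin z r).ne
  have hr0 : ENNReal.ofReal r ≠ 0 := by simpa using hr
  have hlam0 : (lam : ℝ≥0∞) ≠ 0 := by exact_mod_cast hlam.ne'
  set a : ℝ≥0∞ := CP * (⨍⁻ y in B, slopeAt h y ^ p ∂m) ^ (1 / p)
  set t : ℝ≥0∞ := 2 * c * ((∫⁻ y in B, T y ∂m) / m B)
  have hle : (lam : ℝ≥0∞) ≤ a + t := by
    have h1 : ⨍⁻ y in B, ‖u y - h y‖ₑ ∂m ≤
        c * ENNReal.ofReal r * ((∫⁻ y in B, T y ∂m) / m B) := by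
      refine (setLAverage_mono measurableSet_ball hT).trans_eq ?_
      rw [setLAverage_eq, lintegral_const_mul' _ _ (by finiteness), mul_div_assoc]
    have h2 : lam * ENNReal.ofReal r ≤ (a + t) * ENNReal.ofReal r := by
      calc lam * ENNReal.ofReal r ≤ ballOsc m u z r := hosc.le
        _ ≤ ballOsc m h z r + 2 * ⨍⁻ y in B, ‖u y - h y‖ₑ ∂m := hm.ballOsc_le_add hL hL' z hr
        _ ≤ CP * ENNReal.ofReal r * (⨍⁻ y in B, slopeAt h y ^ p ∂m) ^ (1 / p)
            + 2 * (c * ENNReal.ofReal r * ((∫⁻ y in B, T y ∂m) / m B)) :=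
            add_le_add (hP h hh z r hr) (mul_le_mul_right h1 _)
        _ = _ := by simp only [a, t]; ring
    exact (ENNReal.mul_le_mul_iff_left hr0 ENNReal.ofReal_ne_top).1 h2
  -- Either the Poincaré term or the error is at least λ/2. In the first case the inequality is
  -- raised to the power p. In the second it is multiplied by λ^(p-1), so the error stays linear in
  -- `T`.
  have hhalf : (lam : ℝ≥0∞) ≤ 2 * a ∨ (lam : ℝ≥0∞) ≤ 2 * t := by
    by_contra! hcon
    have h1 : 2 * (a + t) < lam + lam := by
      rw [mul_add]; exact ENNReal.add_lt_add hcon.1 hcon.2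
    rw [← two_mul] at h1
    exact absurd (h1.trans_le (mul_le_mul_right hle 2)) (lt_irrefl _)
  rcases hhalf with h1 | h1
  · refine le_trans ?_ le_self_add
    calc (lam : ℝ≥0∞) ^ p * m B ≤ (2 * a) ^ p * m B := by gcongr
      _ = (2 * CP) ^ p * ((∫⁻ y in B, slopeAt h y ^ p ∂m) / m B) * m B := by
          simp only [a]
          rw [← mul_assoc, ENNReal.mul_rpow_of_nonneg _ _ hp0.le, ← ENNReal.rpow_mul,
            one_div_mul_cancel hp0.ne', ENNReal.rpow_one, setLAverage_eq]
      _ = _ := by rw [mul_assoc, ENNReal.div_mul_cancel hB0 hBt]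
  · refine le_trans ?_ le_add_self
    calc (lam : ℝ≥0∞) ^ p * m B = (lam : ℝ≥0∞) ^ (p - 1) * lam * m B := by
          congr 1
          conv_rhs => rw [← ENNReal.rpow_one (lam : ℝ≥0∞), ← ENNReal.rpow_mul]
          rw [one_mul, ← ENNReal.rpow_add _ _ hlam0 ENNReal.coe_ne_top, sub_add_cancel]
      _ ≤ (lam : ℝ≥0∞) ^ (p - 1) * (2 * t) * m B := by gcongr
      _ = 4 * c * (lam : ℝ≥0∞) ^ (p - 1) * (((∫⁻ y in B, T y ∂m) / m B) * m B) := by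
          simp only [t]; ring
      _ = _ := by rw [ENNReal.div_mul_cancel hB0 hBt]

/-- The mean of the Lipschitz truncations of `u` at the dyadic levels `2 ^ i * lam`, `k ≤ i < 2k`:
its closeness to `u` and a bound for its slope. -/
theorem exists_multilevel_truncation [TopologicalSpace.SeparableSpace X] (hm : DoublingWith m D)
    {u : X → ℝ} (hu : IsLipBS u) {lam e : ℝ≥0} (hlam : 0 < lam) {k : ℕ} (hk : 0 < k) :
    ∃ h : X → ℝ, IsLipBS h ∧
      (∀ (z : X) (r : ℝ), 0 < r → (∃ y' ∈ Metric.ball z r, sharpMax m u y' ≤ 2 ^ k * lam) →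
        ∀ y ∈ Metric.ball z r, ‖u y - h y‖ₑ ≤ 60 * D ^ 2 * ENNReal.ofReal r *
          {x | 2 ^ k * lam < sharpMax m u x}.indicator (sharpMax m u) y) ∧
      ∀ᵐ x ∂m, slopeAt h x ≤ e * lam +
        {x | e * lam < slopeAt u x ∧ slopeAt u x ≤ 24 * D ^ 2 * (2 ^ (2 * k) * lam)}.indicator
          (slopeAt u) x +
        24 * D ^ 2 * (k : ℝ≥0∞)⁻¹ *
          ∑ i ∈ Finset.Ico k (2 * k) with 2 ^ i * lam < sharpMax m u x, (2 : ℝ≥0∞) ^ i * lam := by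
  obtain ⟨L, hL⟩ := hu.1
  have hpos : ∀ i : ℕ, 0 < 2 ^ i * lam := fun i => by positivity
  choose v hv hvb hve using fun i : ℕ => hm.exists_lipschitz_truncation hu (hpos i)
  have hk0 : (k : ℝ) ≠ 0 := by exact_mod_cast hk.ne'
  have hcard : (Finset.Ico k (2 * k)).card = k := by rw [Nat.card_Ico]; omega
  have hkn : ‖((k : ℝ)⁻¹)‖ₑ = (k : ℝ≥0∞)⁻¹ := by
    rw [enorm_inv hk0]; simp
  have hkE : (k : ℝ≥0∞) ≠ 0 := by exact_mod_cast hk.ne'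
  have hmean : ∀ c : ℝ≥0∞, (k : ℝ≥0∞)⁻¹ * ∑ _i ∈ Finset.Ico k (2 * k), c = c := by
    intro c
    rw [Finset.sum_const, hcard, nsmul_eq_mul, ← mul_assoc,
      ENNReal.inv_mul_cancel hkE (ENNReal.natCast_ne_top k), one_mul]
  refine ⟨fun x => (k : ℝ)⁻¹ * ∑ i ∈ Finset.Ico k (2 * k), v i x,
    (IsLipBS.sum fun i _ => hvb i).const_mul _, ?_, ?_⟩
  · rintro z r hr ⟨y', hy', hS⟩ y hy
    have hrepr : u y - (k : ℝ)⁻¹ * ∑ i ∈ Finset.Ico k (2 * k), v i y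
        = (k : ℝ)⁻¹ * ∑ i ∈ Finset.Ico k (2 * k), (u y - v i y) := by
      rw [Finset.sum_sub_distrib, Finset.sum_const, hcard, nsmul_eq_mul, mul_sub,
        inv_mul_cancel_left₀ hk0]
    rw [hrepr, enorm_mul, hkn]
    refine le_trans ?_ (hmean _).le
    refine mul_le_mul_right ((enorm_sum_le _ _).trans (Finset.sum_le_sum fun i hi => ?_)) _
    have hki : 2 ^ k * lam ≤ 2 ^ i * lam := by
      gcongr
      · exact one_le_two
      · exact (Finset.mem_Ico.1 hi).1
    have := hm.enorm_sub_truncation_le hL (hv i) (hve i) hki hr hy'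
      (by push_cast; exact hS) hy
    push_cast at this
    exact this
  · have hae : ∀ᵐ x ∂m, ∀ i : ℕ, (v i x = u x → slopeAt (v i) x ≤ slopeAt u x) ∧
        (u x = v i x → slopeAt u x ≤ slopeAt (v i) x) :=
      ae_all_iff.2 fun i => (hm.ae_slopeAt_le_of_eq (hv i) hL).and
        (hm.ae_slopeAt_le_of_eq hL (hv i))
    filter_upwards [hae] with x hx
    set G : ℝ≥0∞ := e * lam +
        {x | e * lam < slopeAt u x ∧ slopeAt u x ≤ 24 * D ^ 2 * (2 ^ (2 * k) * lam)}.indicator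
          (slopeAt u) x with hG
    -- Where S exceeds the i-th level, only the Lipschitz constant of the truncation is available.
    -- Elsewhere the truncation equals u at x and the slopes coincide, so that constant also bounds
    -- the slope of u. This produces the upper end of the window.
    have hslope : ∀ i ∈ Finset.Ico k (2 * k), slopeAt (v i) x ≤
        G + 24 * D ^ 2 * (if 2 ^ i * lam < sharpMax m u x then (2 : ℝ≥0∞) ^ i * lam else 0) := by
      intro i hi
      have hK := (hv i).slopeAt_le x
      push_cast at hK
      by_cases hS : 2 ^ i * lam < sharpMax m u x
      · rw [if_pos hS]
        exact hK.trans le_add_self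
      · rw [if_neg hS, mul_zero, add_zero]
        have hvu := hve i x (by push_cast; exact not_lt.1 hS)
        refine ((hx i).1 hvu).trans ?_
        have hg : slopeAt u x ≤ 24 * D ^ 2 * (2 ^ (2 * k) * lam) := by
          refine (((hx i).2 hvu.symm).trans hK).trans ?_
          gcongr
          · exact one_le_two
          · exact (Finset.mem_Ico.1 hi).2.le
        by_cases hge : e * lam < slopeAt u x
        · rw [hG, Set.indicator_of_mem (show x ∈ {x | e * lam < slopeAt u x ∧
            slopeAt u x ≤ 24 * D ^ 2 * (2 ^ (2 * k) * lam)} from ⟨hge, hg⟩)]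
          exact le_add_self
        · exact (not_lt.1 hge).trans le_self_add
    refine (slopeAt_const_mul_le _ _ _).trans ?_
    rw [hkn]
    refine (mul_le_mul_right ((slopeAt_sum_le _ _ _).trans (Finset.sum_le_sum hslope)) _).trans ?_
    rw [Finset.sum_add_distrib, mul_add, hmean, ← Finset.mul_sum, Finset.sum_filter]
    refine add_le_add le_rfl (le_of_eq ?_)
    ring

end DoublingWith

end LevelInequality

/-! ### Summation of the level densities over dyadic levels. -/

section Density

/-- The density that controls the superlevel set of the sharp maximal function at level `lam`,
as a function of the values `g` of the slope and `S` of the sharp maximal function. -/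
noncomputable def levelDensity (p : ℝ) (D CP e : ℝ≥0) (k : ℕ) (lam g S : ℝ≥0∞) : ℝ≥0∞ :=
  2 * (6 * CP) ^ p *
      (if e * lam < g ∧ g ≤ 24 * D ^ 2 * (2 ^ (2 * k) * lam) then g ^ p else 0) +
    2 * (6 * CP) ^ p * (48 * D ^ 2 * (k : ℝ≥0∞)⁻¹) ^ p *
      ∑ i ∈ Finset.Ico k (2 * k), (if 2 ^ i * lam < S then (2 ^ i * lam) ^ p else 0) +
    480 * D ^ 2 * (lam ^ (p - 1) * if 2 ^ k * lam < S then S else 0)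

/-- The dyadic sum comparable to `S ^ p`. -/
noncomputable def dyadicPow (p : ℝ) (S : ℝ≥0∞) : ℝ≥0∞ :=
  ∑' n : ℤ, (if (2 : ℝ≥0∞) ^ n < S then ((2 : ℝ≥0∞) ^ n) ^ p else 0)

/-- The coefficient of the term that is absorbed. -/
noncomputable def absorbCoeff (p : ℝ) (D CP : ℝ≥0) (k : ℕ) : ℝ≥0∞ :=
  2 * (6 * CP) ^ p * (48 * D ^ 2) ^ p * ((k : ℝ≥0∞)⁻¹) ^ (p - 1) +
    480 * D ^ 2 * (geomConst (p - 1) * 2 ^ p) * (((2 : ℝ≥0∞) ^ k)⁻¹) ^ (p - 1)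

theorem measurable_levelDensity (p : ℝ) (D CP e : ℝ≥0) (k : ℕ) (lam : ℝ≥0∞)
    {X : Type*} [MeasurableSpace X] {g S : X → ℝ≥0∞} (hg : Measurable g) (hS : Measurable S) :
    Measurable fun x => levelDensity p D CP e k lam (g x) (S x) := by
  unfold levelDensity
  refine ((Measurable.const_mul (Measurable.ite ?_ (hg.pow_const p) measurable_const) _).add
    (Measurable.const_mul (Finset.measurable_fun_sum _ fun i _ => Measurable.ite ?_
      measurable_const measurable_const) _)).add
    (Measurable.const_mul (Measurable.const_mul (Measurable.ite ?_ hS measurable_const) _) _)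
  · exact (measurableSet_lt measurable_const hg).inter (measurableSet_le hg measurable_const)
  · exact measurableSet_lt measurable_const hS
  · exact measurableSet_lt measurable_const hS

theorem measurable_dyadicPow (p : ℝ) : Measurable (dyadicPow p) :=
  Measurable.tsum fun _ => Measurable.ite (measurableSet_lt measurable_const measurable_id)
    measurable_const measurable_const

/-- Here p > 1 is decisive. The factor k^(1-p) comes from averaging k truncations, and 2^(-k(p-1))
from the error supported where S exceeds 2^k λ. -/
theorem tendsto_absorbCoeff {p : ℝ} (hp : 1 < p) (D CP : ℝ≥0) :
    Tendsto (absorbCoeff p D CP) atTop (𝓝 0) := by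
  have hp1 : 0 < p - 1 := sub_pos.2 hp
  have hp0 : 0 < p := one_pos.trans hp
  have hpow : Tendsto (fun x : ℝ≥0∞ => x ^ (p - 1)) (𝓝 0) (𝓝 0) := by
    have := (ENNReal.continuous_rpow_const (y := p - 1)).tendsto 0
    rwa [ENNReal.zero_rpow_of_pos hp1] at this
  have h1 : Tendsto (fun k : ℕ => ((k : ℝ≥0∞)⁻¹) ^ (p - 1)) atTop (𝓝 0) :=
    hpow.comp ENNReal.tendsto_inv_nat_nhds_zero
  have h2 : Tendsto (fun k : ℕ => (((2 : ℝ≥0∞) ^ k)⁻¹) ^ (p - 1)) atTop (𝓝 0) := by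
    refine hpow.comp ?_
    simp_rw [ENNReal.inv_pow]
    exact ENNReal.tendsto_pow_atTop_nhds_zero_of_lt_one (by norm_num)
  have hg := geomConst_ne_top hp1
  have h3 := (ENNReal.Tendsto.const_mul (a := 2 * (6 * (CP : ℝ≥0∞)) ^ p * (48 * D ^ 2) ^ p) h1
    (Or.inr (by finiteness))).add (ENNReal.Tendsto.const_mul
      (a := 480 * (D : ℝ≥0∞) ^ 2 * (geomConst (p - 1) * 2 ^ p)) h2 (Or.inr (by finiteness)))
  rw [mul_zero, mul_zero, add_zero] at h3
  exact h3

/-- By `hN` the window spans at most N dyadic scales, so each value g is counted at most N times. In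
the second term, shifting n by i turns each of the k inner sums into the same dyadic sum. The third
is a geometric series in λ^(p-1) over λ < S/2^k. -/
theorem tsum_levelDensity_le {p : ℝ} (hp : 1 < p) (D CP : ℝ≥0) {e : ℝ≥0} (he : 0 < e) {k : ℕ}
    (hk : 0 < k) {N : ℕ} (hN : 24 * D ^ 2 * 2 ^ (2 * k) ≤ e * 2 ^ N) (g : ℝ≥0∞) {S : ℝ≥0∞}
    (hS : S ≠ ∞) :
    ∑' n : ℤ, levelDensity p D CP e k ((2 : ℝ≥0∞) ^ n) g S ≤
      2 * (6 * CP) ^ p * N * g ^ p + absorbCoeff p D CP k * dyadicPow p S := by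
  have hp1 : 0 < p - 1 := sub_pos.2 hp
  have hp0 : 0 < p := one_pos.trans hp
  have h2n : ∀ n : ℤ, (2 : ℝ≥0∞) ^ n ≠ 0 := fun n => (ENNReal.zpow_pos two_ne_zero
    ENNReal.ofNat_ne_top n).ne'
  simp only [levelDensity]
  rw [ENNReal.tsum_add, ENNReal.tsum_add, ENNReal.tsum_mul_left, ENNReal.tsum_mul_left,
    ENNReal.tsum_mul_left]
  have hA : ∑' n : ℤ, (if e * (2 : ℝ≥0∞) ^ n < g ∧
      g ≤ 24 * D ^ 2 * (2 ^ (2 * k) * (2 : ℝ≥0∞) ^ n) then g ^ p else 0) ≤ N * g ^ p := by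
    calc _ ≤ ∑' n : ℤ, (if e * (2 : ℝ≥0∞) ^ n < g ∧ g ≤ e * (2 : ℝ≥0∞) ^ (n + N) then 1 else 0)
          * g ^ p := by
          refine ENNReal.tsum_le_tsum fun n => ?_
          by_cases h : e * (2 : ℝ≥0∞) ^ n < g ∧ g ≤ 24 * D ^ 2 * (2 ^ (2 * k) * (2 : ℝ≥0∞) ^ n)
          · have h' : g ≤ e * (2 : ℝ≥0∞) ^ (n + N) := by
              refine h.2.trans ?_
              rw [ENNReal.zpow_add two_ne_zero ENNReal.ofNat_ne_top, zpow_natCast, ← mul_assoc,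
                mul_comm ((2 : ℝ≥0∞) ^ n), ← mul_assoc (e : ℝ≥0∞)]
              exact mul_le_mul' (by exact_mod_cast hN) le_rfl
            rw [if_pos h, if_pos ⟨h.1, h'⟩, one_mul]
          · rw [if_neg h]; exact bot_le
      _ ≤ _ := by
          rw [ENNReal.tsum_mul_right]
          gcongr
          exact tsum_window_le e he N g
  have hB : ∑' n : ℤ, ∑ i ∈ Finset.Ico k (2 * k), (if 2 ^ i * (2 : ℝ≥0∞) ^ n < S then
      (2 ^ i * (2 : ℝ≥0∞) ^ n) ^ p else 0) = k * dyadicPow p S := by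
    rw [Summable.tsum_finsetSum fun _ _ => ENNReal.summable]
    have : ∀ i : ℕ, ∑' n : ℤ, (if 2 ^ i * (2 : ℝ≥0∞) ^ n < S then
        (2 ^ i * (2 : ℝ≥0∞) ^ n) ^ p else 0) = dyadicPow p S := by
      intro i
      refine Eq.trans ?_ ((Equiv.addLeft (i : ℤ)).tsum_eq
        fun n : ℤ => if (2 : ℝ≥0∞) ^ n < S then ((2 : ℝ≥0∞) ^ n) ^ p else 0)
      refine tsum_congr fun n => ?_
      rw [Equiv.coe_addLeft, ENNReal.zpow_add two_ne_zero ENNReal.ofNat_ne_top, zpow_natCast]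
    rw [Finset.sum_congr rfl fun i _ => this i, Finset.sum_const, Nat.card_Ico, nsmul_eq_mul]
    congr 2
    omega
  have hC : ∑' n : ℤ, ((2 : ℝ≥0∞) ^ n) ^ (p - 1) * (if 2 ^ k * (2 : ℝ≥0∞) ^ n < S then S else 0) ≤
      geomConst (p - 1) * 2 ^ p * (((2 : ℝ≥0∞) ^ k)⁻¹) ^ (p - 1) * dyadicPow p S := by
    have h2k : (2 : ℝ≥0∞) ^ k ≠ 0 := pow_ne_zero _ two_ne_zero
    have h2kt : (2 : ℝ≥0∞) ^ k ≠ ∞ := by finiteness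
    have hcond : ∀ n : ℤ, 2 ^ k * (2 : ℝ≥0∞) ^ n < S ↔ (2 : ℝ≥0∞) ^ n < S / 2 ^ k := fun n => by
      rw [ENNReal.lt_div_iff_mul_lt (Or.inl h2k) (Or.inl h2kt), mul_comm]
    have hSp : S ^ (p - 1) * S = S ^ p := by
      rcases eq_or_ne S 0 with rfl | h0
      · simp [hp0]
      · nth_rw 2 [← ENNReal.rpow_one S]
        rw [← ENNReal.rpow_add _ _ h0 hS, sub_add_cancel]
    calc _ = ∑' n : ℤ, (if (2 : ℝ≥0∞) ^ n < S / 2 ^ k then ((2 : ℝ≥0∞) ^ n) ^ (p - 1) else 0)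
          * S := by
          refine tsum_congr fun n => ?_
          simp only [hcond]
          split_ifs <;> simp
      _ ≤ geomConst (p - 1) * (S / 2 ^ k) ^ (p - 1) * S := by
          rw [ENNReal.tsum_mul_right]
          gcongr
          exact tsum_zpow_rpow_lt_le hp1 _
      _ = geomConst (p - 1) * (((2 : ℝ≥0∞) ^ k)⁻¹) ^ (p - 1) * S ^ p := by
          rw [div_eq_mul_inv, ENNReal.mul_rpow_of_nonneg _ _ hp1.le, ← hSp]; ring
      _ ≤ geomConst (p - 1) * (((2 : ℝ≥0∞) ^ k)⁻¹) ^ (p - 1) * (2 ^ p * dyadicPow p S) := by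
          gcongr
          exact rpow_le_tsum_zpow_rpow_lt hp0 hS
      _ = _ := by ring
  have hkk : ((k : ℝ≥0∞)⁻¹) ^ p * k = ((k : ℝ≥0∞)⁻¹) ^ (p - 1) := by
    have hk0 : (k : ℝ≥0∞) ≠ 0 := by exact_mod_cast hk.ne'
    rw [ENNReal.rpow_sub _ _ (ENNReal.inv_ne_zero.2 (ENNReal.natCast_ne_top k))
      (ENNReal.inv_ne_top.2 hk0), ENNReal.rpow_one, div_eq_mul_inv, inv_inv]
  rw [hB]
  calc _ ≤ 2 * (6 * CP) ^ p * (N * g ^ p)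
        + 2 * (6 * CP) ^ p * (48 * D ^ 2 * (k : ℝ≥0∞)⁻¹) ^ p * (k * dyadicPow p S)
        + 480 * D ^ 2 * (geomConst (p - 1) * 2 ^ p * (((2 : ℝ≥0∞) ^ k)⁻¹) ^ (p - 1)
          * dyadicPow p S) := by gcongr
    _ = 2 * (6 * CP) ^ p * N * g ^ p + (2 * (6 * CP) ^ p * (48 * D ^ 2) ^ p *
          (((k : ℝ≥0∞)⁻¹) ^ p * k) + 480 * D ^ 2 * (geomConst (p - 1) * 2 ^ p)
            * (((2 : ℝ≥0∞) ^ k)⁻¹) ^ (p - 1)) * dyadicPow p S := by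
        rw [ENNReal.mul_rpow_of_nonneg (48 * (D : ℝ≥0∞) ^ 2) _ hp0.le]; ring
    _ = _ := by rw [hkk, absorbCoeff]

end Density

/-! ### The strong-type bound for the sharp maximal function. -/

section Absorption

variable {X : Type*} [MetricSpace X] [MeasurableSpace X] [BorelSpace X] {m : Measure X} {D : ℝ≥0}

theorem lintegral_dyadicPow_sharpMax (p : ℝ) (u : X → ℝ) :
    ∫⁻ x, dyadicPow p (sharpMax m u x) ∂m =
      ∑' n : ℤ, ((2 : ℝ≥0∞) ^ n) ^ p * m {x | (2 : ℝ≥0∞) ^ n < sharpMax m u x} := by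
  have hSm : Measurable (sharpMax m u) := measurable_sharpMax u
  simp only [dyadicPow]
  rw [lintegral_tsum fun n => (Measurable.ite (measurableSet_lt measurable_const hSm)
    measurable_const measurable_const).aemeasurable]
  refine tsum_congr fun n => ?_
  rw [← setLIntegral_const, ← lintegral_indicator (measurableSet_lt measurable_const hSm)]
  refine lintegral_congr fun x => ?_
  simp only [Set.indicator_apply, Set.mem_ofPred_eq]

variable [TopologicalSpace.SeparableSpace X]

namespace DoublingWith

theorem mul_measure_ball_le_levelDensity (hm : DoublingWith m D) {p : ℝ} (hp : 1 < p) {CP : ℝ≥0}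
    (hCP : 0 < CP) (hP : PoincareWith p m CP) {u : X → ℝ} (hu : IsLipBS u) {lam : ℝ≥0}
    (hlam : 0 < lam) {k : ℕ} (hk : 0 < k) {b : X × ℝ} (hb : b ∈ oscillatingBalls m u lam) :
    (lam : ℝ≥0∞) ^ p * m (Metric.ball b.1 b.2) ≤
      ∫⁻ x in Metric.ball b.1 b.2,
        levelDensity p D CP (12 * CP)⁻¹ k lam (slopeAt u x) (sharpMax m u x) ∂m := by
  have hp0 : 0 < p := one_pos.trans hp
  have : Nonempty X := ⟨b.1⟩
  have hD1 : (1 : ℝ≥0∞) ≤ D := by exact_mod_cast hm.one_le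
  obtain ⟨L, hL⟩ := hu.1
  have hg : Measurable (slopeAt u) := measurable_slopeAt hL.continuous
  have hSm : Measurable (sharpMax m u) := measurable_sharpMax u
  set B := Metric.ball b.1 b.2 with hB
  have hBm : MeasurableSet B := measurableSet_ball
  have hBt : m B ≠ ∞ := (hm.fin _ _).ne
  have hlam0 : (lam : ℝ≥0∞) ≠ 0 := by exact_mod_cast hlam.ne'
  set S := sharpMax m u
  -- If S is large on the whole ball, the third term of the density suffices, as λ^p ≤ λ^(p-1) S.
  -- Otherwise some point of the ball has S ≤ 2^k λ, which is what makes the multilevel truncation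
  -- close to u on the ball.
  by_cases hall : ∀ y ∈ B, 2 ^ k * lam < S y
  · have hpl : (lam : ℝ≥0∞) ^ p = (lam : ℝ≥0∞) ^ (p - 1) * lam := by
      conv_rhs => rw [← ENNReal.rpow_one (lam : ℝ≥0∞), ← ENNReal.rpow_mul]
      rw [one_mul, ← ENNReal.rpow_add _ _ hlam0 ENNReal.coe_ne_top, sub_add_cancel]
    rw [← setLIntegral_const]
    refine setLIntegral_mono' hBm fun y hy => ?_
    refine le_trans ?_ le_add_self
    rw [if_pos (hall y hy), hpl]
    have h1 : (lam : ℝ≥0∞) ≤ S y := by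
      refine le_trans ?_ (hall y hy).le
      exact le_mul_of_one_le_left bot_le (one_le_pow₀ one_le_two)
    calc (lam : ℝ≥0∞) ^ (p - 1) * lam ≤ 1 * ((lam : ℝ≥0∞) ^ (p - 1) * S y) := by
          rw [one_mul]; gcongr
      _ ≤ _ := by
          gcongr
          calc (1 : ℝ≥0∞) ≤ 480 * 1 ^ 2 := by norm_num
            _ ≤ _ := by gcongr
  · push Not at hall
    obtain ⟨h, hh, hclose, hslope⟩ := hm.exists_multilevel_truncation hu
      (e := (12 * CP)⁻¹) hlam hk
    have hA := hm.mul_measure_ball_le_of_close hp hP hu hh (c := 60 * D ^ 2) hlam hb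
      (T := {x | 2 ^ k * lam < S x}.indicator S)
      (by push_cast; exact hclose b.1 b.2 hb.1 hall)
    set e : ℝ≥0 := (12 * CP)⁻¹ with he
    set I1 : X → ℝ≥0∞ := fun x => if e * lam < slopeAt u x ∧
      slopeAt u x ≤ 24 * D ^ 2 * (2 ^ (2 * k) * lam) then slopeAt u x ^ p else 0 with hI1
    set I2 : X → ℝ≥0∞ := fun x => ∑ i ∈ Finset.Ico k (2 * k),
      (if 2 ^ i * lam < S x then ((2 : ℝ≥0∞) ^ i * lam) ^ p else 0) with hI2
    have hI1m : Measurable I1 := Measurable.ite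
      ((measurableSet_lt measurable_const hg).inter (measurableSet_le hg measurable_const))
      (hg.pow_const p) measurable_const
    have hI2m : Measurable I2 := Finset.measurable_fun_sum _ fun i _ =>
      Measurable.ite (measurableSet_lt measurable_const hSm) measurable_const measurable_const
    have hint : ∫⁻ y in B, slopeAt h y ^ p ∂m ≤ 3 ^ p * ((e * lam) ^ p * m B
        + ∫⁻ y in B, I1 y ∂m + (48 * D ^ 2 * (k : ℝ≥0∞)⁻¹) ^ p * ∫⁻ y in B, I2 y ∂m) := by
      have hpt : ∀ᵐ x ∂m, slopeAt h x ^ p ≤ 3 ^ p * ((e * lam) ^ p + I1 x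
          + (48 * D ^ 2 * (k : ℝ≥0∞)⁻¹) ^ p * I2 x) := by
        filter_upwards [hslope] with x hx
        refine (ENNReal.rpow_le_rpow hx hp0.le).trans
          ((ENNReal.rpow_add_three_le hp0 _ _ _).trans ?_)
        refine mul_le_mul_right (add_le_add (add_le_add le_rfl ?_) ?_) _
        · simp only [hI1, Set.indicator_apply, Set.mem_ofPred_eq]
          split_ifs
          · exact le_rfl
          · simp [hp0]
        · rw [ENNReal.mul_rpow_of_nonneg _ _ hp0.le]
          refine (mul_le_mul_right (rpow_sum_two_pow_le hp0 _ _) _).trans_eq ?_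
          simp only [hI2]
          rw [← Finset.sum_filter, ← mul_assoc, ← ENNReal.mul_rpow_of_nonneg _ _ hp0.le]
          congr 2
          ring
      refine (lintegral_mono_ae (ae_restrict_of_ae hpt)).trans_eq ?_
      rw [lintegral_const_mul' _ _ (by finiteness), lintegral_add_right _ (hI2m.const_mul _),
        lintegral_add_right _ hI1m,
        setLIntegral_const, lintegral_const_mul _ hI2m]
    set T : X → ℝ≥0∞ := {x | 2 ^ k * lam < S x}.indicator S
    have hT : ∀ x, T x = if 2 ^ k * lam < S x then S x else 0 := fun x => by
      simp only [T, Set.indicator_apply, Set.mem_ofPred_eq]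
    have hTm : Measurable T := hSm.indicator (measurableSet_lt measurable_const hSm)
    -- The choice e = 1/(12 CP) gives 2 CP · 3 · eλ = λ/2. Hence the part of the slope below eλ
    -- contributes at most half of the left side and is absorbed.
    have hhalf : (2 * (CP : ℝ≥0∞)) ^ p * (3 ^ p * (e * lam) ^ p) ≤ 2⁻¹ * (lam : ℝ≥0∞) ^ p := by
      rw [← ENNReal.mul_rpow_of_nonneg _ _ hp0.le, ← ENNReal.mul_rpow_of_nonneg _ _ hp0.le]
      have : (2 * (CP : ℝ≥0∞)) * (3 * (e * lam)) = 2⁻¹ * lam := by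
        have h1 : (2 * CP) * (3 * (e * lam)) = 2⁻¹ * lam := by
          rw [he]; field_simp; norm_num
        have h2 := congrArg (fun t : ℝ≥0 => (t : ℝ≥0∞)) h1
        push_cast at h2
        exact h2
      rw [this, ENNReal.mul_rpow_of_nonneg _ _ hp0.le]
      gcongr
      calc (2⁻¹ : ℝ≥0∞) ^ p ≤ 2⁻¹ ^ (1 : ℝ) :=
            ENNReal.rpow_le_rpow_of_exponent_ge (by norm_num) hp.le
        _ = 2⁻¹ := ENNReal.rpow_one _
    set R : ℝ≥0∞ := (6 * CP) ^ p * ∫⁻ y in B, I1 y ∂m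
      + (6 * CP) ^ p * (48 * D ^ 2 * (k : ℝ≥0∞)⁻¹) ^ p * ∫⁻ y in B, I2 y ∂m
      + 240 * D ^ 2 * (lam : ℝ≥0∞) ^ (p - 1) * ∫⁻ y in B, T y ∂m with hR
    have hmain : (lam : ℝ≥0∞) ^ p * m B ≤ 2⁻¹ * ((lam : ℝ≥0∞) ^ p * m B) + R := by
      have h6 : (6 * (CP : ℝ≥0∞)) ^ p = (2 * CP) ^ p * 3 ^ p := by
        rw [← ENNReal.mul_rpow_of_nonneg _ _ hp0.le]; congr 1; ring
      calc (lam : ℝ≥0∞) ^ p * m B ≤ _ := hA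
        _ ≤ (2 * CP) ^ p * (3 ^ p * ((e * lam) ^ p * m B
            + ∫⁻ y in B, I1 y ∂m + (48 * D ^ 2 * (k : ℝ≥0∞)⁻¹) ^ p * ∫⁻ y in B, I2 y ∂m))
            + 4 * (60 * D ^ 2 : ℝ≥0) * (lam : ℝ≥0∞) ^ (p - 1) * ∫⁻ y in B, T y ∂m :=
            add_le_add (mul_le_mul_right hint _) le_rfl
        _ = (2 * CP) ^ p * (3 ^ p * (e * lam) ^ p) * m B + R := by
            rw [hR, h6]; push_cast; ring
        _ ≤ 2⁻¹ * (lam : ℝ≥0∞) ^ p * m B + R := by gcongr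
        _ = _ := by rw [mul_assoc]
    have hfin : (lam : ℝ≥0∞) ^ p * m B ≠ ∞ :=
      ENNReal.mul_ne_top (ENNReal.rpow_ne_top_of_nonneg hp0.le ENNReal.coe_ne_top) hBt
    have hle : (lam : ℝ≥0∞) ^ p * m B ≤ 2 * R := by
      set a := (lam : ℝ≥0∞) ^ p * m B
      have h1 : 2⁻¹ * a ≤ R := by
        have h2 : 2⁻¹ * a + 2⁻¹ * a ≤ 2⁻¹ * a + R := by
          rw [← add_mul, ENNReal.inv_two_add_inv_two, one_mul]; exact hmain
        exact (ENNReal.add_le_add_iff_left (by finiteness)).1 h2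
      calc a = 2 * (2⁻¹ * a) := by
            rw [← mul_assoc, ENNReal.mul_inv_cancel two_ne_zero ENNReal.ofNat_ne_top, one_mul]
        _ ≤ 2 * R := by gcongr
    refine hle.trans_eq ?_
    simp only [levelDensity]
    simp_rw [← hT]
    rw [lintegral_add_right _ ((hTm.const_mul _).const_mul _),
      lintegral_add_right _ (hI2m.const_mul _), lintegral_const_mul _ hI1m,
      lintegral_const_mul _ hI2m, lintegral_const_mul _ (hTm.const_mul _),
      lintegral_const_mul _ hTm, hR]
    ring

/-- The estimate on single balls is globalised by the covering argument, applied to the measure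
whose density is the level density. -/
theorem mul_measure_setOf_lt_sharpMax_le (hm : DoublingWith m D) {p : ℝ} (hp : 1 < p) {CP : ℝ≥0}
    (hCP : 0 < CP) (hP : PoincareWith p m CP) {u : X → ℝ} (hu : IsLipBS u) {lam : ℝ≥0}
    (hlam : 0 < lam) {k : ℕ} (hk : 0 < k) :
    (lam : ℝ≥0∞) ^ p * m {x | lam < sharpMax m u x} ≤ D ^ 3 *
      ∫⁻ x, levelDensity p D CP (12 * CP)⁻¹ k lam (slopeAt u x) (sharpMax m u x) ∂m := by
  obtain ⟨L, hL⟩ := hu.1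
  obtain ⟨M, hM⟩ := hu.exists_bound
  have := hm.mul_measure_iUnion_le (m.withDensity fun x =>
      levelDensity p D CP (12 * CP)⁻¹ k lam (slopeAt u x) (sharpMax m u x)) ((lam : ℝ≥0∞) ^ p)
    (oscillatingBalls m u lam) (2 * M / lam)
    (fun b hb => ⟨hb.1, hm.radius_le_of_mem_oscillatingBalls hL hM hlam hb⟩)
    (fun b hb => by
      rw [withDensity_apply _ measurableSet_ball]
      exact hm.mul_measure_ball_le_levelDensity hp hCP hP hu hlam hk hb)
  rwa [← setOf_lt_sharpMax, withDensity_apply _ MeasurableSet.univ, Measure.restrict_univ] at this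

/-- Weak-type bound for the sharp maximal function of a Lipschitz function of bounded support. -/
theorem exists_weak_bound_sharpMax (hm : DoublingWith m D) {u : X → ℝ} (hu : IsLipBS u) :
    ∃ K : ℝ≥0∞, K ≠ ∞ ∧ ∀ lam : ℝ≥0, 0 < lam → lam * m {x | lam < sharpMax m u x} ≤ K := by
  obtain ⟨M, hM⟩ := hu.exists_bound
  obtain ⟨⟨L, hL⟩, hb⟩ := hu
  set V := Metric.thickening 2 (Function.support u) with hV
  have hVm : MeasurableSet V := Metric.isOpen_thickening.measurableSet
  have hVt : m V < ∞ := hm.measure_lt_top_of_isBounded hb.thickening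
  -- The first summand serves balls of radius at least 1, where λ ≤ λ r is below twice the mean of
  -- |u|. The second serves balls of radius below 1: they meet the support, hence lie in its
  -- 2-neighbourhood, and λ < S ≤ 2L at the centre.
  set φ : X → ℝ≥0∞ := fun x => 2 * ‖u x‖ₑ + V.indicator (fun _ => 2 * (L : ℝ≥0∞)) x with hφ
  have humeas : Measurable fun x => ‖u x‖ₑ := hL.continuous.measurable.enorm
  refine ⟨D ^ 3 * ∫⁻ x, φ x ∂m, ?_, fun lam hlam => ?_⟩
  · have h1 : ∫⁻ x, φ x ∂m ≤ ∫⁻ x, V.indicator (fun _ => 2 * (M : ℝ≥0∞) + 2 * L) x ∂m := by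
      refine lintegral_mono fun x => ?_
      by_cases hx : x ∈ V
      · simp only [hφ, Set.indicator_of_mem hx]
        gcongr
        exact hM x
      · have : u x = 0 := by
          by_contra h
          exact hx (Metric.self_subset_thickening two_pos _ h)
        simp [hφ, Set.indicator_of_notMem hx, this]
    rw [lintegral_indicator hVm, setLIntegral_const] at h1
    exact ENNReal.mul_ne_top (by finiteness) (h1.trans_lt (by finiteness)).ne
  · have := hm.mul_measure_iUnion_le (m.withDensity φ) lam
      (oscillatingBalls m u lam) (2 * M / lam)
      (fun b hb => ⟨hb.1, hm.radius_le_of_mem_oscillatingBalls hL hM hlam hb⟩)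
      (fun b hb => by
        rw [withDensity_apply _ measurableSet_ball]
        have hr := hb.1
        have hosc := hb.2
        have hB0 := (hm.pos b.1 b.2 hr).ne'
        have hBt := (hm.fin b.1 b.2).ne
        rcases le_or_gt 1 b.2 with h1 | h1
        · have h2 : (lam : ℝ≥0∞) ≤ 2 * ((∫⁻ y in Metric.ball b.1 b.2, ‖u y‖ₑ ∂m)
              / m (Metric.ball b.1 b.2)) := by
            rw [← setLAverage_eq]
            refine le_trans ?_ (hosc.le.trans (hm.ballOsc_le_two_mul_average hL b.1 hr))
            exact le_mul_of_one_le_right bot_le (ENNReal.one_le_ofReal.2 h1)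
          calc lam * m (Metric.ball b.1 b.2)
              ≤ 2 * ((∫⁻ y in Metric.ball b.1 b.2, ‖u y‖ₑ ∂m)
              / m (Metric.ball b.1 b.2)) * m (Metric.ball b.1 b.2) := by gcongr
            _ = ∫⁻ y in Metric.ball b.1 b.2, 2 * ‖u y‖ₑ ∂m := by
                rw [mul_assoc, ENNReal.div_mul_cancel hB0 hBt, lintegral_const_mul _ humeas]
            _ ≤ _ := lintegral_mono fun x => le_self_add
        · have hlamL : (lam : ℝ≥0∞) ≤ 2 * L := by
            have hmem : b.1 ∈ {x | lam < sharpMax m u x} := by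
              rw [setOf_lt_sharpMax]
              exact Set.mem_biUnion hb (Metric.mem_ball_self hr)
            exact (show (lam : ℝ≥0∞) < sharpMax m u b.1 from hmem).le.trans
              (hm.sharpMax_le hL b.1)
          obtain ⟨y, hy, hy0⟩ := exists_mem_support_of_mem_oscillatingBalls hb
          rw [← setLIntegral_const]
          refine setLIntegral_mono' measurableSet_ball fun x hx => ?_
          have hxV : x ∈ V := by
            rw [hV, Metric.mem_thickening_iff]
            refine ⟨y, hy0, ?_⟩
            rw [Metric.mem_ball] at hx hy
            linarith [dist_triangle_right x y b.1]
          simp only [hφ, Set.indicator_of_mem hxV]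
          exact hlamL.trans le_add_self)
    rwa [← setOf_lt_sharpMax, withDensity_apply _ MeasurableSet.univ,
      Measure.restrict_univ] at this

/-- The a priori finiteness that permits absorption. Levels from 2L upwards have empty superlevel
sets; below, the weak-type bound leaves λ^(p-1), summable over dyadic λ because p > 1. -/
theorem lintegral_dyadicPow_sharpMax_ne_top (hm : DoublingWith m D) {p : ℝ} (hp : 1 < p)
    {u : X → ℝ} (hu : IsLipBS u) : ∫⁻ x, dyadicPow p (sharpMax m u x) ∂m ≠ ∞ := by
  obtain ⟨K, hK, hweak⟩ := hm.exists_weak_bound_sharpMax hu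
  obtain ⟨L, hL⟩ := hu.1
  have hp1 : 0 < p - 1 := sub_pos.2 hp
  have hS := hm.sharpMax_le hL
  rw [lintegral_dyadicPow_sharpMax]
  have hterm : ∀ n : ℤ, ((2 : ℝ≥0∞) ^ n) ^ p * m {x | (2 : ℝ≥0∞) ^ n < sharpMax m u x} ≤
      (if (2 : ℝ≥0∞) ^ n < 2 * L then ((2 : ℝ≥0∞) ^ n) ^ (p - 1) else 0) * K := by
    intro n
    have h20 : (2 : ℝ≥0∞) ^ n ≠ 0 := (ENNReal.zpow_pos two_ne_zero ENNReal.ofNat_ne_top n).ne'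
    have h2t : (2 : ℝ≥0∞) ^ n ≠ ∞ := ENNReal.zpow_ne_top two_ne_zero ENNReal.ofNat_ne_top n
    split_ifs with h
    · have hcoe : (((2 : ℝ≥0) ^ n : ℝ≥0) : ℝ≥0∞) = (2 : ℝ≥0∞) ^ n := by
        rw [ENNReal.coe_zpow two_ne_zero]; rfl
      have hw := hweak ((2 : ℝ≥0) ^ n) (by positivity)
      rw [hcoe] at hw
      calc ((2 : ℝ≥0∞) ^ n) ^ p * m {x | (2 : ℝ≥0∞) ^ n < sharpMax m u x}
          = ((2 : ℝ≥0∞) ^ n) ^ (p - 1) *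
            ((2 : ℝ≥0∞) ^ n * m {x | (2 : ℝ≥0∞) ^ n < sharpMax m u x}) := by
            rw [← mul_assoc]
            congr 1
            nth_rw 3 [← ENNReal.rpow_one ((2 : ℝ≥0∞) ^ n)]
            rw [← ENNReal.rpow_add _ _ h20 h2t, sub_add_cancel]
        _ ≤ _ := by gcongr
    · have : {x | (2 : ℝ≥0∞) ^ n < sharpMax m u x} = ∅ :=
        Set.eq_empty_of_forall_notMem fun x hx => h (lt_of_lt_of_le hx (hS x))
      rw [this]
      simp
  refine ((ENNReal.tsum_le_tsum hterm).trans_lt ?_).ne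
  rw [ENNReal.tsum_mul_right]
  refine ENNReal.mul_lt_top (lt_of_le_of_lt (tsum_zpow_rpow_lt_le hp1 _) ?_) hK.lt_top
  have := geomConst_ne_top hp1
  exact ENNReal.mul_lt_top this.lt_top (by
    refine (ENNReal.rpow_lt_top_of_nonneg hp1.le (by finiteness)))

/-- The sharp maximal function theorem: under a `(1,p)`-Poincaré inequality, the sharp maximal
function of a Lipschitz function of bounded support is bounded in `L^p` by the slope. -/
theorem exists_lintegral_sharpMax_le (hm : DoublingWith m D) {p : ℝ} (hp : 1 < p) {CP : ℝ≥0}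
    (hCP : 0 < CP) (hP : PoincareWith p m CP) :
    ∃ C : ℝ≥0∞, C ≠ ∞ ∧ ∀ u : X → ℝ, IsLipBS u →
      ∫⁻ x, sharpMax m u x ^ p ∂m ≤ C * ∫⁻ x, slopeAt u x ^ p ∂m := by
  have hp0 : 0 < p := one_pos.trans hp
  have htend := ENNReal.Tendsto.const_mul (a := (D : ℝ≥0∞) ^ 3) (tendsto_absorbCoeff hp D CP)
    (Or.inr (by finiteness))
  rw [mul_zero] at htend
  -- The number k of truncation levels is fixed so that the absorbed term, covering constant
  -- included, has coefficient at most 1/2. The window length N is chosen afterwards.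
  obtain ⟨k, hkθ, hk⟩ := ((htend.eventually_le_const (by norm_num : (0 : ℝ≥0∞) < 2⁻¹)).and
    (eventually_gt_atTop 0)).exists
  set e : ℝ≥0 := (12 * CP)⁻¹ with he
  have he0 : 0 < e := by positivity
  obtain ⟨N, hN⟩ : ∃ N : ℕ, 24 * D ^ 2 * 2 ^ (2 * k) ≤ e * 2 ^ N := by
    obtain ⟨N, hN⟩ := pow_unbounded_of_one_lt (24 * D ^ 2 * 2 ^ (2 * k) / e) (one_lt_two (α := ℝ≥0))
    exact ⟨N, by rw [mul_comm e]; exact ((div_lt_iff₀ he0).1 hN).le⟩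
  set A : ℝ≥0∞ := D ^ 3 * (2 * (6 * CP) ^ p * N)
  have hAt : A ≠ ∞ := by simp only [A]; finiteness
  refine ⟨2 ^ p * (2 * A), by finiteness, fun u hu => ?_⟩
  obtain ⟨L, hL⟩ := hu.1
  have hg : Measurable (slopeAt u) := measurable_slopeAt hL.continuous
  have hSm : Measurable (sharpMax m u) := measurable_sharpMax u
  have hSt : ∀ x, sharpMax m u x ≠ ∞ := fun x => ((hm.sharpMax_le hL x).trans_lt (by finiteness)).ne
  have hdm : Measurable fun x => dyadicPow p (sharpMax m u x) := (measurable_dyadicPow p).comp hSm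
  set Q := ∫⁻ x, dyadicPow p (sharpMax m u x) ∂m with hQ
  set E := ∫⁻ x, slopeAt u x ^ p ∂m with hE
  have hQt : Q ≠ ∞ := hm.lintegral_dyadicPow_sharpMax_ne_top hp hu
  have hQle : Q ≤ A * E + 2⁻¹ * Q := by
    calc Q = ∑' n : ℤ, ((2 : ℝ≥0∞) ^ n) ^ p * m {x | (2 : ℝ≥0∞) ^ n < sharpMax m u x} :=
          lintegral_dyadicPow_sharpMax p u
      _ ≤ ∑' n : ℤ, D ^ 3 * ∫⁻ x, levelDensity p D CP e k ((2 : ℝ≥0∞) ^ n) (slopeAt u x)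
            (sharpMax m u x) ∂m := by
          refine ENNReal.tsum_le_tsum fun n => ?_
          have hcoe : (((2 : ℝ≥0) ^ n : ℝ≥0) : ℝ≥0∞) = (2 : ℝ≥0∞) ^ n := by
            rw [ENNReal.coe_zpow two_ne_zero]; rfl
          have := hm.mul_measure_setOf_lt_sharpMax_le hp hCP hP hu (lam := (2 : ℝ≥0) ^ n)
            (by positivity) hk
          rwa [hcoe] at this
      _ = D ^ 3 * ∫⁻ x, ∑' n : ℤ, levelDensity p D CP e k ((2 : ℝ≥0∞) ^ n) (slopeAt u x)
            (sharpMax m u x) ∂m := by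
          rw [ENNReal.tsum_mul_left, lintegral_tsum fun n =>
            (measurable_levelDensity p D CP e k _ hg hSm).aemeasurable]
      _ ≤ D ^ 3 * ∫⁻ x, (2 * (6 * CP) ^ p * N * slopeAt u x ^ p
            + absorbCoeff p D CP k * dyadicPow p (sharpMax m u x)) ∂m := by
          gcongr with x
          exact tsum_levelDensity_le hp D CP he0 hk hN _ (hSt x)
      _ = A * E + D ^ 3 * absorbCoeff p D CP k * Q := by
          rw [lintegral_add_left ((hg.pow_const p).const_mul _),
            lintegral_const_mul _ (hg.pow_const p),
            lintegral_const_mul _ hdm]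
          simp only [A]; ring
      _ ≤ _ := by gcongr
  -- Subtracting Q/2 from both sides is legitimate because Q is finite.
  have hQ2 : Q ≤ 2 * (A * E) := by
    have h1 : 2⁻¹ * Q ≤ A * E := by
      have h2 : 2⁻¹ * Q + 2⁻¹ * Q ≤ A * E + 2⁻¹ * Q := by
        rw [← add_mul, ENNReal.inv_two_add_inv_two, one_mul]; exact hQle
      exact (ENNReal.add_le_add_iff_right (by finiteness)).1 h2
    calc Q = 2 * (2⁻¹ * Q) := by
          rw [← mul_assoc, ENNReal.mul_inv_cancel two_ne_zero ENNReal.ofNat_ne_top, one_mul]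
      _ ≤ _ := by gcongr
  calc ∫⁻ x, sharpMax m u x ^ p ∂m ≤ ∫⁻ x, 2 ^ p * dyadicPow p (sharpMax m u x) ∂m :=
        lintegral_mono fun x => rpow_le_tsum_zpow_rpow_lt hp0 (hSt x)
    _ = 2 ^ p * Q := lintegral_const_mul _ hdm
    _ ≤ 2 ^ p * (2 * (A * E)) := by gcongr
    _ = _ := by ring

end DoublingWith

end Absorption

/-! ### Uniformity in δ of the dyadic constants. -/

section Constants

/-- Bernoulli's inequality gives 2^(-δ) ≤ 1 - δ/2. The factor δ in the functional thus offsets the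
divergence of the geometric series as δ tends to 0. -/
theorem ofReal_mul_geomConst_le {δ : ℝ} (h0 : 0 < δ) (h1 : δ ≤ 1) :
    ENNReal.ofReal δ * geomConst δ ≤ 2 := by
  have hb : ((1 : ℝ) / 2) ^ δ ≤ 1 - δ / 2 := by
    have := rpow_one_add_le_one_add_mul_self (s := -(1 / 2)) (by norm_num) h0.le h1
    have h2 : (1 : ℝ) + -(1 / 2) = 1 / 2 := by norm_num
    rw [h2] at this
    linarith
  have h2 : ((2 : ℝ≥0∞) ^ δ)⁻¹ = ENNReal.ofReal ((1 / 2) ^ δ) := by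
    rw [← ENNReal.ofReal_rpow_of_pos (by norm_num), ← ENNReal.inv_rpow]
    congr 1
    rw [one_div, ENNReal.ofReal_inv_of_pos two_pos, ENNReal.ofReal_ofNat]
  have h3 : ENNReal.ofReal (δ / 2) ≤ 1 - ((2 : ℝ≥0∞) ^ δ)⁻¹ := by
    rw [h2, ← ENNReal.ofReal_one, ← ENNReal.ofReal_sub _ (by positivity)]
    exact ENNReal.ofReal_le_ofReal (by linarith)
  have hδ : ENNReal.ofReal (δ / 2) ≠ 0 := by simpa using h0
  calc ENNReal.ofReal δ * geomConst δ ≤ ENNReal.ofReal δ * (ENNReal.ofReal (δ / 2))⁻¹ := by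
        unfold geomConst
        gcongr
    _ = 2 * (ENNReal.ofReal (δ / 2) * (ENNReal.ofReal (δ / 2))⁻¹) := by
        rw [← mul_assoc, ← ENNReal.ofReal_ofNat 2, ← ENNReal.ofReal_mul zero_le_two]
        congr 2
        ring
    _ = 2 := by rw [ENNReal.mul_inv_cancel hδ ENNReal.ofReal_ne_top, mul_one]

/-- The sum over dyadic scales that bounds the nonlocal energy of a linear profile. -/
theorem ofReal_mul_tsum_profile_le {p δ : ℝ} (hp : 1 < p) (h0 : 0 < δ) (h1 : δ ≤ 1) :
    ENNReal.ofReal δ * ∑' n : ℤ, min ((2 : ℝ≥0∞) ^ (n + 1)) 1 ^ (p + δ) / ((2 : ℝ≥0∞) ^ n) ^ p ≤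
      2 ^ (p + 1) * 4 + geomConst p * 2 ^ p := by
  have hp0 : 0 < p := one_pos.trans hp
  have h2n : ∀ n : ℤ, (2 : ℝ≥0∞) ^ n ≠ 0 := fun n => (ENNReal.zpow_pos two_ne_zero
    ENNReal.ofNat_ne_top n).ne'
  have h2t : ∀ n : ℤ, (2 : ℝ≥0∞) ^ n ≠ ∞ := fun n => ENNReal.zpow_ne_top two_ne_zero
    ENNReal.ofNat_ne_top n
  have hterm : ∀ n : ℤ, min ((2 : ℝ≥0∞) ^ (n + 1)) 1 ^ (p + δ) / ((2 : ℝ≥0∞) ^ n) ^ p ≤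
      2 ^ (p + 1) * (if (2 : ℝ≥0∞) ^ n < 2 then ((2 : ℝ≥0∞) ^ n) ^ δ else 0) +
      (if (2 : ℝ≥0∞) ^ (-n) < 2 then ((2 : ℝ≥0∞) ^ (-n)) ^ p else 0) := by
    intro n
    have hnp0 : ((2 : ℝ≥0∞) ^ n) ^ p ≠ 0 := by
      simp only [ne_eq, ENNReal.rpow_eq_zero_iff, not_or, not_and]
      exact ⟨fun h => absurd h (h2n n), fun h => absurd h (h2t n)⟩
    have hnpt : ((2 : ℝ≥0∞) ^ n) ^ p ≠ ∞ := ENNReal.rpow_ne_top_of_nonneg hp0.le (h2t n)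
    -- At small scales (n < 0) the profile 2^(n+1) leaves a term of order 2^(nδ), the series that
    -- needs the factor δ. At large scales the truncation at 1 leaves 2^(-np), summable without
    -- help.
    rcases lt_or_ge n 0 with hn | hn
    · refine le_trans ?_ le_self_add
      have hlt : (2 : ℝ≥0∞) ^ n < 2 := by
        calc (2 : ℝ≥0∞) ^ n ≤ 2 ^ (0 : ℤ) := ENNReal.zpow_le_of_le ENNReal.one_lt_two.le hn.le
          _ < 2 := by simp
      rw [if_pos hlt]
      rw [ENNReal.div_le_iff hnp0 hnpt]
      calc min ((2 : ℝ≥0∞) ^ (n + 1)) 1 ^ (p + δ) ≤ ((2 : ℝ≥0∞) ^ (n + 1)) ^ (p + δ) := by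
            gcongr; exact min_le_left _ _
        _ = 2 ^ (p + δ) * ((2 : ℝ≥0∞) ^ n) ^ (p + δ) := by
            rw [ENNReal.zpow_add two_ne_zero ENNReal.ofNat_ne_top, zpow_one, mul_comm,
              ENNReal.mul_rpow_of_nonneg _ _ (by positivity)]
        _ ≤ 2 ^ (p + 1) * ((2 : ℝ≥0∞) ^ n) ^ (p + δ) := by
            gcongr; exact ENNReal.one_lt_two.le
        _ = _ := by
            rw [ENNReal.rpow_add _ _ (h2n n) (h2t n)]; ring
    · refine le_trans ?_ le_add_self
      have hlt : (2 : ℝ≥0∞) ^ (-n) < 2 := by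
        calc (2 : ℝ≥0∞) ^ (-n) ≤ 2 ^ (0 : ℤ) :=
              ENNReal.zpow_le_of_le ENNReal.one_lt_two.le (by omega)
          _ < 2 := by simp
      rw [if_pos hlt, ENNReal.zpow_neg, ENNReal.inv_rpow,
        ← one_div]
      gcongr
      calc min ((2 : ℝ≥0∞) ^ (n + 1)) 1 ^ (p + δ) ≤ 1 ^ (p + δ) := by
            gcongr; exact min_le_right _ _
        _ = 1 := ENNReal.one_rpow _
  have hneg : ∑' n : ℤ, (if (2 : ℝ≥0∞) ^ (-n) < 2 then ((2 : ℝ≥0∞) ^ (-n)) ^ p else 0) =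
      ∑' n : ℤ, (if (2 : ℝ≥0∞) ^ n < 2 then ((2 : ℝ≥0∞) ^ n) ^ p else 0) :=
    (Equiv.neg ℤ).tsum_eq fun n : ℤ => if (2 : ℝ≥0∞) ^ n < 2 then ((2 : ℝ≥0∞) ^ n) ^ p else 0
  have h2δ : (2 : ℝ≥0∞) ^ δ ≤ 2 := by
    calc (2 : ℝ≥0∞) ^ δ ≤ 2 ^ (1 : ℝ) :=
          ENNReal.rpow_le_rpow_of_exponent_le ENNReal.one_lt_two.le h1
      _ = 2 := ENNReal.rpow_one _
  calc _ ≤ ENNReal.ofReal δ * ∑' n : ℤ, (2 ^ (p + 1) *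
        (if (2 : ℝ≥0∞) ^ n < 2 then ((2 : ℝ≥0∞) ^ n) ^ δ else 0) +
        (if (2 : ℝ≥0∞) ^ (-n) < 2 then ((2 : ℝ≥0∞) ^ (-n)) ^ p else 0)) := by
        gcongr with n
        exact hterm n
    _ ≤ ENNReal.ofReal δ * (2 ^ (p + 1) * (geomConst δ * 2 ^ δ) + geomConst p * 2 ^ p) := by
        rw [ENNReal.tsum_add, ENNReal.tsum_mul_left, hneg]
        gcongr
        · exact tsum_zpow_rpow_lt_le h0 _
        · exact tsum_zpow_rpow_lt_le hp0 _
    _ = 2 ^ (p + 1) * (ENNReal.ofReal δ * geomConst δ * 2 ^ δ) +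
        ENNReal.ofReal δ * (geomConst p * 2 ^ p) := by ring
    _ ≤ 2 ^ (p + 1) * (2 * 2) + 1 * (geomConst p * 2 ^ p) := by
        gcongr
        · exact ofReal_mul_geomConst_le h0 h1
        · exact ENNReal.ofReal_le_one.2 h1
    _ = _ := by rw [one_mul]; norm_num

end Constants

/-! ### Nonlocal energy bounded by the sharp maximal function. -/

section NonlocalEnergy

variable {X : Type*} [MetricSpace X] [MeasurableSpace X] {m : Measure X} {D : ℝ≥0}

/-- The nonlocal kernel weight `m(B_{d(x,y)}(x)) d(x,y)^p`. -/
noncomputable def pairWeight (p : ℝ) (m : Measure X) (x y : X) : ℝ≥0∞ :=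
  m (Metric.ball x (dist x y)) * edist x y ^ p

/-- The nonlocal energy with the differences truncated at one. -/
noncomputable def truncEnergy (p : ℝ) (m : Measure X) (δ : ℝ) (u : X → ℝ) : ℝ≥0∞ :=
  ∫⁻ x, ∫⁻ y, ENNReal.ofReal δ * min (edist (u x) (u y)) 1 ^ (p + δ) / pairWeight p m x y ∂m ∂m

namespace DoublingWith

/-- With d = d(x,y), the ball of radius d about y lies in the ball of radius 2d about x. The weight
is thus symmetric up to D, and the roles of x and y can be exchanged. -/
theorem pairWeight_comm_le (hm : DoublingWith m D) (p : ℝ) (x y : X) :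
    pairWeight p m y x ≤ D * pairWeight p m x y := by
  unfold pairWeight
  rw [edist_comm y x, dist_comm y x, ← mul_assoc]
  gcongr
  rcases eq_or_ne x y with rfl | hxy
  · simp
  · refine (measure_mono ?_).trans (hm.dbl x _ (dist_pos.2 hxy))
    exact Metric.ball_subset_ball' (by rw [dist_comm y x]; linarith)

theorem div_pairWeight_le (hm : DoublingWith m D) (p : ℝ) (x y : X) (a : ℝ≥0∞) :
    a / pairWeight p m x y ≤ D * (a / pairWeight p m y x) := by
  have : Nonempty X := ⟨x⟩
  have hD0 : (D : ℝ≥0∞) ≠ 0 := by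
    exact_mod_cast (zero_lt_one.trans_le hm.one_le).ne'
  have h := hm.pairWeight_comm_le p x y
  calc a / pairWeight p m x y = D * (a / (D * pairWeight p m x y)) := by
        rw [div_eq_mul_inv a (D * _), ENNReal.mul_inv (Or.inl hD0) (Or.inl ENNReal.coe_ne_top)]
        calc a / pairWeight p m x y = (D * (D : ℝ≥0∞)⁻¹) * (a * (pairWeight p m x y)⁻¹) := by
              rw [ENNReal.mul_inv_cancel hD0 ENNReal.coe_ne_top, one_mul, div_eq_mul_inv]
          _ = _ := by ring
    _ ≤ D * (a / pairWeight p m y x) := by gcongr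

theorem sigmaFinite [TopologicalSpace.SeparableSpace X] (hm : DoublingWith m D) :
    SigmaFinite m := by
  have := hm.isLocallyFiniteMeasure
  have := UniformSpace.secondCountable_of_separable X
  infer_instance

variable [BorelSpace X]

/-- On the annulus 2^n < t d(x,y) ≤ 2^(n+1) the weight is at least m(B) ρ^p, where B is the ball
about x of radius ρ = 2^n/t. The annulus has measure at most D² m(B), so m(B) cancels and only the
numerical sum over n remains. -/
theorem lintegral_profile_le (hm : DoublingWith m D) {p δ : ℝ} (hp : 1 < p) (h0 : 0 < δ)
    (h1 : δ ≤ 1) (x : X) {t : ℝ≥0∞} (ht : t ≠ ∞) :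
    ∫⁻ y, ENNReal.ofReal δ * min (t * edist x y) 1 ^ (p + δ) / pairWeight p m x y ∂m ≤
      D ^ 2 * (2 ^ (p + 1) * 4 + geomConst p * 2 ^ p) * t ^ p := by
  have hp0 : 0 < p := one_pos.trans hp
  have hpδ : 0 < p + δ := by positivity
  rcases eq_or_ne t 0 with rfl | ht0
  · simp [hpδ]
  have h2n : ∀ n : ℤ, (2 : ℝ≥0∞) ^ n ≠ 0 := fun n => (ENNReal.zpow_pos two_ne_zero
    ENNReal.ofNat_ne_top n).ne'
  have h2t : ∀ n : ℤ, (2 : ℝ≥0∞) ^ n ≠ ∞ := fun n => ENNReal.zpow_ne_top two_ne_zero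
    ENNReal.ofNat_ne_top n
  set ρ : ℤ → ℝ≥0∞ := fun n => 2 ^ n / t with hρ
  have hρ0 : ∀ n, ρ n ≠ 0 := fun n => ENNReal.div_ne_zero.2 ⟨h2n n, ht⟩
  have hρt : ∀ n, ρ n ≠ ∞ := fun n => ENNReal.div_ne_top (h2t n) ht0
  have hρpos : ∀ n, 0 < (ρ n).toReal := fun n => ENNReal.toReal_pos (hρ0 n) (hρt n)
  set A : ℤ → Set X := fun n => {y | ρ n < edist x y ∧ t * edist x y ≤ 2 ^ (n + 1)} with hA
  have hAm : ∀ n, MeasurableSet (A n) := fun n =>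
    (measurableSet_lt measurable_const measurable_edist_right).inter
      (measurableSet_le (measurable_edist_right.const_mul t) measurable_const)
  set K : ℤ → ℝ≥0∞ := fun n => ENNReal.ofReal δ * min ((2 : ℝ≥0∞) ^ (n + 1)) 1 ^ (p + δ) /
    (m (Metric.ball x (ρ n).toReal) * ρ n ^ p) with hK
  have hpt : ∀ y, ENNReal.ofReal δ * min (t * edist x y) 1 ^ (p + δ) / pairWeight p m x y ≤
      ∑' n : ℤ, (A n).indicator (fun _ => K n) y := by
    intro y
    rcases eq_or_ne (edist x y) 0 with hxy | hxy
    · simp [hxy, hpδ]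
    obtain ⟨n, hn1, hn2⟩ := ENNReal.exists_mem_Ioc_zpow (mul_ne_zero ht0 hxy)
      (ENNReal.mul_ne_top ht (edist_ne_top x y)) ENNReal.one_lt_two ENNReal.ofNat_ne_top
    have hlt : ρ n < edist x y := by
      rw [hρ]
      exact (ENNReal.div_lt_iff (Or.inl ht0) (Or.inl ht)).2 (by rwa [mul_comm] at hn1)
    have hyA : y ∈ A n := ⟨hlt, hn2⟩
    refine le_trans ?_ (ENNReal.le_tsum n)
    rw [Set.indicator_of_mem hyA]
    simp only [hK, pairWeight]
    gcongr
    rw [dist_edist]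
    exact ENNReal.toReal_mono (edist_ne_top x y) hlt.le
  have hAle : ∀ n, m (A n) ≤ D ^ 2 * m (Metric.ball x (ρ n).toReal) := by
    intro n
    refine (measure_mono fun y hy => ?_).trans (hm.ball_four_le x (hρpos n))
    have h2 : edist x y ≤ 2 * ρ n := by
      have := hy.2
      rw [mul_comm, ← ENNReal.le_div_iff_mul_le (Or.inl ht0) (Or.inl ht)] at this
      refine this.trans_eq ?_
      rw [hρ, ENNReal.zpow_add two_ne_zero ENNReal.ofNat_ne_top, zpow_one, mul_comm, mul_div_assoc]
    have h3 := ENNReal.toReal_mono (ENNReal.mul_ne_top ENNReal.ofNat_ne_top (hρt n)) h2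
    rw [ENNReal.toReal_mul, ENNReal.toReal_ofNat, ← dist_edist] at h3
    rw [Metric.mem_ball, dist_comm]
    linarith [hρpos n]
  have hKA : ∀ n, K n * m (A n) ≤ D ^ 2 * t ^ p * (ENNReal.ofReal δ *
      (min ((2 : ℝ≥0∞) ^ (n + 1)) 1 ^ (p + δ) / ((2 : ℝ≥0∞) ^ n) ^ p)) := by
    intro n
    set b := m (Metric.ball x (ρ n).toReal) with hb
    have hb0 : b ≠ 0 := (hm.pos x _ (hρpos n)).ne'
    have hbt : b ≠ ∞ := (hm.fin x _).ne
    have hρp : (ρ n ^ p)⁻¹ = t ^ p * (((2 : ℝ≥0∞) ^ n) ^ p)⁻¹ := by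
      rw [hρ, ENNReal.div_rpow_of_nonneg _ _ hp0.le, ENNReal.inv_div, div_eq_mul_inv]
      · exact Or.inl (ENNReal.rpow_ne_top_of_nonneg hp0.le ht)
      · exact Or.inl (by simp [ENNReal.rpow_eq_zero_iff, ht0, ht])
    calc K n * m (A n) ≤ K n * (D ^ 2 * b) := by gcongr; exact hAle n
      _ = ENNReal.ofReal δ * min ((2 : ℝ≥0∞) ^ (n + 1)) 1 ^ (p + δ) * (b⁻¹ * b) * (ρ n ^ p)⁻¹
          * D ^ 2 := by
          simp only [hK]
          rw [div_eq_mul_inv, ENNReal.mul_inv (Or.inl hb0) (Or.inl hbt)]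
          ring
      _ = _ := by
          rw [ENNReal.inv_mul_cancel hb0 hbt, hρp, div_eq_mul_inv]
          ring
  calc _ ≤ ∫⁻ y, ∑' n : ℤ, (A n).indicator (fun _ => K n) y ∂m := lintegral_mono hpt
    _ = ∑' n : ℤ, K n * m (A n) := by
        rw [lintegral_tsum fun n => (measurable_const.indicator (hAm n)).aemeasurable]
        refine tsum_congr fun n => ?_
        rw [lintegral_indicator (hAm n), setLIntegral_const]
    _ ≤ ∑' n : ℤ, D ^ 2 * t ^ p * (ENNReal.ofReal δ *
      (min ((2 : ℝ≥0∞) ^ (n + 1)) 1 ^ (p + δ) / ((2 : ℝ≥0∞) ^ n) ^ p)) :=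
        ENNReal.tsum_le_tsum hKA
    _ = D ^ 2 * t ^ p * (ENNReal.ofReal δ * ∑' n : ℤ,
      min ((2 : ℝ≥0∞) ^ (n + 1)) 1 ^ (p + δ) / ((2 : ℝ≥0∞) ^ n) ^ p) := by
        rw [ENNReal.tsum_mul_left, ENNReal.tsum_mul_left]
    _ ≤ D ^ 2 * t ^ p * (2 ^ (p + 1) * 4 + geomConst p * 2 ^ p) := by
        gcongr
        exact ofReal_mul_tsum_profile_le hp h0 h1
    _ = _ := by ring

/-- The ball measure is the measure of a section of an open set of triples; σ-finiteness then gives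
joint measurability. -/
theorem measurable_pairWeight [TopologicalSpace.SeparableSpace X] (hm : DoublingWith m D) (p : ℝ) :
    Measurable fun q : X × X => pairWeight p m q.1 q.2 := by
  have := hm.sigmaFinite
  have := UniformSpace.secondCountable_of_separable X
  have hs : MeasurableSet {q : (X × X) × X | dist q.2 q.1.1 < dist q.1.1 q.1.2} :=
    (isOpen_lt (by fun_prop) (by fun_prop)).measurableSet
  have h1 := measurable_measure_prodMk_left (ν := m) hs
  exact h1.mul ((measurable_fst.edist measurable_snd).pow_const p)

theorem measurable_truncIntegrand [TopologicalSpace.SeparableSpace X] (hm : DoublingWith m D)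
    (p δ : ℝ) {u : X → ℝ} (hu : Measurable u) : Measurable fun q : X × X =>
      ENNReal.ofReal δ * min (edist (u q.1) (u q.2)) 1 ^ (p + δ) / pairWeight p m q.1 q.2 := by
  refine Measurable.div (Measurable.const_mul (Measurable.pow_const ?_ _) _)
    (hm.measurable_pairWeight p)
  exact ((hu.comp measurable_fst).edist (hu.comp measurable_snd)).min measurable_const

/-- The truncated nonlocal energy is controlled by the sharp maximal function. -/
theorem truncEnergy_le_sharpMax [TopologicalSpace.SeparableSpace X] (hm : DoublingWith m D)
    {p δ : ℝ} (hp : 1 < p) (h0 : 0 < δ) (h1 : δ ≤ 1) {u : X → ℝ} {L : ℝ≥0}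
    (hu : LipschitzWith L u) :
    truncEnergy p m δ u ≤ (1 + D) * (D ^ 2 * (2 ^ (p + 1) * 4 + geomConst p * 2 ^ p) *
      (24 * D ^ 2) ^ p) * ∫⁻ x, sharpMax m u x ^ p ∂m := by
  have hp0 : 0 < p := one_pos.trans hp
  have := hm.sigmaFinite
  have := UniformSpace.secondCountable_of_separable X
  set S := sharpMax m u
  have hSm : Measurable S := measurable_sharpMax u
  have hSt : ∀ x, S x ≠ ∞ := fun x => ((hm.sharpMax_le hu x).trans_lt (by finiteness)).ne
  set F : X → X → ℝ≥0∞ := fun x y =>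
    ENNReal.ofReal δ * min (24 * D ^ 2 * S x * edist x y) 1 ^ (p + δ) / pairWeight p m x y with hF
  have hFm : Measurable fun q : X × X => F q.1 q.2 := by
    refine Measurable.div (Measurable.const_mul (Measurable.pow_const ?_ _) _)
      (hm.measurable_pairWeight p)
    exact (((hSm.comp measurable_fst).const_mul _).mul
      (measurable_fst.edist measurable_snd)).min measurable_const
  have hFint : ∀ x, ∫⁻ y, F x y ∂m ≤ D ^ 2 * (2 ^ (p + 1) * 4 + geomConst p * 2 ^ p) *
      (24 * D ^ 2) ^ p * S x ^ p := by
    intro x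
    refine (hm.lintegral_profile_le hp h0 h1 x (by have := hSt x; finiteness)).trans_eq ?_
    rw [ENNReal.mul_rpow_of_nonneg _ _ hp0.le, mul_assoc]
    ring
  have hpt : ∀ x y, ENNReal.ofReal δ * min (edist (u x) (u y)) 1 ^ (p + δ) / pairWeight p m x y ≤
      F x y + D * F y x := by
    intro x y
    have hE := hm.edist_le_sharpMax hu x y
    -- Keeping the larger of S(x) and S(y) gives 12 (S(x) + S(y)) ≤ 24 max, so each pair is charged
    -- to one endpoint. When that endpoint is y, swapping the weight costs D.
    rcases le_total (S y) (S x) with h | h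
    · refine le_trans ?_ le_self_add
      simp only [hF]
      gcongr
      refine hE.trans ?_
      calc 12 * (D : ℝ≥0∞) ^ 2 * edist x y * (S x + S y)
          ≤ 12 * (D : ℝ≥0∞) ^ 2 * edist x y * (S x + S x) := by gcongr
        _ = _ := by ring
    · refine le_trans ?_ le_add_self
      refine (hm.div_pairWeight_le p x y _).trans ?_
      simp only [hF]
      gcongr
      refine hE.trans ?_
      calc 12 * (D : ℝ≥0∞) ^ 2 * edist x y * (S x + S y)
          ≤ 12 * (D : ℝ≥0∞) ^ 2 * edist y x * (S y + S y) := by rw [edist_comm]; gcongr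
        _ = _ := by ring
  have hswap : ∫⁻ x, ∫⁻ y, F y x ∂m ∂m = ∫⁻ x, ∫⁻ y, F x y ∂m ∂m :=
    lintegral_lintegral_swap (f := fun x y => F y x)
      (hFm.comp measurable_swap).aemeasurable
  have hInt : ∫⁻ x, ∫⁻ y, F x y ∂m ∂m ≤ D ^ 2 * (2 ^ (p + 1) * 4 + geomConst p * 2 ^ p) *
      (24 * D ^ 2) ^ p * ∫⁻ x, S x ^ p ∂m := by
    rw [← lintegral_const_mul _ (hSm.pow_const p)]
    exact lintegral_mono hFint
  calc truncEnergy p m δ u ≤ ∫⁻ x, ∫⁻ y, (F x y + D * F y x) ∂m ∂m :=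
        lintegral_mono fun x => lintegral_mono fun y => hpt x y
    _ = (∫⁻ x, ∫⁻ y, F x y ∂m ∂m) + D * ∫⁻ x, ∫⁻ y, F y x ∂m ∂m := by
        have h1 : ∀ x, ∫⁻ y, (F x y + D * F y x) ∂m = (∫⁻ y, F x y ∂m) + D * ∫⁻ y, F y x ∂m := by
          intro x
          rw [lintegral_add_left (hFm.of_uncurry_left (f := F)),
            lintegral_const_mul' _ _ ENNReal.coe_ne_top]
        simp_rw [h1]
        rw [lintegral_add_left hFm.lintegral_prod_right',
          lintegral_const_mul' _ _ ENNReal.coe_ne_top]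
    _ = (1 + D) * ∫⁻ x, ∫⁻ y, F x y ∂m ∂m := by rw [hswap]; ring
    _ ≤ _ := by
        rw [mul_assoc]
        gcongr

end DoublingWith

end NonlocalEnergy

/-! ### Finite Cheeger energy implies finite functionals. -/

section Forward

theorem ofReal_abs_sub_eq_edist (a b : ℝ) : ENNReal.ofReal |a - b| = edist a b := by
  rw [edist_dist, Real.dist_eq]

theorem nullMeasurableSet_abs_sub_le {X : Type*} [MeasurableSpace X] {m : Measure X} {f : X → ℝ}
    (hf : AEStronglyMeasurable f m) (a : ℝ) :
    NullMeasurableSet {y | |a - f y| ≤ 1} m :=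
  nullMeasurableSet_le ((aemeasurable_const.sub hf.aemeasurable).abs) aemeasurable_const

theorem nullMeasurableSet_lt_abs_sub {X : Type*} [MeasurableSpace X] {m : Measure X} {f : X → ℝ}
    (hf : AEStronglyMeasurable f m) (a : ℝ) :
    NullMeasurableSet {y | 1 < |a - f y|} m :=
  nullMeasurableSet_lt aemeasurable_const ((aemeasurable_const.sub hf.aemeasurable).abs)

variable {X : Type*} [MetricSpace X] [MeasurableSpace X] {m : Measure X} {D : ℝ≥0}

theorem functionalJ_le_truncEnergy (p : ℝ) {f : X → ℝ} (hf : AEStronglyMeasurable f m) (δ : ℝ) :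
    functionalJ p m f δ ≤ truncEnergy p m δ f := by
  refine lintegral_mono fun x => ?_
  refine le_trans (lintegral_mono_ae ?_) (setLIntegral_le_lintegral {y | |f x - f y| ≤ 1} _)
  filter_upwards [ae_restrict_mem₀ (nullMeasurableSet_abs_sub_le hf (f x))] with y hy
  have h1 : edist (f x) (f y) ≤ 1 := by
    rw [← ofReal_abs_sub_eq_edist]; exact ENNReal.ofReal_le_one.2 hy
  rw [ofReal_abs_sub_eq_edist, min_eq_left h1, pairWeight]

/-- Where |f(x) - f(y)| > 1 the truncated difference is 1, so the exponent is irrelevant and δ = 1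
makes the prefactor 1. -/
theorem largeOscIntegral_le_truncEnergy (p : ℝ) {f : X → ℝ} (hf : AEStronglyMeasurable f m) :
    largeOscIntegral p m f ≤ truncEnergy p m 1 f := by
  refine lintegral_mono fun x => ?_
  refine le_trans (lintegral_mono_ae ?_) (setLIntegral_le_lintegral {y | 1 < |f x - f y|} _)
  filter_upwards [ae_restrict_mem₀ (nullMeasurableSet_lt_abs_sub hf (f x))] with y hy
  have h1 : 1 ≤ edist (f x) (f y) := by
    rw [← ofReal_abs_sub_eq_edist]; exact ENNReal.one_le_ofReal.2 (le_of_lt hy)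
  rw [min_eq_right h1, ENNReal.ofReal_one, ENNReal.one_rpow, one_mul, pairWeight]

namespace DoublingWith

variable [BorelSpace X] [TopologicalSpace.SeparableSpace X]

/-- Lower semicontinuity of the truncated nonlocal energy under almost everywhere convergence. -/
theorem truncEnergy_le_liminf (hm : DoublingWith m D) {p δ : ℝ} (hp : 0 < p) (hδ : 0 < δ)
    {f : X → ℝ} {v : ℕ → X → ℝ} (hv : ∀ n, Measurable (v n))
    (hlim : ∀ᵐ x ∂m, Tendsto (fun n => v n x) atTop (𝓝 (f x))) :
    truncEnergy p m δ f ≤ liminf (fun n => truncEnergy p m δ (v n)) atTop := by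
  have hpδ : 0 < p + δ := by positivity
  have := hm.sigmaFinite
  have hmeas := fun n => hm.measurable_truncIntegrand p δ (hv n)
  set G : (X → ℝ) → X → X → ℝ≥0∞ := fun u x y =>
    ENNReal.ofReal δ * min (edist (u x) (u y)) 1 ^ (p + δ) / pairWeight p m x y with hG
  refine le_trans ?_ (lintegral_liminf_le fun n => (hmeas n).lintegral_prod_right')
  refine lintegral_mono_ae ?_
  filter_upwards [hlim] with x hx
  refine le_trans ?_ (lintegral_liminf_le fun n => (hmeas n).of_uncurry_left (f := G (v n)))
  refine lintegral_mono_ae ?_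
  filter_upwards [hlim] with y hy
  -- On the diagonal the numerator vanishes. Off it the weight is nonzero, so the quotient depends
  -- continuously on the numerator.
  rcases eq_or_ne x y with rfl | hxy
  · simp [hpδ]
  have hw : pairWeight p m x y ≠ 0 := by
    refine mul_ne_zero (hm.pos x _ (dist_pos.2 hxy)).ne' ?_
    simp [ENNReal.rpow_eq_zero_iff, hxy, edist_ne_top]
  have ht : Tendsto (fun n => min (edist (v n x) (v n y)) 1 ^ (p + δ)) atTop
      (𝓝 (min (edist (f x) (f y)) 1 ^ (p + δ))) :=
    (ENNReal.continuous_rpow_const.tendsto _).comp ((hx.edist hy).min tendsto_const_nhds)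
  exact ((ENNReal.Tendsto.div_const (ENNReal.Tendsto.const_mul ht
    (Or.inr ENNReal.ofReal_ne_top)) (Or.inr hw)).liminf_eq).ge

theorem exists_truncEnergy_bound (hm : DoublingWith m D) {p : ℝ} (hp : 1 < p) {CP : ℝ≥0}
    (hCP : 0 < CP) (hP : PoincareWith p m CP) {f : X → ℝ} (hf : AEStronglyMeasurable f m)
    (hCh : cheegerEnergy p m f < ∞) :
    ∃ C : ℝ≥0∞, C ≠ ∞ ∧ ∀ δ : ℝ, 0 < δ → δ ≤ 1 → truncEnergy p m δ f ≤ C := by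
  have hp0 : 0 < p := one_pos.trans hp
  obtain ⟨C, hC, hsharp⟩ := hm.exists_lintegral_sharpMax_le hp hCP hP
  have hCh' := hCh
  simp only [cheegerEnergy, iInf_lt_iff] at hCh'
  obtain ⟨u, hu, hconv, hlt⟩ := hCh'
  obtain ⟨E, hE1, hE2⟩ := exists_between hlt
  -- Along this first subsequence the slope energies stay below E. A second one then gives almost
  -- everywhere convergence, as Fatou's lemma requires. Neither depends on δ.
  obtain ⟨φ, hφ, hφE⟩ := extraction_of_frequently_atTop (frequently_lt_of_liminf_lt
    (by isBoundedDefault) hE1)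
  have hmeasure : TendstoInMeasure m (fun n => u (φ n)) atTop f :=
    tendstoInMeasure_of_tendsto_eLpNorm (by simpa using hp0)
      (fun n => (hu (φ n)).2.1) hf (hconv.comp hφ.tendsto_atTop)
  obtain ⟨ψ, -, hae⟩ := hmeasure.exists_seq_tendsto_ae
  set K : ℝ≥0∞ := (1 + D) * (D ^ 2 * (2 ^ (p + 1) * 4 + geomConst p * 2 ^ p) * (24 * D ^ 2) ^ p)
  have hK : K ≠ ∞ := by
    have := geomConst_ne_top hp0
    simp only [K]
    finiteness
  have hE : E ≠ ∞ := hE2.ne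
  refine ⟨K * (C * E), by finiteness, fun δ h0 h1 => ?_⟩
  have hcont : ∀ n, Continuous (u n) := fun n => by
    obtain ⟨L, hL⟩ := (hu n).1.1
    exact hL.continuous
  refine (hm.truncEnergy_le_liminf hp0 h0 (fun n => (hcont (φ (ψ n))).measurable) hae).trans ?_
  refine liminf_le_of_le (by isBoundedDefault) fun b hb => ?_
  obtain ⟨n, hn⟩ := hb.exists
  refine hn.trans ?_
  obtain ⟨L, hL⟩ := (hu (φ (ψ n))).1.1
  refine (hm.truncEnergy_le_sharpMax hp h0 h1 hL).trans ?_
  refine mul_le_mul_right ((hsharp _ (hu (φ (ψ n))).1).trans ?_) _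
  exact mul_le_mul_right (hφE (ψ n)).le _

theorem nonlocal_finite_of_cheegerEnergy_lt_top (hm : DoublingWith m D) {p : ℝ} (hp : 1 < p)
    {CP : ℝ≥0} (hCP : 0 < CP) (hP : PoincareWith p m CP) {f : X → ℝ}
    (hf : AEStronglyMeasurable f m) (hCh : cheegerEnergy p m f < ∞) :
    sSup (functionalJ p m f '' Set.Ioo 0 1) < ∞ ∧ largeOscIntegral p m f < ∞ := by
  obtain ⟨C, hC, hbound⟩ := hm.exists_truncEnergy_bound hp hCP hP hf hCh
  refine ⟨lt_of_le_of_lt (sSup_le ?_) hC.lt_top,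
    ((largeOscIntegral_le_truncEnergy p hf).trans (hbound 1 one_pos le_rfl)).trans_lt hC.lt_top⟩
  rintro _ ⟨δ, hδ, rfl⟩
  exact (functionalJ_le_truncEnergy p hf δ).trans (hbound δ hδ.1 hδ.2.le)

end DoublingWith

end Forward

/-! ### Regularisation by tent averages. -/

section TentAverage

variable {X : Type*} [MetricSpace X]

/-- The tent function of radius `2r` centred at `x`. -/
noncomputable def tent (r : ℝ) (x y : X) : ℝ := max 0 (2 - dist x y / r)

theorem tent_nonneg (r : ℝ) (x y : X) : 0 ≤ tent r x y := le_max_left _ _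

theorem tent_le_two {r : ℝ} (hr : 0 < r) (x y : X) : tent r x y ≤ 2 :=
  max_le zero_le_two (sub_le_self _ (by positivity))

theorem one_le_tent {r : ℝ} (hr : 0 < r) {x y : X} (h : y ∈ Metric.ball x r) : 1 ≤ tent r x y := by
  refine le_max_of_le_right ?_
  rw [Metric.mem_ball, dist_comm] at h
  have : dist x y / r ≤ 1 := (div_le_one hr).2 h.le
  linarith

theorem tent_eq_zero {r : ℝ} (hr : 0 < r) {x y : X} (h : y ∉ Metric.ball x (2 * r)) :
    tent r x y = 0 := by
  refine max_eq_left ?_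
  rw [Metric.mem_ball, dist_comm, not_lt] at h
  have : 2 ≤ dist x y / r := (le_div_iff₀ hr).2 h
  linarith

theorem abs_tent_sub_tent_le {r : ℝ} (hr : 0 < r) (x x' y : X) :
    |tent r x y - tent r x' y| ≤ dist x x' / r := by
  unfold tent
  refine (abs_max_sub_max_le_max _ _ _ _).trans ?_
  rw [sub_self, abs_zero]
  refine max_le (by positivity) ?_
  have h : 2 - dist x y / r - (2 - dist x' y / r) = (dist x' y - dist x y) / r := by ring
  rw [h, abs_div, abs_of_pos hr]
  gcongr
  rw [dist_comm x x']
  exact abs_dist_sub_le x' x y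

theorem continuous_tent (r : ℝ) (x : X) : Continuous (tent r x) := by
  unfold tent
  fun_prop

variable [MeasurableSpace X] {m : Measure X} {D : ℝ≥0}

/-- The average of `F` with respect to the tent functions of radius `2r`. -/
noncomputable def tentAvg (m : Measure X) (r : ℝ) (F : X → ℝ) (x : X) : ℝ :=
  (∫ y, tent r x y * F y ∂m) / ∫ y, tent r x y ∂m

namespace DoublingWith

theorem measureReal_ball_pos (hm : DoublingWith m D) {r : ℝ} (hr : 0 < r) (x : X) :
    0 < m.real (Metric.ball x r) :=
  ENNReal.toReal_pos (hm.pos x r hr).ne' (hm.fin x r).ne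

theorem measureReal_ball_le_of_dist (hm : DoublingWith m D) {x y : X} {r s : ℝ} (hr : 0 < r)
    (hs : dist y x + s ≤ 4 * r) : m.real (Metric.ball y s) ≤ D ^ 2 * m.real (Metric.ball x r) := by
  have h := ENNReal.toReal_mono (by have := (hm.fin x r).ne; finiteness) (hm.ball_le_of_dist hr hs)
  simpa [Measure.real] using h

theorem integrableOn_of_bounded (hm : DoublingWith m D) {G : X → ℝ} (hG : Measurable G) {M : ℝ}
    (hM : ∀ y, |G y| ≤ M) (x : X) (r : ℝ) : IntegrableOn G (Metric.ball x r) m :=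
  Measure.integrableOn_of_bounded (M := M) (hm.fin x r).ne hG.aestronglyMeasurable
    (Eventually.of_forall hM)

theorem integrable_of_bounded_of_zero_off_ball (hm : DoublingWith m D) {G : X → ℝ}
    (hG : Measurable G) {M : ℝ} (hM : ∀ y, |G y| ≤ M) {x : X} {r : ℝ}
    (h0 : ∀ y, y ∉ Metric.ball x r → G y = 0) : Integrable G m := by
  rw [← integrableOn_iff_integrable_of_support_subset (s := Metric.ball x r)]
  · exact Measure.integrableOn_of_bounded (M := M) (hm.fin x r).ne hG.aestronglyMeasurable
      (Eventually.of_forall hM)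
  · intro y hy
    by_contra h
    exact hy (h0 y h)

variable [BorelSpace X]

theorem integrable_tent_mul (hm : DoublingWith m D) {r : ℝ} (hr : 0 < r) {G : X → ℝ}
    (hG : Measurable G) {M : ℝ} (hM : ∀ y, |G y| ≤ M) (x : X) :
    Integrable (fun y => tent r x y * G y) m := by
  refine hm.integrable_of_bounded_of_zero_off_ball (M := 2 * M) (x := x) (r := 2 * r)
    ((continuous_tent r x).measurable.mul hG) (fun y => ?_) fun y hy => by
      rw [tent_eq_zero hr hy, zero_mul]
  rw [abs_mul, abs_of_nonneg (tent_nonneg r x y)]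
  exact mul_le_mul (tent_le_two hr x y) (hM y) (abs_nonneg _) zero_le_two

theorem integrable_tent (hm : DoublingWith m D) {r : ℝ} (hr : 0 < r) (x : X) :
    Integrable (tent r x) m := by
  simpa using hm.integrable_tent_mul hr (G := fun _ => 1) measurable_const (M := 1) (by simp) x

theorem measureReal_ball_le_integral_tent (hm : DoublingWith m D) {r : ℝ} (hr : 0 < r) (x : X) :
    m.real (Metric.ball x r) ≤ ∫ y, tent r x y ∂m := by
  have hball : IntegrableOn (fun _ : X => (1 : ℝ)) (Metric.ball x r) m :=
    integrableOn_const (hm.fin x r).ne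
  calc m.real (Metric.ball x r) = ∫ _y in Metric.ball x r, (1 : ℝ) ∂m := by simp
    _ ≤ ∫ y in Metric.ball x r, tent r x y ∂m :=
        setIntegral_mono_on hball (hm.integrable_tent hr x).integrableOn measurableSet_ball
          fun y hy => one_le_tent hr hy
    _ ≤ ∫ y, tent r x y ∂m :=
        setIntegral_le_integral (hm.integrable_tent hr x)
          (Eventually.of_forall fun y => tent_nonneg r x y)

theorem integral_tent_pos (hm : DoublingWith m D) {r : ℝ} (hr : 0 < r) (x : X) :
    0 < ∫ y, tent r x y ∂m :=
  (hm.measureReal_ball_pos hr x).trans_le (hm.measureReal_ball_le_integral_tent hr x)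

theorem tentAvg_sub_const (hm : DoublingWith m D) {r : ℝ} (hr : 0 < r) {F : X → ℝ}
    (hF : Measurable F) {M : ℝ} (hM : ∀ y, |F y| ≤ M) (x : X) (c : ℝ) :
    tentAvg m r F x - c = (∫ y, tent r x y * (F y - c) ∂m) / ∫ y, tent r x y ∂m := by
  have h0 := (hm.integral_tent_pos hr x).ne'
  have : ∫ y, tent r x y * (F y - c) ∂m = (∫ y, tent r x y * F y ∂m) - (∫ y, tent r x y ∂m) * c := by
    rw [← integral_mul_const, ← integral_sub (hm.integrable_tent_mul hr hF hM x)
      ((hm.integrable_tent hr x).mul_const c)]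
    simp only [mul_sub]
  rw [this, sub_div, mul_div_cancel_left₀ _ h0]
  rfl

theorem abs_integral_tent_mul_le (hm : DoublingWith m D) {r s : ℝ} (hr : 0 < r) {G : X → ℝ}
    (hG : Measurable G) {M : ℝ} (hM : ∀ y, |G y| ≤ M) {x z : X}
    (hs : Metric.ball x (2 * r) ⊆ Metric.ball z s) :
    |∫ y, tent r x y * G y ∂m| ≤ 2 * ∫ y in Metric.ball z s, |G y| ∂m := by
  have hGa : IntegrableOn (fun y => |G y|) (Metric.ball z s) m :=
    (hm.integrableOn_of_bounded hG hM z s).abs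
  rw [← setIntegral_eq_integral_of_forall_compl_eq_zero (s := Metric.ball z s)
    (f := fun y => tent r x y * G y) (fun y hy => by
      rw [tent_eq_zero hr fun h => hy (hs h), zero_mul]), ← integral_const_mul]
  refine (abs_integral_le_integral_abs).trans ?_
  refine integral_mono (hm.integrable_tent_mul hr hG hM x).integrableOn.abs (hGa.const_mul 2)
    fun y => ?_
  simp only [abs_mul, abs_of_nonneg (tent_nonneg r x y)]
  exact mul_le_mul_of_nonneg_right (tent_le_two hr x y) (abs_nonneg _)

theorem abs_integral_tent_sub_le (hm : DoublingWith m D) {r : ℝ} (hr : 0 < r) {G : X → ℝ}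
    (hG : Measurable G) {M : ℝ} (hM : ∀ y, |G y| ≤ M) {x x' : X} (hd : dist x x' ≤ r) :
    |(∫ y, tent r x y * G y ∂m) - ∫ y, tent r x' y * G y ∂m| ≤
      dist x x' / r * ∫ y in Metric.ball x (3 * r), |G y| ∂m := by
  have hGa : IntegrableOn (fun y => |G y|) (Metric.ball x (3 * r)) m :=
    (hm.integrableOn_of_bounded hG hM x _).abs
  have hint := (hm.integrable_tent_mul hr hG hM x).sub (hm.integrable_tent_mul hr hG hM x')
  rw [← integral_sub (hm.integrable_tent_mul hr hG hM x) (hm.integrable_tent_mul hr hG hM x'),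
    ← setIntegral_eq_integral_of_forall_compl_eq_zero (s := Metric.ball x (3 * r))
      (f := fun y => tent r x y * G y - tent r x' y * G y) ?_, ← integral_const_mul]
  · refine (abs_integral_le_integral_abs).trans ?_
    refine integral_mono hint.integrableOn.abs (hGa.const_mul _) fun y => ?_
    simp only [← sub_mul, abs_mul]
    exact mul_le_mul_of_nonneg_right (abs_tent_sub_tent_le hr x x' y) (abs_nonneg _)
  · intro y hy
    rw [tent_eq_zero hr fun h => hy (Metric.ball_subset_ball (by linarith) h),
      tent_eq_zero hr fun h => hy (Metric.ball_subset_ball' (by rw [dist_comm x' x]; linarith) h)]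
    simp

/-- Difference estimate for tent averages. -/
theorem abs_tentAvg_sub_le (hm : DoublingWith m D) {r : ℝ} (hr : 0 < r) {F : X → ℝ}
    (hF : Measurable F) {M : ℝ} (hM : ∀ y, |F y| ≤ M) {x x' : X} (hd : dist x x' ≤ r) :
    |tentAvg m r F x - tentAvg m r F x'| ≤ 3 * D ^ 4 / r * dist x x' *
      ((∫ y in Metric.ball x (3 * r), |F y - F x| ∂m) / m.real (Metric.ball x (3 * r))) := by
  have : Nonempty X := ⟨x⟩
  have hD : (1 : ℝ) ≤ D := by exact_mod_cast hm.one_le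
  have hGM : ∀ y, |F y - F x| ≤ 2 * M := fun y => by
    have h1 := hM y; have h2 := hM x
    calc |F y - F x| ≤ |F y| + |F x| := abs_sub _ _
      _ ≤ _ := by linarith
  have hGm : Measurable fun y => F y - F x := hF.sub_const _
  have h3r : 0 < 3 * r := by positivity
  have hV := hm.measureReal_ball_pos h3r x
  have hTx := hm.integral_tent_pos hr x
  have hTx' := hm.integral_tent_pos hr x'
  have hVx : m.real (Metric.ball x (3 * r)) ≤ D ^ 2 * ∫ y, tent r x y ∂m :=
    (hm.measureReal_ball_le_of_dist hr (by rw [dist_self]; linarith)).trans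
      (mul_le_mul_of_nonneg_left (hm.measureReal_ball_le_integral_tent hr x) (by positivity))
  have hVx' : m.real (Metric.ball x (3 * r)) ≤ D ^ 2 * ∫ y, tent r x' y ∂m :=
    (hm.measureReal_ball_le_of_dist hr (by linarith)).trans
      (mul_le_mul_of_nonneg_left (hm.measureReal_ball_le_integral_tent hr x') (by positivity))
  have hN := hm.abs_integral_tent_sub_le hr hGm hGM hd
  have hN' := hm.abs_integral_tent_mul_le hr hGm hGM (x := x') (z := x) (s := 3 * r)
    (Metric.ball_subset_ball' (by rw [dist_comm x' x]; linarith))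
  have hT := hm.abs_integral_tent_sub_le hr (G := fun _ => 1) measurable_const (M := 1) (by simp) hd
  simp only [mul_one, abs_one, integral_const, MeasurableSet.univ, measureReal_restrict_apply,
    Set.univ_inter, smul_eq_mul] at hT
  have hsub : tentAvg m r F x - tentAvg m r F x' =
      (tentAvg m r F x - F x) - (tentAvg m r F x' - F x) := by ring
  rw [hsub, hm.tentAvg_sub_const hr hF hM, hm.tentAvg_sub_const hr hF hM]
  set I := ∫ y in Metric.ball x (3 * r), |F y - F x| ∂m
  set V := m.real (Metric.ball x (3 * r))
  set T := ∫ y, tent r x y ∂m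
  set T' := ∫ y, tent r x' y ∂m
  set N := ∫ y, tent r x y * (F y - F x) ∂m
  set N' := ∫ y, tent r x' y * (F y - F x) ∂m
  have hI : 0 ≤ I := integral_nonneg fun y => abs_nonneg _
  set a := dist x x' / r with ha
  have ha0 : 0 ≤ a := by positivity
  have hTinv : T⁻¹ ≤ D ^ 2 * V⁻¹ := by
    rw [← div_eq_mul_inv, inv_eq_one_div, div_le_div_iff₀ hTx hV]; linarith
  have hTinv' : T'⁻¹ ≤ D ^ 2 * V⁻¹ := by
    rw [← div_eq_mul_inv, inv_eq_one_div, div_le_div_iff₀ hTx' hV]; linarith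
  -- Separates the variation of the numerator from that of the normalisation. The constant F(x) was
  -- subtracted beforehand, so both pieces involve only |F - F(x)|.
  have hid : N / T - N' / T' = (N - N') * T⁻¹ + N' * ((T' - T) * (T⁻¹ * T'⁻¹)) := by
    field_simp; ring
  rw [hid]
  calc |(N - N') * T⁻¹ + N' * ((T' - T) * (T⁻¹ * T'⁻¹))|
      ≤ |N - N'| * T⁻¹ + |N'| * (|T - T'| * (T⁻¹ * T'⁻¹)) := by
        refine (abs_add_le _ _).trans ?_
        rw [abs_mul, abs_mul, abs_mul, abs_sub_comm T' T, abs_of_pos (inv_pos.2 hTx),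
          abs_of_pos (mul_pos (inv_pos.2 hTx) (inv_pos.2 hTx'))]
    _ ≤ (a * I) * (D ^ 2 * V⁻¹) + (2 * I) * ((a * V) * ((D ^ 2 * V⁻¹) * (D ^ 2 * V⁻¹))) := by
        gcongr
    _ = (D ^ 2 + 2 * D ^ 4) * a * (I / V) := by field_simp
    _ ≤ (D ^ 4 + 2 * D ^ 4) * a * (I / V) := by
        gcongr
        norm_num
    _ = _ := by rw [ha]; ring

theorem abs_tentAvg_le (hm : DoublingWith m D) {r : ℝ} (hr : 0 < r) {F : X → ℝ}
    (hF : Measurable F) {M : ℝ} (hM : ∀ y, |F y| ≤ M) (x : X) : |tentAvg m r F x| ≤ M := by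
  have hT := hm.integral_tent_pos hr x
  rw [tentAvg, abs_div, abs_of_pos hT, div_le_iff₀ hT, ← integral_const_mul]
  refine (abs_integral_le_integral_abs).trans ?_
  refine integral_mono (hm.integrable_tent_mul hr hF hM x).abs ((hm.integrable_tent hr x).const_mul M)
    fun y => ?_
  simp only [abs_mul, abs_of_nonneg (tent_nonneg r x y)]
  rw [mul_comm]
  exact mul_le_mul_of_nonneg_right (hM y) (tent_nonneg r x y)

/-- Points within distance r use the difference estimate, and more distant ones the bound 2M. The
constant degenerates as r tends to 0, so it only serves admissibility and finiteness. -/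
theorem exists_lipschitzWith_tentAvg (hm : DoublingWith m D) {r : ℝ} (hr : 0 < r) {F : X → ℝ}
    (hF : Measurable F) {M : ℝ} (hM : ∀ y, |F y| ≤ M) :
    ∃ L : ℝ≥0, LipschitzWith L (tentAvg m r F) := by
  rcases isEmpty_or_nonempty X with hX | ⟨⟨x₀⟩⟩
  · exact ⟨0, fun x => (hX.false x).elim⟩
  have hM0 : 0 ≤ M := (abs_nonneg _).trans (hM x₀)
  refine ⟨(3 * D ^ 4 / r * (2 * M) + 2 * M / r).toNNReal, LipschitzWith.of_dist_le_mul fun x x' => ?_⟩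
  rw [Real.coe_toNNReal _ (by positivity), Real.dist_eq]
  rcases le_total (dist x x') r with hd | hd
  · refine (hm.abs_tentAvg_sub_le hr hF hM hd).trans ?_
    have hV := hm.measureReal_ball_pos (by positivity : 0 < 3 * r) x
    have hle : (∫ y in Metric.ball x (3 * r), |F y - F x| ∂m) / m.real (Metric.ball x (3 * r))
        ≤ 2 * M := by
      rw [div_le_iff₀ hV]
      have := norm_setIntegral_le_of_norm_le_const (μ := m) (s := Metric.ball x (3 * r)) (C := 2 * M)
        (f := fun y => |F y - F x|) (hm.fin x _) (fun y _ => by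
          rw [Real.norm_eq_abs, abs_abs]
          calc |F y - F x| ≤ |F y| + |F x| := abs_sub _ _
            _ ≤ 2 * M := by linarith [hM y, hM x])
      exact (le_abs_self _).trans this
    calc _ ≤ 3 * D ^ 4 / r * dist x x' * (2 * M) := by gcongr
      _ = 3 * D ^ 4 / r * (2 * M) * dist x x' := by ring
      _ ≤ _ := by
        gcongr
        exact le_add_of_nonneg_right (by positivity)
  · calc |tentAvg m r F x - tentAvg m r F x'| ≤ |tentAvg m r F x| + |tentAvg m r F x'| := abs_sub _ _
      _ ≤ 2 * M := by linarith [hm.abs_tentAvg_le hr hF hM x, hm.abs_tentAvg_le hr hF hM x']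
      _ = 2 * M / r * r := by field_simp
      _ ≤ 2 * M / r * dist x x' := by gcongr
      _ ≤ _ := by
        gcongr
        exact le_add_of_nonneg_left (by positivity)

/-- The difference estimate is linear in d(x,y), and its coefficient involves only the base point x,
so it passes directly to the limsup. -/
theorem slopeAt_tentAvg_le (hm : DoublingWith m D) {r : ℝ} (hr : 0 < r) {F : X → ℝ}
    (hF : Measurable F) {M : ℝ} (hM : ∀ y, |F y| ≤ M) (x : X) :
    slopeAt (tentAvg m r F) x ≤ ENNReal.ofReal (3 * D ^ 4 / r) *
      ⨍⁻ y in Metric.ball x (3 * r), ‖F y - F x‖ₑ ∂m := by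
  have h3r : 0 < 3 * r := by positivity
  have hV := hm.measureReal_ball_pos h3r x
  have hint : IntegrableOn (fun y => F y - F x) (Metric.ball x (3 * r)) m :=
    hm.integrableOn_of_bounded (M := M + M) (hF.sub_const _) (fun y =>
      (abs_sub _ _).trans (add_le_add (hM y) (hM x))) x _
  have hconv : ENNReal.ofReal ((∫ y in Metric.ball x (3 * r), |F y - F x| ∂m) /
      m.real (Metric.ball x (3 * r))) = ⨍⁻ y in Metric.ball x (3 * r), ‖F y - F x‖ₑ ∂m := by
    rw [ENNReal.ofReal_div_of_pos hV, setLAverage_eq, Measure.real,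
      ENNReal.ofReal_toReal (hm.fin x _).ne]
    congr 1
    exact ofReal_integral_norm_eq_lintegral_enorm hint
  refine slopeAt_le_of_eventually_le ?_
  filter_upwards [nhdsWithin_le_nhds (Metric.ball_mem_nhds x hr)] with y hy
  rw [Metric.mem_ball, dist_comm] at hy
  rw [edist_dist, Real.dist_eq, edist_dist]
  refine (ENNReal.ofReal_le_ofReal (hm.abs_tentAvg_sub_le hr hF hM hy.le)).trans_eq ?_
  rw [← hconv, ENNReal.ofReal_mul (by positivity), ENNReal.ofReal_mul (by positivity)]
  ring

/-- Tent averages converge almost everywhere as the radius tends to zero. -/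
theorem ae_tendsto_tentAvg [TopologicalSpace.SeparableSpace X] (hm : DoublingWith m D) {F : X → ℝ}
    (hF : Measurable F) {M : ℝ} (hM : ∀ y, |F y| ≤ M) {r : ℕ → ℝ} (hr : ∀ k, 0 < r k)
    (hr0 : Tendsto r atTop (𝓝 0)) :
    ∀ᵐ x ∂m, Tendsto (fun k => tentAvg m (r k) F x) atTop (𝓝 (F x)) := by
  have := hm.isUnifLocDoublingMeasure
  have := hm.isLocallyFiniteMeasure
  have := UniformSpace.secondCountable_of_separable X
  have hloc : LocallyIntegrable F m := fun x =>
    ⟨Metric.ball x 1, Metric.ball_mem_nhds x one_pos,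
      hm.integrableOn_of_bounded hF hM x 1⟩
  -- Lebesgue points suffice: the tent is at most 2, vanishes off the ball of radius 2r, and its
  -- integral is comparable to the measure of that ball.
  filter_upwards [IsUnifLocDoublingMeasure.ae_tendsto_average_norm_sub.{_, _, 0} m hloc 1] with x hx
  have hlim := hx (l := atTop) (fun _ : ℕ => x) (fun k => 2 * r k)
    (tendsto_nhdsWithin_iff.2 ⟨by simpa using hr0.const_mul 2,
      Eventually.of_forall fun k => by simpa using hr k⟩)
    (Eventually.of_forall fun k => Metric.mem_closedBall_self (by have := hr k; positivity))
  rw [tendsto_iff_norm_sub_tendsto_zero]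
  refine squeeze_zero (fun _ => norm_nonneg _) (fun k => ?_)
    (by simpa using hlim.const_mul (2 * (D : ℝ) ^ 2))
  have hrk := hr k
  have hGM : ∀ y, |F y - F x| ≤ M + M := fun y => (abs_sub _ _).trans (add_le_add (hM y) (hM x))
  have hGm : Measurable fun y => F y - F x := hF.sub_const _
  have hT := hm.integral_tent_pos hrk x
  have hcb : m (Metric.closedBall x (2 * r k)) ≠ ∞ :=
    (hm.measure_lt_top_of_isBounded Metric.isBounded_closedBall).ne
  have hVpos : 0 < m.real (Metric.closedBall x (2 * r k)) :=
    (hm.measureReal_ball_pos (by positivity : 0 < 2 * r k) x).trans_le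
      (measureReal_mono Metric.ball_subset_closedBall hcb)
  have hV : m.real (Metric.closedBall x (2 * r k)) ≤ D ^ 2 * ∫ y, tent (r k) x y ∂m := by
    calc m.real (Metric.closedBall x (2 * r k)) ≤ m.real (Metric.ball x (4 * r k)) :=
          measureReal_mono (Metric.closedBall_subset_ball (by linarith)) (hm.fin x _).ne
      _ ≤ D ^ 2 * m.real (Metric.ball x (r k)) :=
          hm.measureReal_ball_le_of_dist hrk (by rw [dist_self]; linarith)
      _ ≤ _ := mul_le_mul_of_nonneg_left (hm.measureReal_ball_le_integral_tent hrk x) (by positivity)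
  have hInt : IntegrableOn (fun y => |F y - F x|) (Metric.closedBall x (2 * r k)) m :=
    (Measure.integrableOn_of_bounded (M := M + M) hcb hGm.aestronglyMeasurable
      (Eventually.of_forall hGM)).abs
  have hI : 2 * ∫ y in Metric.ball x (2 * r k), |F y - F x| ∂m ≤
      2 * ∫ y in Metric.closedBall x (2 * r k), |F y - F x| ∂m := by
    refine mul_le_mul_of_nonneg_left (setIntegral_mono_set hInt
      (Eventually.of_forall fun y => abs_nonneg _)
      (Metric.ball_subset_closedBall.eventuallyLE)) zero_le_two
  rw [Real.norm_eq_abs, hm.tentAvg_sub_const hrk hF hM, abs_div, abs_of_pos hT, setAverage_eq,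
    smul_eq_mul]
  set V := m.real (Metric.closedBall x (2 * r k))
  have hI0 : 0 ≤ ∫ y in Metric.closedBall x (2 * r k), |F y - F x| ∂m :=
    integral_nonneg fun y => abs_nonneg _
  have hN := (hm.abs_integral_tent_mul_le hrk hGm hGM (x := x) subset_rfl).trans hI
  rw [div_le_iff₀ hT]
  refine hN.trans ?_
  calc 2 * ∫ y in Metric.closedBall x (2 * r k), |F y - F x| ∂m
      = 2 * (V⁻¹ * V) * ∫ y in Metric.closedBall x (2 * r k), |F y - F x| ∂m := by
        rw [inv_mul_cancel₀ hVpos.ne', mul_one]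
    _ ≤ 2 * (V⁻¹ * (D ^ 2 * ∫ y, tent (r k) x y ∂m)) *
        ∫ y in Metric.closedBall x (2 * r k), |F y - F x| ∂m := by gcongr
    _ = _ := by ring

end DoublingWith

end TentAverage

/-! ### Jensen's inequality for averages. -/

section Jensen

variable {X : Type*} [MeasurableSpace X] {m : Measure X}

theorem setLAverage_enorm_rpow_le {s : Set X} (h0 : m s ≠ 0) (ht : m s ≠ ∞) {q : ℝ} (hq : 1 ≤ q)
    {g : X → ℝ} (hg : Measurable g) :
    (⨍⁻ y in s, ‖g y‖ₑ ∂m) ^ q ≤ ⨍⁻ y in s, ‖g y‖ₑ ^ q ∂m := by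
  have := isProbabilityMeasure_normalized h0 ht
  have hq0 : 0 < q := one_pos.trans_le hq
  have h := eLpNorm'_le_eLpNorm'_of_exponent_le one_pos hq
    ((m.restrict s Set.univ)⁻¹ • m.restrict s) hg.aestronglyMeasurable
  rw [eLpNorm'_eq_lintegral_enorm, eLpNorm'_eq_lintegral_enorm] at h
  simp only [ENNReal.rpow_one, div_one] at h
  rw [one_div] at h
  exact (ENNReal.le_rpow_inv_iff hq0).1 h

end Jensen

/-! ### Dyadic energies and the choice of a good scale. -/

section DyadicEnergy

/-- Since log 2 < 1, 1 - 2^(-δ) ≤ δ. The sum of 2^(-kδ) over k ≥ 0 is therefore at least 1/δ, which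
drives the selection of a good scale. -/
theorem one_le_ofReal_mul_geomConst {δ : ℝ} (h0 : 0 < δ) :
    1 ≤ ENNReal.ofReal δ * geomConst δ := by
  have h2 : ((2 : ℝ≥0∞) ^ δ)⁻¹ = ENNReal.ofReal ((1 / 2) ^ δ) := by
    rw [← ENNReal.ofReal_rpow_of_pos (by norm_num), ← ENNReal.inv_rpow]
    congr 1
    rw [one_div, ENNReal.ofReal_inv_of_pos two_pos, ENNReal.ofReal_ofNat]
  have hb : 1 - δ ≤ ((1 : ℝ) / 2) ^ δ := by
    rw [Real.rpow_def_of_pos (by norm_num), one_div, Real.log_inv]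
    have h1 := Real.add_one_le_exp (-Real.log 2 * δ)
    have h3 := Real.log_two_lt_d9
    nlinarith
  have h3 : 1 - ((2 : ℝ≥0∞) ^ δ)⁻¹ ≤ ENNReal.ofReal δ := by
    rw [h2, ← ENNReal.ofReal_one, ← ENNReal.ofReal_sub _ (by positivity)]
    exact ENNReal.ofReal_le_ofReal (by linarith)
  have hδ : ENNReal.ofReal δ ≠ 0 := by simpa using h0
  rw [← ENNReal.mul_inv_cancel hδ ENNReal.ofReal_ne_top]
  unfold geomConst
  gcongr

variable {X : Type*} [MetricSpace X] [MeasurableSpace X] {m : Measure X} {D : ℝ≥0}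

/-- The kernel of the energy at scale `2 ^ (-k)`. -/
noncomputable def dyadicKernel (p q : ℝ) (m : Measure X) (F : X → ℝ) (k : ℕ) (x y : X) : ℝ≥0∞ :=
  (Metric.ball x ((1 / 2) ^ k)).indicator
    (fun y => ((2 : ℝ≥0∞) ^ k) ^ p / m (Metric.ball x ((1 / 2) ^ k)) * edist (F y) (F x) ^ q) y

/-- The energy at scale `2 ^ (-k)`. -/
noncomputable def dyadicEnergy (p q : ℝ) (m : Measure X) (F : X → ℝ) (k : ℕ) : ℝ≥0∞ :=
  ∫⁻ x, ∫⁻ y, dyadicKernel p q m F k x y ∂m ∂m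

/-- The nonlocal energy with exponent `q`. -/
noncomputable def nonlocalEnergy (p q : ℝ) (m : Measure X) (F : X → ℝ) : ℝ≥0∞ :=
  ∫⁻ x, ∫⁻ y, edist (F y) (F x) ^ q / pairWeight p m x y ∂m ∂m

namespace DoublingWith

/-- A pair (x,y) is seen only at scales 2^(-k) > d(x,y). There the ball measure is at least that of
radius d(x,y), and the factors 2^(kp) sum geometrically to a multiple of d(x,y)^(-p). -/
theorem tsum_dyadicKernel_le (hm : DoublingWith m D) {p q : ℝ} (hp : 0 < p) (hq : 0 < q)
    (F : X → ℝ) (x y : X) :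
    ∑' k, dyadicKernel p q m F k x y ≤
      geomConst p * (edist (F y) (F x) ^ q / pairWeight p m x y) := by
  rcases eq_or_ne x y with rfl | hxy
  · have : ∀ k, dyadicKernel p q m F k x x = 0 := fun k => by
      simp [dyadicKernel, hq]
    simp [this]
  have hd : 0 < dist x y := dist_pos.2 hxy
  have he : edist x y ≠ 0 := by simpa using hxy
  have hV0 : m (Metric.ball x (dist x y)) ≠ 0 := (hm.pos x _ hd).ne'
  have hVt : m (Metric.ball x (dist x y)) ≠ ∞ := (hm.fin x _).ne
  set a := edist (F y) (F x) ^ q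
  set V := m (Metric.ball x (dist x y))
  set t := (edist x y)⁻¹ with ht
  have hk : ∀ k : ℕ, dyadicKernel p q m F k x y ≤
      a / V * (if (2 : ℝ≥0∞) ^ (k : ℤ) < t then ((2 : ℝ≥0∞) ^ (k : ℤ)) ^ p else 0) := by
    intro k
    by_cases hy : y ∈ Metric.ball x ((1 / 2) ^ k)
    · have hdk : dist x y < (1 / 2) ^ k := by rwa [Metric.mem_ball, dist_comm] at hy
      have hlt : (2 : ℝ≥0∞) ^ (k : ℤ) < t := by
        rw [ht, ENNReal.lt_inv_iff_lt_inv, zpow_natCast, ENNReal.inv_pow, edist_dist]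
        refine (ENNReal.ofReal_lt_ofReal_iff (by positivity)).2 hdk |>.trans_eq ?_
        rw [ENNReal.ofReal_pow (by norm_num), one_div, ENNReal.ofReal_inv_of_pos two_pos,
          ENNReal.ofReal_ofNat]
      rw [if_pos hlt, dyadicKernel, Set.indicator_of_mem hy, zpow_natCast]
      calc ((2 : ℝ≥0∞) ^ k) ^ p / m (Metric.ball x ((1 / 2) ^ k)) * a
          ≤ ((2 : ℝ≥0∞) ^ k) ^ p / V * a := by
            gcongr
            exact measure_mono (Metric.ball_subset_ball hdk.le)
        _ = _ := by rw [div_eq_mul_inv, div_eq_mul_inv]; ring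
    · rw [dyadicKernel, Set.indicator_of_notMem hy]
      exact bot_le
  calc ∑' k, dyadicKernel p q m F k x y
      ≤ ∑' k : ℕ, a / V * (if (2 : ℝ≥0∞) ^ (k : ℤ) < t then ((2 : ℝ≥0∞) ^ (k : ℤ)) ^ p else 0) :=
        ENNReal.tsum_le_tsum hk
    _ = a / V * ∑' k : ℕ, (if (2 : ℝ≥0∞) ^ (k : ℤ) < t then ((2 : ℝ≥0∞) ^ (k : ℤ)) ^ p else 0) :=
        ENNReal.tsum_mul_left
    _ ≤ a / V * (geomConst p * t ^ p) := by
        gcongr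
        exact (ENNReal.tsum_comp_le_tsum_of_injective Nat.cast_injective
          fun n : ℤ => if (2 : ℝ≥0∞) ^ n < t then ((2 : ℝ≥0∞) ^ n) ^ p else 0).trans
          (tsum_zpow_rpow_lt_le hp t)
    _ = _ := by
        rw [pairWeight, div_eq_mul_inv, div_eq_mul_inv, ENNReal.mul_inv (Or.inl hV0) (Or.inl hVt),
          ht, ENNReal.inv_rpow]
        ring

variable [BorelSpace X]

theorem measurable_measure_ball [TopologicalSpace.SeparableSpace X] (hm : DoublingWith m D)
    (r : ℝ) : Measurable fun x => m (Metric.ball x r) := by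
  have := hm.sigmaFinite
  have := UniformSpace.secondCountable_of_separable X
  have hs : MeasurableSet {q : X × X | dist q.2 q.1 < r} :=
    (isOpen_lt (by fun_prop) (by fun_prop)).measurableSet
  exact measurable_measure_prodMk_left (ν := m) hs

theorem measurable_dyadicKernel [TopologicalSpace.SeparableSpace X] (hm : DoublingWith m D)
    (p q : ℝ) {F : X → ℝ} (hF : Measurable F) (k : ℕ) :
    Measurable (Function.uncurry (dyadicKernel p q m F k)) := by
  have := UniformSpace.secondCountable_of_separable X
  have hs : MeasurableSet {q : X × X | dist q.2 q.1 < (1 / 2) ^ k} :=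
    (isOpen_lt (by fun_prop) (by fun_prop)).measurableSet
  have hg : Measurable fun z : X × X => ((2 : ℝ≥0∞) ^ k) ^ p /
      m (Metric.ball z.1 ((1 / 2) ^ k)) * edist (F z.2) (F z.1) ^ q :=
    (measurable_const.div ((hm.measurable_measure_ball _).comp measurable_fst)).mul
      (((hF.comp measurable_snd).edist (hF.comp measurable_fst)).pow_const q)
  exact hg.indicator hs

theorem tsum_dyadicEnergy_le [TopologicalSpace.SeparableSpace X] (hm : DoublingWith m D)
    {p q : ℝ} (hp : 0 < p) (hq : 0 < q) {F : X → ℝ} (hF : Measurable F) :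
    ∑' k, dyadicEnergy p q m F k ≤ geomConst p * nonlocalEnergy p q m F := by
  have := hm.sigmaFinite
  have hmeas := fun k => hm.measurable_dyadicKernel p q hF k
  unfold dyadicEnergy nonlocalEnergy
  rw [← lintegral_tsum fun k => (hmeas k).lintegral_prod_right.aemeasurable,
    ← lintegral_const_mul' _ _ (geomConst_ne_top hp)]
  refine lintegral_mono fun x => ?_
  rw [← lintegral_tsum fun k => ((hmeas k).of_uncurry_left (x := x)).aemeasurable,
    ← lintegral_const_mul' _ _ (geomConst_ne_top hp)]
  exact lintegral_mono fun y => hm.tsum_dyadicKernel_le hp hq F x y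

/-- The tent radius is 2^(-k)/3, so the ball in the slope estimate has radius 2^(-k). Jensen's
inequality moves the exponent p+δ inside. The energy is normalised by 2^(kp) only, whence the
surplus 2^(kδ). -/
theorem lintegral_slopeAt_tentAvg_rpow_le (hm : DoublingWith m D)
    {p δ : ℝ} (hp : 1 ≤ p) (h0 : 0 < δ) {F : X → ℝ} (hF : Measurable F) {M : ℝ}
    (hM : ∀ y, |F y| ≤ M) (k : ℕ) :
    ∫⁻ x, slopeAt (tentAvg m ((1 / 2) ^ k / 3) F) x ^ (p + δ) ∂m ≤
      (9 * D ^ 4) ^ (p + δ) * (((2 : ℝ≥0∞) ^ k) ^ δ * dyadicEnergy p (p + δ) m F k) := by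
  have hq : 1 ≤ p + δ := by linarith
  have hq0 : 0 < p + δ := by linarith
  have h2k : ((2 : ℝ≥0∞) ^ k) ≠ ∞ := by finiteness
  have h2k0 : ((2 : ℝ≥0∞) ^ k) ≠ 0 := by positivity
  unfold dyadicEnergy
  rw [← mul_assoc, ← lintegral_const_mul']
  swap
  · refine ENNReal.mul_ne_top (ENNReal.rpow_ne_top_of_nonneg hq0.le (by finiteness))
      (ENNReal.rpow_ne_top_of_nonneg h0.le h2k)
  refine lintegral_mono fun x => ?_
  have hr : (0 : ℝ) < (1 / 2) ^ k / 3 := by positivity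
  have h3r : 3 * ((1 / 2 : ℝ) ^ k / 3) = (1 / 2) ^ k := by ring
  have hs := hm.slopeAt_tentAvg_le hr hF hM x
  rw [h3r] at hs
  have hV0 := (hm.pos x ((1 / 2) ^ k) (by positivity)).ne'
  have hVt := (hm.fin x ((1 / 2) ^ k)).ne
  have hc : ENNReal.ofReal (3 * D ^ 4 / ((1 / 2) ^ k / 3)) = 9 * D ^ 4 * 2 ^ k := by
    have : (3 * (D : ℝ) ^ 4 / ((1 / 2) ^ k / 3)) = 9 * D ^ 4 * 2 ^ k := by
      rw [one_div, inv_pow]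
      field_simp
      ring
    rw [this, ENNReal.ofReal_mul (by positivity), ENNReal.ofReal_mul (by positivity),
      ENNReal.ofReal_pow (by positivity), ENNReal.ofReal_pow (by positivity),
      ENNReal.ofReal_coe_nnreal, ENNReal.ofReal_ofNat, ENNReal.ofReal_ofNat]
  rw [hc] at hs
  have hker : ∫⁻ y, dyadicKernel p (p + δ) m F k x y ∂m =
      ((2 : ℝ≥0∞) ^ k) ^ p * ⨍⁻ y in Metric.ball x ((1 / 2) ^ k), ‖F y - F x‖ₑ ^ (p + δ) ∂m := by
    unfold dyadicKernel
    rw [lintegral_indicator measurableSet_ball, lintegral_const_mul', setLAverage_eq]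
    · simp only [edist_eq_enorm_sub, div_eq_mul_inv]
      ring
    · exact ENNReal.div_ne_top (ENNReal.rpow_ne_top_of_nonneg (by linarith) h2k) hV0
  rw [hker]
  calc slopeAt (tentAvg m ((1 / 2) ^ k / 3) F) x ^ (p + δ)
      ≤ (9 * D ^ 4 * 2 ^ k * ⨍⁻ y in Metric.ball x ((1 / 2) ^ k), ‖F y - F x‖ₑ ∂m) ^ (p + δ) := by
        gcongr
    _ = (9 * D ^ 4) ^ (p + δ) * (((2 : ℝ≥0∞) ^ k) ^ p * ((2 : ℝ≥0∞) ^ k) ^ δ) *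
        (⨍⁻ y in Metric.ball x ((1 / 2) ^ k), ‖F y - F x‖ₑ ∂m) ^ (p + δ) := by
        rw [ENNReal.mul_rpow_of_nonneg _ _ hq0.le, ENNReal.mul_rpow_of_nonneg _ _ hq0.le,
          ENNReal.rpow_add p δ h2k0 h2k]
    _ ≤ (9 * D ^ 4) ^ (p + δ) * (((2 : ℝ≥0∞) ^ k) ^ p * ((2 : ℝ≥0∞) ^ k) ^ δ) *
        ⨍⁻ y in Metric.ball x ((1 / 2) ^ k), ‖F y - F x‖ₑ ^ (p + δ) ∂m := by
        gcongr
        exact setLAverage_enorm_rpow_le hV0 hVt hq (hF.sub_const _)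
    _ = _ := by ring

end DoublingWith

/-- A summable sequence has good terms against a slowly decaying geometric weight. -/
theorem exists_rpow_mul_le_of_tsum_le {e : ℕ → ℝ≥0∞} {δ : ℝ} (h0 : 0 < δ) {A : ℝ≥0∞}
    (hA0 : A ≠ 0) (hAt : A ≠ ∞) (h : ENNReal.ofReal δ * ∑' k, e k ≤ A) {k₀ : ℕ}
    (hk₀ : δ * k₀ ≤ 1) : ∃ k, k₀ ≤ k ∧ ((2 : ℝ≥0∞) ^ k) ^ δ * e k ≤ 4 * A := by
  by_contra! hcon
  have h2δ0 : (2 : ℝ≥0∞) ^ δ ≠ 0 := by simp [ENNReal.rpow_eq_zero_iff]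
  have h2δt : (2 : ℝ≥0∞) ^ δ ≠ ∞ := ENNReal.rpow_ne_top_of_nonneg h0.le ENNReal.ofNat_ne_top
  have hcomm : ∀ k : ℕ, ((2 : ℝ≥0∞) ^ k) ^ δ = ((2 : ℝ≥0∞) ^ δ) ^ k := fun k => by
    simpa using ENNReal.zpow_rpow_comm (k : ℤ) δ
  have hlow : ∀ j : ℕ, 4 * A * (((2 : ℝ≥0∞) ^ δ)⁻¹ ^ k₀ * ((2 : ℝ≥0∞) ^ δ)⁻¹ ^ j) ≤ e (k₀ + j) := by
    intro j
    have h1 := (hcon (k₀ + j) (Nat.le_add_right _ _)).le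
    rw [hcomm] at h1
    rw [← pow_add, ← ENNReal.inv_pow, ← div_eq_mul_inv]
    exact ENNReal.div_le_of_le_mul' h1
  -- Discarding the first k₀ scales costs at most a factor 2, by δ k₀ ≤ 1. If every later term were
  -- bad, δ times the sum would be at least 4A/2 = 2A, exceeding A.
  have hk : (1 / 2 : ℝ≥0∞) ≤ ((2 : ℝ≥0∞) ^ δ)⁻¹ ^ k₀ := by
    rw [← ENNReal.inv_pow, one_div, ENNReal.inv_le_inv, ← ENNReal.rpow_natCast, ← ENNReal.rpow_mul]
    exact (ENNReal.rpow_le_rpow_of_exponent_le ENNReal.one_lt_two.le hk₀).trans_eq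
      (ENNReal.rpow_one 2)
  have hsum : 4 * A * (((2 : ℝ≥0∞) ^ δ)⁻¹ ^ k₀ * geomConst δ) ≤ ∑' k, e k := by
    calc 4 * A * (((2 : ℝ≥0∞) ^ δ)⁻¹ ^ k₀ * geomConst δ)
        = ∑' j : ℕ, 4 * A * (((2 : ℝ≥0∞) ^ δ)⁻¹ ^ k₀ * ((2 : ℝ≥0∞) ^ δ)⁻¹ ^ j) := by
          rw [ENNReal.tsum_mul_left, ENNReal.tsum_mul_left, ENNReal.tsum_geometric, geomConst]
      _ ≤ ∑' j : ℕ, e (k₀ + j) := ENNReal.tsum_le_tsum hlow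
      _ ≤ _ := ENNReal.tsum_comp_le_tsum_of_injective (add_right_injective k₀) e
  have : 2 * A ≤ A := by
    calc 2 * A = 4 * A * (1 / 2) * 1 := by
          rw [mul_one, mul_comm 4 A, mul_assoc, mul_comm]
          congr 1
          rw [show (4 : ℝ≥0∞) = 2 * 2 by norm_num, one_div, mul_assoc,
            ENNReal.mul_inv_cancel two_ne_zero ENNReal.ofNat_ne_top, mul_one]
      _ ≤ 4 * A * (((2 : ℝ≥0∞) ^ δ)⁻¹ ^ k₀) * (ENNReal.ofReal δ * geomConst δ) := by
          gcongr
          exact one_le_ofReal_mul_geomConst h0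
      _ = ENNReal.ofReal δ * (4 * A * (((2 : ℝ≥0∞) ^ δ)⁻¹ ^ k₀ * geomConst δ)) := by ring
      _ ≤ ENNReal.ofReal δ * ∑' k, e k := by gcongr
      _ ≤ A := h
  rw [two_mul] at this
  exact absurd this (not_le.2 (ENNReal.lt_add_right hAt hA0))

/-- Some tent average at a small scale has slope controlled by the nonlocal energy. -/
theorem DoublingWith.exists_lintegral_slopeAt_tentAvg_le [BorelSpace X]
    [TopologicalSpace.SeparableSpace X] [Nonempty X] (hm : DoublingWith m D) {p δ : ℝ} (hp : 1 ≤ p)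
    (h0 : 0 < δ) (h1 : δ ≤ 1) {F : X → ℝ} (hF : Measurable F) {M : ℝ} (hM : ∀ y, |F y| ≤ M)
    {A : ℝ≥0∞} (hA0 : A ≠ 0) (hAt : A ≠ ∞)
    (hA : ENNReal.ofReal δ * nonlocalEnergy p (p + δ) m F ≤ A) {k₀ : ℕ} (hk₀ : δ * k₀ ≤ 1) :
    ∃ k, k₀ ≤ k ∧ ∫⁻ x, slopeAt (tentAvg m ((1 / 2) ^ k / 3) F) x ^ (p + δ) ∂m ≤
      (9 * D ^ 4) ^ (p + 1) * (4 * (geomConst p * A)) := by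
  have hp0 : 0 < p := by linarith
  have hD : (1 : ℝ≥0∞) ≤ D := by exact_mod_cast hm.one_le
  obtain ⟨k, hk, hle⟩ := exists_rpow_mul_le_of_tsum_le (e := dyadicEnergy p (p + δ) m F) h0
    (mul_ne_zero (geomConst_ne_zero p) hA0) (ENNReal.mul_ne_top (geomConst_ne_top hp0) hAt) (by
      calc ENNReal.ofReal δ * ∑' k, dyadicEnergy p (p + δ) m F k
          ≤ ENNReal.ofReal δ * (geomConst p * nonlocalEnergy p (p + δ) m F) := by
            gcongr
            exact hm.tsum_dyadicEnergy_le hp0 (by positivity) hF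
        _ = geomConst p * (ENNReal.ofReal δ * nonlocalEnergy p (p + δ) m F) := by ring
        _ ≤ _ := by gcongr) hk₀
  refine ⟨k, hk, (hm.lintegral_slopeAt_tentAvg_rpow_le hp h0 hF hM k).trans ?_⟩
  gcongr
  calc (1 : ℝ≥0∞) ≤ 9 * 1 ^ 4 := by norm_num
    _ ≤ 9 * D ^ 4 := by gcongr

end DyadicEnergy

/-! ### Dominated convergence in L^p. -/

section LpConvergence

variable {X : Type*} [MeasurableSpace X] {μ : Measure X}

theorem lintegral_enorm_rpow_eq_eLpNorm {p : ℝ} (hp : 0 < p) (g : X → ℝ) :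
    ∫⁻ x, ‖g x‖ₑ ^ p ∂μ = eLpNorm g (ENNReal.ofReal p) μ ^ p := by
  rw [eLpNorm_eq_eLpNorm' (by simpa using hp) ENNReal.ofReal_ne_top, ENNReal.toReal_ofReal hp.le,
    lintegral_rpow_enorm_eq_rpow_eLpNorm' hp]

/-- Dominated convergence in `L^p`. -/
theorem tendsto_eLpNorm_zero_of_dominated {p : ℝ} (hp : 0 < p) {g : ℕ → X → ℝ} {b : X → ℝ}
    (hg : ∀ n, Measurable (g n)) (hb : MemLp b (ENNReal.ofReal p) μ)
    (hgb : ∀ n x, |g n x| ≤ |b x|) (hlim : ∀ᵐ x ∂μ, Tendsto (fun n => g n x) atTop (𝓝 0)) :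
    Tendsto (fun n => eLpNorm (g n) (ENNReal.ofReal p) μ) atTop (𝓝 0) := by
  have h : Tendsto (fun n => ∫⁻ x, ‖g n x‖ₑ ^ p ∂μ) atTop (𝓝 (∫⁻ _x, 0 ∂μ)) := by
    refine tendsto_lintegral_of_dominated_convergence (fun x => ‖b x‖ₑ ^ p)
      (fun n => (hg n).enorm.pow_const p) (fun n => Eventually.of_forall fun x => ?_) ?_ ?_
    · refine ENNReal.rpow_le_rpow ?_ hp.le
      rw [enorm_le_iff_norm_le]
      exact hgb n x
    · rw [lintegral_enorm_rpow_eq_eLpNorm hp]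
      exact ENNReal.rpow_ne_top_of_nonneg hp.le hb.2.ne
    · filter_upwards [hlim] with x hx
      have h1 : Tendsto (fun n => ‖g n x‖ₑ) atTop (𝓝 0) := by
        simpa using hx.enorm
      simpa [ENNReal.zero_rpow_of_pos hp, Function.comp_def] using
        (ENNReal.continuous_rpow_const (y := p)).tendsto 0 |>.comp h1
  have h2 : ∀ n, eLpNorm (g n) (ENNReal.ofReal p) μ = (∫⁻ x, ‖g n x‖ₑ ^ p ∂μ) ^ p⁻¹ := fun n => by
    rw [lintegral_enorm_rpow_eq_eLpNorm hp, ENNReal.rpow_rpow_inv hp.ne']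
  simp only [h2]
  rw [lintegral_zero] at h
  simpa [ENNReal.zero_rpow_of_pos (inv_pos.2 hp), Function.comp_def] using
    (ENNReal.continuous_rpow_const (y := p⁻¹)).tendsto 0 |>.comp h

end LpConvergence

/-! ### Clipping and the energy of contractions. -/

section Truncation

/-- Truncation of a real number at height `M`. -/
noncomputable def clip (M t : ℝ) : ℝ := max (-M) (min M t)

theorem abs_clip_le {M : ℝ} (hM : 0 ≤ M) (t : ℝ) : |clip M t| ≤ M :=
  abs_le.2 ⟨le_max_left _ _, max_le (by linarith) (min_le_left _ _)⟩

theorem clip_of_abs_le {M t : ℝ} (h : |t| ≤ M) : clip M t = t := by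
  rw [clip, min_eq_right (abs_le.1 h).2, max_eq_right (abs_le.1 h).1]

theorem abs_clip_sub_clip_le (M s t : ℝ) : |clip M s - clip M t| ≤ |s - t| := by
  unfold clip
  refine (abs_max_sub_max_le_max _ _ _ _).trans (max_le (by simp) ?_)
  exact (abs_min_sub_min_le_max _ _ _ _).trans (max_le (by simp) le_rfl)

theorem abs_clip_le_abs {M : ℝ} (hM : 0 ≤ M) (t : ℝ) : |clip M t| ≤ |t| := by
  have h := abs_clip_sub_clip_le M t 0
  rwa [clip_of_abs_le (t := 0) (by simpa using hM), sub_zero, sub_zero] at h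

theorem measurable_clip (M : ℝ) : Measurable (clip M) :=
  measurable_const.max (measurable_const.min measurable_id)

variable {X : Type*} [MetricSpace X] [MeasurableSpace X] {m : Measure X} {D : ℝ≥0}

/-- Allows f to be replaced by a Borel representative. -/
theorem functionalJ_congr_ae (p : ℝ) {f g : X → ℝ} (h : f =ᵐ[m] g) (δ : ℝ) :
    functionalJ p m f δ = functionalJ p m g δ := by
  refine lintegral_congr_ae ?_
  filter_upwards [h] with x hx
  have hs : {y | |f x - f y| ≤ 1} =ᵐ[m] {y | |g x - g y| ≤ 1} := by
    filter_upwards [h] with y hy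
    exact congrArg (· ≤ 1) (by rw [hx, hy])
  rw [setLIntegral_congr hs]
  refine lintegral_congr_ae (ae_restrict_of_ae ?_)
  filter_upwards [h] with y hy
  rw [hx, hy]

theorem largeOscIntegral_congr_ae (p : ℝ) {f g : X → ℝ} (h : f =ᵐ[m] g) :
    largeOscIntegral p m f = largeOscIntegral p m g := by
  refine lintegral_congr_ae ?_
  filter_upwards [h] with x hx
  have hs : {y | 1 < |f x - f y|} =ᵐ[m] {y | 1 < |g x - g y|} := by
    filter_upwards [h] with y hy
    exact congrArg (1 < ·) (by rw [hx, hy])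
  rw [setLIntegral_congr hs]

/-- The nonlocal energy of a bounded contraction of `f`. -/
theorem DoublingWith.ofReal_mul_nonlocalEnergy_le [BorelSpace X]
    [TopologicalSpace.SeparableSpace X] (hm : DoublingWith m D) {p δ : ℝ} (hp : 0 < p) (h0 : 0 < δ)
    (h1 : δ ≤ 1) {f F : X → ℝ} (hf : Measurable f) (hFf : ∀ x y, |F x - F y| ≤ |f x - f y|)
    {N : ℝ} (hN : 1 ≤ N) (hFN : ∀ x y, |F x - F y| ≤ N) :
    ENNReal.ofReal δ * nonlocalEnergy p (p + δ) m F ≤ functionalJ p m f δ +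
      ENNReal.ofReal δ * (ENNReal.ofReal N ^ (p + 1) * largeOscIntegral p m f) := by
  have := hm.sigmaFinite
  have hpδ : 0 < p + δ := by positivity
  have hNt : ENNReal.ofReal N ^ (p + 1) ≠ ∞ :=
    ENNReal.rpow_ne_top_of_nonneg (by positivity) ENNReal.ofReal_ne_top
  have hs : ∀ x, MeasurableSet {y | 1 < |f x - f y|} := fun x =>
    measurableSet_lt measurable_const (measurable_const.sub hf).abs
  have hmeas : Measurable fun x => ∫⁻ y in {y | 1 < |f x - f y|}, 1 / pairWeight p m x y ∂m := by
    have hg : Measurable fun q : X × X => {q : X × X | 1 < |f q.1 - f q.2|}.indicator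
        (fun q => 1 / pairWeight p m q.1 q.2) q :=
      (measurable_const.div (hm.measurable_pairWeight p)).indicator
        (measurableSet_lt measurable_const
          ((hf.comp measurable_fst).sub (hf.comp measurable_snd)).abs)
    convert hg.lintegral_prod_right' (ν := m) using 2 with x
    rw [← lintegral_indicator (hs x)]
    rfl
  unfold nonlocalEnergy functionalJ largeOscIntegral
  rw [← lintegral_const_mul' _ _ hNt, ← lintegral_const_mul' _ _ ENNReal.ofReal_ne_top,
    ← lintegral_const_mul' _ _ ENNReal.ofReal_ne_top, ← lintegral_add_right]
  swap
  · exact (hmeas.const_mul _).const_mul _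
  refine lintegral_mono fun x => ?_
  have hcompl : {y | 1 < |f x - f y|}ᶜ = {y | |f x - f y| ≤ 1} := by
    ext y; simp
  -- Where f varies by at most 1, F varies less than f. Where f varies more, only |F(x) - F(y)| ≤ N
  -- is available, and N ≥ 1 permits replacing N^(p+δ) by N^(p+1), independent of δ.
  rw [← lintegral_add_compl _ (hs x), hcompl, mul_add, add_comm]
  refine add_le_add ?_ ?_
  · rw [← lintegral_const_mul' _ _ ENNReal.ofReal_ne_top]
    refine lintegral_mono fun y => ?_
    rw [← mul_div_assoc, edist_comm, ofReal_abs_sub_eq_edist, pairWeight]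
    gcongr
    rw [← ofReal_abs_sub_eq_edist, ← ofReal_abs_sub_eq_edist]
    exact ENNReal.ofReal_le_ofReal (hFf x y)
  · gcongr
    rw [← lintegral_const_mul' _ _ hNt]
    refine lintegral_mono fun y => ?_
    rw [mul_one_div, pairWeight]
    gcongr
    rw [edist_comm, ← ofReal_abs_sub_eq_edist]
    calc ENNReal.ofReal |F x - F y| ^ (p + δ) ≤ ENNReal.ofReal N ^ (p + δ) := by
          gcongr; exact hFN x y
      _ ≤ ENNReal.ofReal N ^ (p + 1) := by
          refine ENNReal.rpow_le_rpow_of_exponent_le (ENNReal.one_le_ofReal.2 hN) (by linarith)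

end Truncation

/-! ### Cutoff functions. -/

section Cutoff

variable {X : Type*} [MetricSpace X]

/-- A cutoff function equal to one on the ball of radius `R` and vanishing off the ball of radius
`2R`. -/
noncomputable def cutoff (x₀ : X) (R : ℝ) (x : X) : ℝ := max 0 (min 1 (2 - dist x x₀ / R))

theorem cutoff_nonneg (x₀ : X) (R : ℝ) (x : X) : 0 ≤ cutoff x₀ R x := le_max_left _ _

theorem cutoff_le_one (x₀ : X) (R : ℝ) (x : X) : cutoff x₀ R x ≤ 1 :=
  max_le zero_le_one (min_le_left _ _)

theorem abs_cutoff_le_one (x₀ : X) (R : ℝ) (x : X) : |cutoff x₀ R x| ≤ 1 := by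
  rw [abs_of_nonneg (cutoff_nonneg x₀ R x)]
  exact cutoff_le_one x₀ R x

theorem cutoff_eq_one {x₀ : X} {R : ℝ} (hR : 0 < R) {x : X} (h : dist x x₀ ≤ R) :
    cutoff x₀ R x = 1 := by
  have : dist x x₀ / R ≤ 1 := (div_le_one hR).2 h
  rw [cutoff, min_eq_left (by linarith), max_eq_right zero_le_one]

theorem cutoff_eq_zero {x₀ : X} {R : ℝ} (hR : 0 < R) {x : X}
    (h : x ∉ Metric.closedBall x₀ (2 * R)) : cutoff x₀ R x = 0 := by
  rw [Metric.mem_closedBall, not_le] at h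
  have : 2 ≤ dist x x₀ / R := (le_div_iff₀ hR).2 h.le
  exact max_eq_left ((min_le_right _ _).trans (by linarith))

theorem abs_cutoff_sub_le {x₀ : X} {R : ℝ} (hR : 1 ≤ R) (x y : X) :
    |cutoff x₀ R x - cutoff x₀ R y| ≤ dist x y := by
  unfold cutoff
  refine (abs_max_sub_max_le_max _ _ _ _).trans (max_le (by simp) ?_)
  refine (abs_min_sub_min_le_max _ _ _ _).trans (max_le (by simp) ?_)
  have h : 2 - dist x x₀ / R - (2 - dist y x₀ / R) = (dist y x₀ - dist x x₀) / R := by ring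
  rw [h, abs_div, abs_of_pos (by linarith : 0 < R), div_le_iff₀ (by linarith)]
  calc |dist y x₀ - dist x x₀| ≤ dist y x := abs_dist_sub_le y x x₀
    _ = dist x y * 1 := by rw [dist_comm, mul_one]
    _ ≤ dist x y * R := by gcongr

theorem continuous_cutoff (x₀ : X) (R : ℝ) : Continuous (cutoff x₀ R) := by
  unfold cutoff
  fun_prop

/-- The Leibniz rule; R ≥ 1 makes the cutoff 1-Lipschitz, so the bounds do not depend on R. -/
theorem abs_cutoff_mul_sub_le {x₀ : X} {R : ℝ} (hR : 1 ≤ R) (G : X → ℝ) (x y : X) :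
    |cutoff x₀ R x * G x - cutoff x₀ R y * G y| ≤ |G x| * dist x y + |G x - G y| := by
  have h : cutoff x₀ R x * G x - cutoff x₀ R y * G y =
      G x * (cutoff x₀ R x - cutoff x₀ R y) + cutoff x₀ R y * (G x - G y) := by ring
  rw [h]
  refine (abs_add_le _ _).trans (add_le_add ?_ ?_)
  · rw [abs_mul]
    gcongr
    exact abs_cutoff_sub_le hR x y
  · rw [abs_mul]
    exact mul_le_of_le_one_left (abs_nonneg _) (abs_cutoff_le_one x₀ R y)

theorem isLipBS_cutoff_mul {x₀ : X} {R : ℝ} (hR : 1 ≤ R) {G : X → ℝ} {L : ℝ≥0}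
    (hG : LipschitzWith L G) {M : ℝ} (hM : ∀ x, |G x| ≤ M) :
    IsLipBS fun x => cutoff x₀ R x * G x := by
  have hM0 : 0 ≤ M := (abs_nonneg _).trans (hM x₀)
  refine ⟨⟨M.toNNReal + L, LipschitzWith.of_dist_le_mul fun x y => ?_⟩,
    (Metric.isBounded_closedBall (x := x₀) (r := 2 * R)).subset fun x hx => ?_⟩
  · rw [Real.dist_eq, NNReal.coe_add, Real.coe_toNNReal _ hM0, add_mul]
    refine (abs_cutoff_mul_sub_le hR G x y).trans (add_le_add ?_ ?_)
    · gcongr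
      exact hM x
    · rw [← Real.dist_eq]
      exact hG.dist_le_mul x y
  · by_contra h
    exact hx (by simp [cutoff_eq_zero (by linarith : 0 < R) h])

theorem slopeAt_cutoff_mul_le {x₀ : X} {R : ℝ} (hR : 1 ≤ R) (G : X → ℝ) (x : X) :
    slopeAt (fun x => cutoff x₀ R x * G x) x ≤
      (Metric.closedBall x₀ (2 * R)).indicator (fun x => ‖G x‖ₑ + slopeAt G x) x := by
  by_cases hx : x ∈ Metric.closedBall x₀ (2 * R)
  · rw [Set.indicator_of_mem hx]
    refine slopeAt_le_const_add (Eventually.of_forall fun y => ?_)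
    rw [edist_dist (cutoff x₀ R x * G x), edist_dist (G x), edist_dist x, ← ofReal_norm,
      ← ENNReal.ofReal_mul (norm_nonneg _), ← ENNReal.ofReal_add (by positivity) dist_nonneg]
    exact ENNReal.ofReal_le_ofReal (abs_cutoff_mul_sub_le hR G x y)
  · rw [Set.indicator_of_notMem hx, slopeAt_eq_zero_of_eventuallyEq_zero]
    filter_upwards [Metric.isClosed_closedBall.isOpen_compl.mem_nhds hx] with y hy
    rw [cutoff_eq_zero (by linarith) hy, zero_mul]

theorem IsLipBS.memLp [MeasurableSpace X] [BorelSpace X] {m : Measure X} {D : ℝ≥0}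
    (hm : DoublingWith m D) {u : X → ℝ} (hu : IsLipBS u) (p : ℝ≥0∞) : MemLp u p m := by
  obtain ⟨M, hM⟩ := hu.exists_bound
  obtain ⟨⟨K, hK⟩, hb⟩ := hu
  have hmu := hK.continuous.measurable
  have hs : MeasurableSet (Function.support u) := measurableSet_support hmu
  have hfin : IsFiniteMeasure (m.restrict (Function.support u)) :=
    ⟨by rw [Measure.restrict_apply_univ]; exact hm.measure_lt_top_of_isBounded hb⟩
  rw [← Set.indicator_support (f := u), memLp_indicator_iff_restrict hs]
  refine MemLp.of_bound hmu.aestronglyMeasurable M (Eventually.of_forall fun x => ?_)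
  have := hM x
  rwa [enorm_le_coe, ← NNReal.coe_le_coe, coe_nnnorm] at this

end Cutoff

/-! ### Finite functionals imply finite Cheeger energy. -/

section Backward

/-- Splitting at t = 1/s trades the exponent p+δ for p. On a set of finite measure, s is taken large
to control the first term, and then δ small to keep s^δ bounded. -/
theorem ENNReal.rpow_le_add_mul_rpow {t s : ℝ≥0∞} {p δ : ℝ} (hp : 0 < p) (hδ : 0 < δ) (ht : t ≠ ∞)
    (hs0 : s ≠ 0) (hst : s ≠ ∞) : t ^ p ≤ s⁻¹ ^ p + s ^ δ * t ^ (p + δ) := by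
  rcases le_total t s⁻¹ with h | h
  · exact (ENNReal.rpow_le_rpow h hp.le).trans le_self_add
  · refine le_trans ?_ le_add_self
    have h1 : 1 ≤ s * t := by
      rw [← ENNReal.mul_inv_cancel hs0 hst]
      gcongr
    have ht0 : t ≠ 0 := fun h0 => by simp [h0] at h1
    calc t ^ p = 1 * t ^ p := (one_mul _).symm
      _ ≤ (s * t) ^ δ * t ^ p := by
        gcongr
        exact ENNReal.one_le_rpow h1 hδ
      _ = _ := by
        rw [ENNReal.mul_rpow_of_nonneg _ _ hδ.le, add_comm p δ, ENNReal.rpow_add _ _ ht0 ht, mul_assoc]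

theorem ofReal_mul_le_one_of_le_natCast {δ : ℝ} (h0 : 0 ≤ δ) {a : ℝ≥0∞} {N : ℕ} (ha : a ≤ N)
    (hN : δ * N ≤ 1) : ENNReal.ofReal δ * a ≤ 1 := by
  calc ENNReal.ofReal δ * a ≤ ENNReal.ofReal δ * N := by gcongr
    _ = ENNReal.ofReal (δ * N) := by rw [ENNReal.ofReal_mul h0, ENNReal.ofReal_natCast]
    _ ≤ 1 := ENNReal.ofReal_le_one.2 hN

theorem ENNReal.rpow_le_two_of_le_natCast {δ : ℝ} (h0 : 0 ≤ δ) {a : ℝ≥0∞} {N : ℕ} (ha : a ≤ N)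
    (hN : δ * N ≤ 1) : a ^ δ ≤ 2 := by
  have h2 : (N : ℝ≥0∞) ≤ 2 ^ N := by exact_mod_cast Nat.lt_two_pow_self.le
  calc a ^ δ ≤ ((2 : ℝ≥0∞) ^ N) ^ δ := by gcongr; exact ha.trans h2
    _ = 2 ^ (δ * N) := by rw [← ENNReal.rpow_natCast, ← ENNReal.rpow_mul, mul_comm]
    _ ≤ 2 ^ (1 : ℝ) := ENNReal.rpow_le_rpow_of_exponent_le ENNReal.one_lt_two.le hN
    _ = 2 := ENNReal.rpow_one 2

variable {X : Type*} [MetricSpace X] [MeasurableSpace X] [BorelSpace X] {m : Measure X} {D : ℝ≥0}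

theorem tendsto_eLpNorm_cutoff_mul_clip_sub {p : ℝ} (hp : 0 < p) {f : X → ℝ} (hf : Measurable f)
    (hfp : MemLp f (ENNReal.ofReal p) m) (x₀ : X) :
    Tendsto (fun n : ℕ => eLpNorm ((fun x => cutoff x₀ (n + 1) x * clip (n + 1) (f x)) - f)
      (ENNReal.ofReal p) m) atTop (𝓝 0) := by
  refine tendsto_eLpNorm_zero_of_dominated hp (b := fun x => 2 * f x)
    (fun n => ((continuous_cutoff x₀ _).measurable.mul ((measurable_clip _).comp hf)).sub hf)
    (hfp.const_mul 2) (fun n x => ?_) (Eventually.of_forall fun x => ?_)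
  · rw [Pi.sub_apply, abs_mul, abs_two, two_mul]
    refine (abs_sub _ _).trans (add_le_add ?_ le_rfl)
    rw [abs_mul]
    exact (mul_le_of_le_one_left (abs_nonneg _) (abs_cutoff_le_one _ _ _)).trans
      (abs_clip_le_abs (by positivity) _)
  · obtain ⟨N, hN⟩ := exists_nat_ge (max (dist x x₀) |f x|)
    refine tendsto_const_nhds.congr' ?_
    filter_upwards [eventually_ge_atTop N] with n hn
    have hn' : (N : ℝ) ≤ n := by exact_mod_cast hn
    rw [Pi.sub_apply, cutoff_eq_one (by positivity) (by linarith [le_max_left (dist x x₀) |f x|]),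
      clip_of_abs_le (by linarith [le_max_right (dist x x₀) |f x|]), one_mul, sub_self]

variable [TopologicalSpace.SeparableSpace X]

namespace DoublingWith

/-- Tent averages of truncations with small slope and close to the truncation in `L^p`. -/
theorem exists_tentAvg_approx (hm : DoublingWith m D) {p : ℝ} (hp : 1 < p) {f : X → ℝ}
    (hf : Measurable f) {A : ℝ≥0∞} (hAt : A ≠ ∞)
    (hJ : ∀ δ ∈ Set.Ioo (0 : ℝ) 1, functionalJ p m f δ ≤ A) (hI : largeOscIntegral p m f ≠ ∞)
    (x₀ : X) (R : ℝ) {M : ℝ} (hM : 1 ≤ M) {ε : ℝ≥0∞} (hε : 0 < ε) :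
    ∃ r, 0 < r ∧ eLpNorm (tentAvg m r (fun x => clip M (f x)) - fun x => clip M (f x))
        (ENNReal.ofReal p) (m.restrict (Metric.closedBall x₀ R)) ≤ ε ∧
      ∫⁻ x in Metric.closedBall x₀ R, slopeAt (tentAvg m r fun x => clip M (f x)) x ^ p ∂m ≤
        1 + 2 * ((9 * D ^ 4) ^ (p + 1) * (4 * (geomConst p * (A + 1)))) := by
  have : Nonempty X := ⟨x₀⟩
  have hp0 : 0 < p := by linarith
  have hM0 : 0 ≤ M := by linarith
  set F : X → ℝ := fun x => clip M (f x) with hFdef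
  have hF : Measurable F := (measurable_clip M).comp hf
  have hFM : ∀ x, |F x| ≤ M := fun x => abs_clip_le hM0 _
  set B := Metric.closedBall x₀ R with hB
  have hBt : m B < ∞ := hm.measure_lt_top_of_isBounded Metric.isBounded_closedBall
  have hfinB : IsFiniteMeasure (m.restrict B) := ⟨by rwa [Measure.restrict_apply_univ]⟩
  have hr : ∀ k : ℕ, (0 : ℝ) < (1 / 2) ^ k / 3 := fun k => by positivity
  have hr0 : Tendsto (fun k : ℕ => (1 / 2 : ℝ) ^ k / 3) atTop (𝓝 0) := by
    simpa using (tendsto_pow_atTop_nhds_zero_of_lt_one (by norm_num) (by norm_num :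
      (1 / 2 : ℝ) < 1)).div_const 3
  have hGc : ∀ k : ℕ, Continuous (tentAvg m ((1 / 2) ^ k / 3) F) := fun k => by
    obtain ⟨L, hL⟩ := hm.exists_lipschitzWith_tentAvg (hr k) hF hFM
    exact hL.continuous
  have hlim : Tendsto (fun k : ℕ => eLpNorm (tentAvg m ((1 / 2) ^ k / 3) F - F)
      (ENNReal.ofReal p) (m.restrict B)) atTop (𝓝 0) := by
    refine tendsto_eLpNorm_zero_of_dominated hp0 (b := fun _ => 2 * M)
      (fun k => (hGc k).measurable.sub hF) (memLp_const _) (fun k x => ?_)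
      (ae_restrict_of_ae ?_)
    · rw [Pi.sub_apply, abs_of_nonneg (by positivity : 0 ≤ 2 * M)]
      refine (abs_sub _ _).trans ?_
      linarith [hm.abs_tentAvg_le (hr k) hF hFM x, hFM x]
    · filter_upwards [hm.ae_tendsto_tentAvg hF hFM hr hr0] with x hx
      simpa using hx.sub_const (F x)
  obtain ⟨k₀, hk₀⟩ := eventually_atTop.1 (hlim.eventually_le_const hε)
  -- Chosen so that s^(-p) m(B) ≤ 1. The added 1 makes s ≥ 1, hence nonzero.
  set s : ℝ≥0∞ := (1 + m B) ^ p⁻¹ with hs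
  have h1B : 1 ≤ 1 + m B := le_self_add
  have hs0 : s ≠ 0 := by
    have : 1 ≤ s := ENNReal.one_le_rpow h1B (inv_pos.2 hp0)
    exact (zero_lt_one.trans_le this).ne'
  have hst : s ≠ ∞ := ENNReal.rpow_ne_top_of_nonneg (inv_pos.2 hp0).le (by finiteness)
  set Q : ℝ≥0∞ := ENNReal.ofReal (2 * M) ^ (p + 1) * largeOscIntegral p m f with hQ
  have hQt : Q ≠ ∞ := ENNReal.mul_ne_top
    (ENNReal.rpow_ne_top_of_nonneg (by positivity) ENNReal.ofReal_ne_top) hI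
  obtain ⟨N₁, hN₁⟩ := ENNReal.exists_nat_gt hst
  obtain ⟨N₂, hN₂⟩ := ENNReal.exists_nat_gt hQt
  -- One δ meets all demands: N₁ forces s^δ ≤ 2, N₂ makes the large-oscillation term δQ at most 1,
  -- and k₀ lets the good scale be taken fine enough for the L^p error. The summand 2 ensures δ < 1.
  set δ : ℝ := 1 / (N₁ + N₂ + k₀ + 2) with hδ
  have hδ0 : 0 < δ := by positivity
  have hδmul : ∀ a : ℝ, a ≤ N₁ + N₂ + k₀ + 2 → δ * a ≤ 1 := fun a ha => by
    rw [hδ, one_div_mul_eq_div]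
    exact (div_le_one (by positivity)).2 ha
  have hδ1 : δ < 1 := by
    rw [hδ, div_lt_one (by positivity)]
    have : (0 : ℝ) ≤ N₁ + N₂ + k₀ := by positivity
    linarith
  have hcast : (0 : ℝ) ≤ N₁ ∧ (0 : ℝ) ≤ N₂ ∧ (0 : ℝ) ≤ k₀ :=
    ⟨Nat.cast_nonneg _, Nat.cast_nonneg _, Nat.cast_nonneg _⟩
  have hE : ENNReal.ofReal δ * nonlocalEnergy p (p + δ) m F ≤ A + 1 :=
    (hm.ofReal_mul_nonlocalEnergy_le hp0 hδ0 hδ1.le hf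
      (fun x y => abs_clip_sub_clip_le M (f x) (f y)) (N := 2 * M) (by linarith) (fun x y =>
        (abs_sub _ _).trans (by linarith [hFM x, hFM y]))).trans
      (add_le_add (hJ δ ⟨hδ0, hδ1⟩)
        (ofReal_mul_le_one_of_le_natCast hδ0.le hN₂.le (hδmul _ (by linarith))))
  obtain ⟨k, hk, hslope⟩ := hm.exists_lintegral_slopeAt_tentAvg_le hp.le hδ0 hδ1.le hF hFM
    (by simp) (by finiteness) hE (hδmul k₀ (by linarith))
  refine ⟨_, hr k, hk₀ k hk, ?_⟩
  obtain ⟨L, hL⟩ := hm.exists_lipschitzWith_tentAvg (hr k) hF hFM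
  set G := tentAvg m ((1 / 2) ^ k / 3) F
  have hsδ : s ^ δ ≤ 2 := ENNReal.rpow_le_two_of_le_natCast hδ0.le hN₁.le (hδmul _ (by linarith))
  calc ∫⁻ x in B, slopeAt G x ^ p ∂m
      ≤ ∫⁻ x in B, (s⁻¹ ^ p + s ^ δ * slopeAt G x ^ (p + δ)) ∂m :=
        lintegral_mono fun x => ENNReal.rpow_le_add_mul_rpow hp0 hδ0
          ((hL.slopeAt_le x).trans_lt ENNReal.coe_lt_top).ne hs0 hst
    _ = s⁻¹ ^ p * m B + s ^ δ * ∫⁻ x in B, slopeAt G x ^ (p + δ) ∂m := by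
        rw [lintegral_add_left measurable_const, setLIntegral_const,
          lintegral_const_mul' _ _ (hsδ.trans_lt ENNReal.ofNat_lt_top).ne]
    _ ≤ 1 + 2 * ∫⁻ x, slopeAt G x ^ (p + δ) ∂m := by
        gcongr
        · rw [ENNReal.inv_rpow, hs, ENNReal.rpow_inv_rpow hp0.ne', mul_comm, ← div_eq_mul_inv]
          exact ENNReal.div_le_of_le_mul (by rw [one_mul]; exact le_add_self)
        · exact Measure.restrict_le_self
    _ ≤ _ := by gcongr

/-- The tent average is localised by a cutoff. The new slope is at most |G| + lip(G) on the ball of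
radius 2R. Closeness of G to the clipped function bounds the first part by the norm of f, so the
energy bound is independent of R and ε. -/
theorem exists_isLipBS_approx (hm : DoublingWith m D) {p : ℝ} (hp : 1 < p) {f : X → ℝ}
    (hf : Measurable f) {A : ℝ≥0∞} (hAt : A ≠ ∞)
    (hJ : ∀ δ ∈ Set.Ioo (0 : ℝ) 1, functionalJ p m f δ ≤ A) (hI : largeOscIntegral p m f ≠ ∞)
    (x₀ : X) {R : ℝ} (hR : 1 ≤ R) {ε : ℝ≥0∞} (hε : 0 < ε) (hε1 : ε ≤ 1) :
    ∃ u, IsLipBS u ∧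
      eLpNorm (u - fun x => cutoff x₀ R x * clip R (f x)) (ENNReal.ofReal p) m ≤ ε ∧
      ∫⁻ x, slopeAt u x ^ p ∂m ≤ 2 ^ (p - 1) * ((1 + eLpNorm f (ENNReal.ofReal p) m) ^ p +
        (1 + 2 * ((9 * D ^ 4) ^ (p + 1) * (4 * (geomConst p * (A + 1)))))) := by
  have hp0 : 0 < p := by linarith
  have hR0 : 0 < R := by linarith
  have hp1 : 1 ≤ ENNReal.ofReal p := ENNReal.one_le_ofReal.2 hp.le
  obtain ⟨r, hr, hdist, hslope⟩ := hm.exists_tentAvg_approx hp hf hAt hJ hI x₀ (2 * R) hR hε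
  set F : X → ℝ := fun x => clip R (f x) with hFdef
  have hF : Measurable F := (measurable_clip R).comp hf
  have hFM : ∀ x, |F x| ≤ R := fun x => abs_clip_le hR0.le _
  obtain ⟨L, hL⟩ := hm.exists_lipschitzWith_tentAvg hr hF hFM
  have hGM := hm.abs_tentAvg_le hr hF hFM
  set G := tentAvg m r F
  have hGm : Measurable G := hL.continuous.measurable
  set B := Metric.closedBall x₀ (2 * R) with hB
  have hBm : MeasurableSet B := Metric.isClosed_closedBall.measurableSet
  refine ⟨fun x => cutoff x₀ R x * G x, isLipBS_cutoff_mul hR hL hGM, ?_, ?_⟩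
  · refine le_trans ?_ hdist
    rw [← eLpNorm_indicator_eq_eLpNorm_restrict hBm]
    refine eLpNorm_mono fun x => ?_
    by_cases hx : x ∈ B
    · rw [Set.indicator_of_mem hx, Pi.sub_apply, Pi.sub_apply, ← mul_sub, norm_mul]
      exact mul_le_of_le_one_left (norm_nonneg _) (abs_cutoff_le_one x₀ R x)
    · simp [cutoff_eq_zero hR0 hx]
  · have hGF : eLpNorm G (ENNReal.ofReal p) (m.restrict B) ≤
        1 + eLpNorm f (ENNReal.ofReal p) m := by
      calc eLpNorm G (ENNReal.ofReal p) (m.restrict B)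
          = eLpNorm ((G - F) + F) (ENNReal.ofReal p) (m.restrict B) := by rw [sub_add_cancel]
        _ ≤ eLpNorm (G - F) (ENNReal.ofReal p) (m.restrict B) +
            eLpNorm F (ENNReal.ofReal p) (m.restrict B) :=
            eLpNorm_add_le (hGm.sub hF).aestronglyMeasurable hF.aestronglyMeasurable hp1
        _ ≤ 1 + eLpNorm f (ENNReal.ofReal p) m := by
            refine add_le_add (hdist.trans hε1) ((eLpNorm_restrict_le _ _ _ _).trans ?_)
            exact eLpNorm_mono fun x => abs_clip_le_abs hR0.le (f x)
    have h2 : (2 : ℝ≥0∞) ^ (p - 1) ≠ ∞ :=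
      ENNReal.rpow_ne_top_of_nonneg (by linarith) ENNReal.ofNat_ne_top
    calc ∫⁻ x, slopeAt (fun x => cutoff x₀ R x * G x) x ^ p ∂m
        ≤ ∫⁻ x, B.indicator (fun x => 2 ^ (p - 1) * (‖G x‖ₑ ^ p + slopeAt G x ^ p)) x ∂m := by
          refine lintegral_mono fun x => ?_
          have h := ENNReal.rpow_le_rpow (slopeAt_cutoff_mul_le (x₀ := x₀) hR G x) hp0.le
          refine h.trans ?_
          by_cases hx : x ∈ B
          · rw [Set.indicator_of_mem hx, Set.indicator_of_mem hx, mul_add]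
            exact ENNReal.rpow_add_le_mul_rpow_add_rpow _ _ hp.le |>.trans_eq (by ring)
          · rw [Set.indicator_of_notMem hx, Set.indicator_of_notMem hx,
              ENNReal.zero_rpow_of_pos hp0]
      _ = 2 ^ (p - 1) * (eLpNorm G (ENNReal.ofReal p) (m.restrict B) ^ p +
          ∫⁻ x in B, slopeAt G x ^ p ∂m) := by
          rw [lintegral_indicator hBm, lintegral_const_mul' _ _ h2,
            lintegral_add_left (hGm.enorm.pow_const p), lintegral_enorm_rpow_eq_eLpNorm hp0]
      _ ≤ _ := by gcongr

/-- Uniform finiteness of the nonlocal energies implies finiteness of the Cheeger energy. -/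
theorem cheegerEnergy_lt_top_of_nonlocal_finite (hm : DoublingWith m D) {p : ℝ} (hp : 1 < p)
    {f : X → ℝ} (hfp : MemLp f (ENNReal.ofReal p) m)
    (hJ : sSup (functionalJ p m f '' Set.Ioo 0 1) < ∞) (hI : largeOscIntegral p m f < ∞) :
    cheegerEnergy p m f < ∞ := by
  have hp0 : 0 < p := by linarith
  have hp1 : 1 ≤ ENNReal.ofReal p := ENNReal.one_le_ofReal.2 hp.le
  -- Product measurability and the pointwise clipping need a Borel representative.
  obtain ⟨g, hg, hfg⟩ := hfp.1.aemeasurable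
  have hgp : MemLp g (ENNReal.ofReal p) m := (memLp_congr_ae hfg).1 hfp
  set A := sSup (functionalJ p m f '' Set.Ioo 0 1) with hA
  have hJg : ∀ δ ∈ Set.Ioo (0 : ℝ) 1, functionalJ p m g δ ≤ A := fun δ hδ => by
    rw [← functionalJ_congr_ae p hfg]
    exact le_sSup ⟨δ, hδ, rfl⟩
  have hIg : largeOscIntegral p m g ≠ ∞ := by
    rw [← largeOscIntegral_congr_ae p hfg]
    exact hI.ne
  set C : ℝ≥0∞ := 2 ^ (p - 1) * ((1 + eLpNorm g (ENNReal.ofReal p) m) ^ p +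
    (1 + 2 * ((9 * D ^ 4) ^ (p + 1) * (4 * (geomConst p * (A + 1)))))) with hC
  have hCt : C ≠ ∞ := by
    have h1 : (2 : ℝ≥0∞) ^ (p - 1) ≠ ∞ :=
      ENNReal.rpow_ne_top_of_nonneg (by linarith) ENNReal.ofNat_ne_top
    have h2 : (1 + eLpNorm g (ENNReal.ofReal p) m) ^ p ≠ ∞ :=
      ENNReal.rpow_ne_top_of_nonneg hp0.le (ENNReal.add_ne_top.2 ⟨ENNReal.one_ne_top, hgp.2.ne⟩)
    have h3 : (9 * (D : ℝ≥0∞) ^ 4) ^ (p + 1) ≠ ∞ :=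
      ENNReal.rpow_ne_top_of_nonneg (by positivity) (by finiteness)
    have h4 := geomConst_ne_top hp0
    have h5 := hJ.ne
    finiteness
  rcases isEmpty_or_nonempty X with hX | ⟨⟨x₀⟩⟩
  · have h0 : ∀ u : X → ℝ, u = 0 := fun u => funext fun x => (hX.false x).elim
    refine (iInf₂_le_of_le (fun _ => 0) (fun _ => ⟨⟨⟨0, fun x => (hX.false x).elim⟩, by simp⟩,
      MemLp.zero⟩) (iInf_le_of_le (by simp [h0 f]) le_rfl)).trans_lt ?_
    simp [Measure.eq_zero_of_isEmpty m]
  · have key : ∀ n : ℕ, ∃ u, IsLipBS u ∧ eLpNorm (u - fun x => cutoff x₀ (n + 1) x *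
        clip (n + 1) (g x)) (ENNReal.ofReal p) m ≤ ((n : ℝ≥0∞) + 1)⁻¹ ∧
        ∫⁻ x, slopeAt u x ^ p ∂m ≤ C := fun n =>
      hm.exists_isLipBS_approx hp hg hJ.ne hJg hIg x₀ (by simp)
        (ENNReal.inv_pos.2 (by finiteness)) (ENNReal.inv_le_one.2 (by simp))
    choose u hu hdist hslope using key
    have hconv : Tendsto (fun n => eLpNorm (u n - f) (ENNReal.ofReal p) m) atTop (𝓝 0) := by
      have h0 : Tendsto (fun n : ℕ => ((n : ℝ≥0∞) + 1)⁻¹) atTop (𝓝 0) := by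
        have := (tendsto_add_atTop_iff_nat 1).2 ENNReal.tendsto_inv_nat_nhds_zero
        simpa using this
      have hadd := h0.add (tendsto_eLpNorm_cutoff_mul_clip_sub hp0 hg hgp x₀)
      rw [add_zero] at hadd
      refine tendsto_of_tendsto_of_tendsto_of_le_of_le tendsto_const_nhds hadd
        (fun _ => bot_le) fun n => ?_
      have hcm : Measurable fun x => cutoff x₀ ((n : ℝ) + 1) x * clip (n + 1) (g x) :=
        (continuous_cutoff x₀ _).measurable.mul ((measurable_clip _).comp hg)
      obtain ⟨⟨L, hL⟩, -⟩ := hu n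
      have hum := hL.continuous.measurable
      calc eLpNorm (u n - f) (ENNReal.ofReal p) m = eLpNorm (u n - g) (ENNReal.ofReal p) m := by
            refine eLpNorm_congr_ae ?_
            filter_upwards [hfg] with x hx
            simp [hx]
        _ = eLpNorm ((u n - fun x => cutoff x₀ ((n : ℝ) + 1) x * clip (n + 1) (g x)) +
            ((fun x => cutoff x₀ ((n : ℝ) + 1) x * clip (n + 1) (g x)) - g))
            (ENNReal.ofReal p) m := by rw [sub_add_sub_cancel]
        _ ≤ _ := (eLpNorm_add_le (hum.sub hcm).aestronglyMeasurable
            (hcm.sub hg).aestronglyMeasurable hp1).trans (by gcongr; exact hdist n)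
    have hle : cheegerEnergy p m f ≤ liminf (fun n => ∫⁻ x, slopeAt (u n) x ^ p ∂m) atTop :=
      iInf₂_le_of_le u (fun n => ⟨hu n, (hu n).memLp hm _⟩) (iInf_le_of_le hconv le_rfl)
    refine (hle.trans ?_).trans_lt hCt.lt_top
    exact liminf_le_of_frequently_le' (Eventually.of_forall hslope).frequently

end DoublingWith

end Backward

/-! ### The characterisation of the Sobolev space. -/

theorem mainTheorem3 {X : Type*} [MetricSpace X] [CompleteSpace X]
    [TopologicalSpace.SeparableSpace X] [MeasurableSpace X] [BorelSpace X]
    (m : Measure X) (p : ℝ) (hp : 1 < p) (hPI : IsPISpace p m)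
    (f : X → ℝ) (hf : MemLp f (ENNReal.ofReal p) m) :
    f ∈ sobolevW1 p m ↔
      sSup (functionalJ p m f '' Set.Ioo 0 1) < ∞ ∧ largeOscIntegral p m f < ∞ := by
  -- For the zero measure both sides hold trivially. Otherwise doubling makes all balls positive, as
  -- the estimates require.
  rcases eq_or_ne m 0 with rfl | hm0
  · have h1 : cheegerEnergy p (0 : Measure X) f < ∞ := by
      refine (iInf₂_le_of_le (fun _ => 0) (fun _ => ⟨⟨⟨0, LipschitzWith.const 0⟩, by simp⟩,
        MemLp.zero⟩) (iInf_le_of_le (by simp) le_rfl)).trans_lt ?_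
      simp
    have h2 : sSup (functionalJ p (0 : Measure X) f '' Set.Ioo 0 1) < ∞ := by
      refine lt_of_le_of_lt (sSup_le ?_) ENNReal.zero_lt_top
      rintro _ ⟨δ, -, rfl⟩
      simp [functionalJ]
    have h3 : largeOscIntegral p (0 : Measure X) f < ∞ := by simp [largeOscIntegral]
    exact iff_of_true ⟨hf, h1⟩ ⟨h2, h3⟩
  · obtain ⟨D, -, hD⟩ := hPI.doubling
    obtain ⟨C, hC, hP⟩ := hPI.poincare
    have hm := doublingWith_of_ne_zero hPI.ball_finite hD hm0
    exact ⟨fun h => hm.nonlocal_finite_of_cheegerEnergy_lt_top hp hC hP hf.1 h.2,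
      fun h => ⟨hf, hm.cheegerEnergy_lt_top_of_nonlocal_finite hp hf h.1 h.2⟩⟩
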